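/- Let $u,v\in\mathbb C$ with $|e^u|<1$ and $\phi\in\mathbb R$, put $p=e^{i\phi}$ (so $\arg p=\phi$), $\arg e^u=\operatorname{Im}u$, and $\theta_0=\pi+\arg e^u-\arg p$. Functions of $\zeta$ are functions on the universal covering of $\mathbb C^*$, on which $\arg\zeta$ and $\zeta^{1/2}$ are well defined. **Setting.** Let $T^{\rm test}=\mathbb C[z,z^{-1}]\oplus\mathbb C^2$, with elements $\hat X=(X(z),X_v,X_u)$, $X(z)=\sum_n X_nz^n$, and basis $e_m=(z^m,0,0)$ $(m\in\mathbb Z)$, $e_v=(0,1,0)$, $e_u=(0,0,1)$. At the point $\hat\lambda_0=(z,v,u)$ of the 2D Toda Dubrovin–Frobenius manifold, multiplication by the Euler vector field and the grading operator act on $T^{\rm test}$ by $$\mathcal U\hat X=\big((v+2e^uz^{-1})X(z)+2e^uX_u,\ 2e^uX_1+vX_v,\ 2X_v+vX_u\big),\qquad \mathcal V\hat X=\big(-\tfrac12X(z)+zX'(z),\,-\tfrac12X_v,\,\tfrac12X_u\big).$$ A weak functional is a linear functional on $T^{\rm test}$. A family $\xi(\zeta)$ of weak functionals is a weak solution of the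 Dubrovin equation if $\partial_\zeta\langle\xi,\hat X\rangle=\langle\xi,(\mathcal U-\zeta^{-1}\mathcal V)\hat X\rangle$ for all $\hat X\in T^{\rm test}$. **Formal solution.** Let $\lambda(z)=z-v-e^uz^{-1}$, $\bar\lambda(z)=v+e^uz^{-1}$, $\lambda_\sigma=\sigma\bar\lambda+(\sigma-1)\lambda$, $\sigma=\sigma(p)=\lambda'(p)/(\lambda'(p)+\bar\lambda'(p))=1+e^u/p^2$, and $u_p=\lambda_{\sigma(p)}(p)=v+2e^u/p$. Let $$\langle d\lambda_\sigma(z),\hat X\rangle=\sigma\sum_{n\ge1}X_nz^n+(\sigma-1)\sum_{n\le0}X_nz^n+X_v+e^uX_uz^{-1}.$$ Then $\lambda_\sigma(z)-u_p=\frac{e^u}{z}\left(\frac zp-1\right)^2$. Near $z=p$ let $(\lambda_\sigma(z)-u_p)^{1/2}=\left(\frac zp-1\right)\left(\frac{e^u}{z}\right)^{1/2}$, with the determination $(e^u/p)^{1/2}=-e^{(u-i\phi)/2}$ at $z=p$. The formal integral solution is $$\langle dy_p^{\rm formal},\hat X\rangle=e^{\zeta u_p}\sum_{k\ge0}\langle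 r_p^k,\hat X\rangle\zeta^{-k},\qquad \langle r_p^k,\hat X\rangle=\frac1{2\Gamma(\frac12-k)}\,\frac1{2\pi i}\oint_p\frac{\langle d\lambda_\sigma(z),\hat X\rangle}{(\lambda_\sigma(z)-u_p)^{k+1/2}}\,\frac{dz}z,$$ where $\oint_p$ is taken along a small counterclockwise circle around $p$. **Resummed weak functional.** Let $K_m=\lim_{\mu\to m}K_\mu$ be the modified Bessel function of the second kind on the universal covering of $\mathbb C^*$, where $K_\mu=\frac\pi2\frac{I_{-\mu}-I_\mu}{\sin\pi\mu}$ for $\mu\notin\mathbb Z$. Let $x=-2\zeta e^u/p$ with $\arg x=\arg\zeta+\theta_0$. The weak functional $ds_p(\zeta)$ is defined by $$\langle ds_p(\zeta),e_m\rangle=\frac1{i\pi}\Big(\frac{e^u}{p^2}+1\Big)p^me^{\zeta v}\zeta^{1/2}K_m(x)\ (m\ge1),\qquad \langle ds_p(\zeta),e_m\rangle=\frac1{i\pi}\frac{e^u}{p^2}p^me^{\zeta v}\zeta^{1/2}K_m(x)\ (m\le0),$$ $$\langle ds_p(\zeta),e_v\rangle=\frac1{i\pi}e^{\zeta v}\zeta^{1/2}K_0(x),\qquad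 \langle ds_p(\zeta),e_u\rangle=\frac1{i\pi}\frac{e^u}{p}e^{\zeta v}\zeta^{1/2}K_1(x).$$ It depends on the choice of $\arg p$; write $ds_{-p}$ for the functional with $\phi$ replaced by $\phi-\pi$, i.e. $ds_{-p}=ds_{e^{-i\pi}p}$. **Claim.** 1. $ds_p(\zeta)$ is a weak solution of the Dubrovin equation. 2. $ds_p$ is the Borel resummation of $dy_p^{\rm formal}$: for every $\hat X\in T^{\rm test}$, every $\theta$ with $|\theta-\theta_0|<\pi$ and every $\zeta$ with $|\arg\zeta+\theta|<\pi/2$, the series $\sum_k\langle r_p^k,\hat X\rangle\chi^k/k!$ converges near $\chi=0$, its sum continues analytically to a function $F$ along the ray $e^{i\theta}\mathbb R_+$, and $$\langle ds_p(\zeta),\hat X\rangle=e^{\zeta u_p}\,\zeta\int_{e^{i\theta}\mathbb R_+}F(\chi)e^{-\zeta\chi}\,d\chi,$$ where the integral converges absolutely. 3. $ds_p(\zeta)\sim dy_p^{\rm formal}(\zeta)$ as $|\zeta|\to\infty$ in the sector $|\arg\zeta+\theta_0|<\frac{3\pi}2$. That is, for all $\hat X\in T^{\rm test}$, $N\ge0$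 and $\alpha<\frac{3\pi}2$, as $|\zeta|\to\infty$ one has, uniformly for $|\arg\zeta+\theta_0|\le\alpha$, $$e^{-\zeta u_p}\langle ds_p(\zeta),\hat X\rangle=\sum_{k<N}\langle r_p^k,\hat X\rangle\zeta^{-k}+O(|\zeta|^{-N}).$$ 4. For all $\zeta$ in the universal covering, $$ds_p(\zeta e^{2\pi i})=ds_p(\zeta)-2\,ds_{-p}(\zeta),\qquad ds_{-p}(\zeta e^{-2\pi i})=ds_{-p}(\zeta)-2\,ds_p(\zeta).$$ -/

import Mathlib

open scoped LaurentPolynomial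

/-!
Conventions. Multivalued functions of `ζ ∈ ℂ*` are functions on the universal covering of `ℂ*`,
with coordinate `l = log ζ ∈ ℂ`: the point `l` lies over `ζ = exp l`, `arg ζ = im l`,
`ζ ^ (1/2) = exp (l / 2)`, and `ζ ↦ ζ e^{2πi}` is `l ↦ l + 2πi`. A point `p ∈ S¹` is given by its
argument `φ : ℝ`, `p = exp (i φ)`, and `arg e^u = im u`.
-/

noncomputable section

namespace TodaDubrovin

/-! ### Modified Bessel functions on the universal covering of `ℂ*` -/

/-- `I_ν(x) = ∑ₖ (x/2)^(2k+ν) / (Γ(k+ν+1) k!)` at the point `x` of the universal covering of `ℂ*`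
with `log x = l`. -/
def besselI (ν l : ℂ) : ℂ :=
  ∑' k : ℕ, Complex.exp ((2 * k + ν) * (l - Complex.log 2)) /
    (Complex.Gamma (k + ν + 1) * (k.factorial : ℂ))

/-- `K_ν(x)` for `ν ∉ ℤ`, `log x = l`. -/
def besselKNonint (ν l : ℂ) : ℂ :=
  (Real.pi / 2 : ℂ) * (besselI (-ν) l - besselI ν l) / Complex.sin (Real.pi * ν)

/-- `K_m(x) = lim_{μ → m} K_μ(x)` for `m ∈ ℤ`, `log x = l`. -/
def besselK (m : ℤ) (l : ℂ) : ℂ :=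
  Filter.limUnder (nhdsWithin (m : ℂ) {(m : ℂ)}ᶜ) (fun μ : ℂ => besselKNonint μ l)

/-! ### Test vectors, weak functionals, the operators `U` and `V` at the point `(z, v, u)` -/

/-- Test vectors `(X(z), X_v, X_u)` with `X(z)` a Laurent polynomial. -/
abbrev Test : Type := ℂ[T;T⁻¹] × ℂ × ℂ

/-- The algebraic dual of the space of test vectors. -/
abbrev WeakDual : Type := Module.Dual ℂ Test

/-- The weak functional with prescribed coefficients:
`(X, X_v, X_u) ↦ ∑ₙ Xₙ Cₙ + X_v C_v + X_u C_u`. -/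
def ofCoeffs (C : ℤ → ℂ) (Cv Cu : ℂ) : WeakDual :=
  (Finsupp.linearCombination ℂ C ∘ₗ
      (AddMonoidAlgebra.coeffLinearEquiv (M := ℤ) (S := ℂ) ℂ).toLinearMap) ∘ₗ
      LinearMap.fst ℂ ℂ[T;T⁻¹] (ℂ × ℂ)
    + (Cv • LinearMap.fst ℂ ℂ ℂ + Cu • LinearMap.snd ℂ ℂ ℂ) ∘ₗ
      LinearMap.snd ℂ ℂ[T;T⁻¹] (ℂ × ℂ)

/-- `z X'(z)`. -/
def zDeriv (X : ℂ[T;T⁻¹]) : ℂ[T;T⁻¹] :=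
  X.coeff.sum fun n a => LaurentPolynomial.C ((n : ℂ) * a) * LaurentPolynomial.T n

/-- Multiplication by the Euler vector field at the point `(z, v, u)`:
`((v + 2 e^u z⁻¹) X(z) + 2 e^u X_u, 2 e^u X₁ + v X_v, 2 X_v + v X_u)`. -/
def opU (u v : ℂ) (X : Test) : Test :=
  ((LaurentPolynomial.C v + LaurentPolynomial.C (2 * Complex.exp u) * LaurentPolynomial.T (-1))
      * X.1 + LaurentPolynomial.C (2 * Complex.exp u * X.2.2),
    2 * Complex.exp u * X.1.coeff 1 + v * X.2.1,
    2 * X.2.1 + v * X.2.2)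

/-- The grading operator at the point `(z, v, u)`:
`(-X(z)/2 + z X'(z), -X_v/2, X_u/2)`. -/
def opV (X : Test) : Test :=
  (-((1 / 2 : ℂ) • X.1) + zDeriv X.1, -(X.2.1 / 2), X.2.2 / 2)

/-- Weak solutions of the Dubrovin equation `∂_ζ ⟨ξ, X⟩ = ⟨ξ, (U - ζ⁻¹ V) X⟩` for all test vectors
`X`, on the universal covering of `ℂ*`. In the coordinate `l = log ζ` one has
`∂_l = ζ ∂_ζ`, whence the factor `exp l`. -/
def IsWeakSolution (u v : ℂ) (ξ : ℂ → WeakDual) : Prop :=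
  ∀ (X : Test) (l : ℂ),
    HasDerivAt (fun l' => ξ l' X)
      (Complex.exp l * ξ l (opU u v X - (Complex.exp l)⁻¹ • opV X)) l

/-! ### Superpotentials and the formal integral solutions -/

/-- `λ(z) = z - v - e^u / z`. -/
def lam (u v z : ℂ) : ℂ := z - v - Complex.exp u / z

/-- `\bar λ(z) = v + e^u / z`. -/
def lamBar (u v z : ℂ) : ℂ := v + Complex.exp u / z

/-- `λ_σ(z) = σ \bar λ(z) + (σ - 1) λ(z)`. -/
def lamSigma (u v σ z : ℂ) : ℂ := σ * lamBar u v z + (σ - 1) * lam u v z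

/-- `σ(p) = λ'(p) / (λ'(p) + \bar λ'(p))`. -/
def sigma (u v p : ℂ) : ℂ :=
  deriv (lam u v) p / (deriv (lam u v) p + deriv (lamBar u v) p)

/-- The point `p = e^{iφ}` of the unit circle. -/
def pt (φ : ℝ) : ℂ := Complex.exp (φ * Complex.I)

/-- The canonical coordinate `u_p = λ_{σ(p)}(p)`. -/
def canon (u v : ℂ) (φ : ℝ) : ℂ := lamSigma u v (sigma u v (pt φ)) (pt φ)

/-- `⟨dλ(z), X⟩`; the `λ`-component of `X` is `X_{≤0}(z) - X_v - e^u X_u z⁻¹`. -/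
def dLam (u z : ℂ) (X : Test) : ℂ :=
  (X.1.coeff.sum fun n a => if n ≤ 0 then a * z ^ n else 0) - X.2.1 - Complex.exp u * X.2.2 / z

/-- `⟨d\bar λ(z), X⟩`; the `\bar λ`-component of `X` is `X_{≥1}(z) + X_v + e^u X_u z⁻¹`. -/
def dLamBar (u z : ℂ) (X : Test) : ℂ :=
  (X.1.coeff.sum fun n a => if 1 ≤ n then a * z ^ n else 0) + X.2.1 + Complex.exp u * X.2.2 / z

/-- `⟨dλ_σ(z), X⟩ = σ ⟨d\bar λ(z), X⟩ + (σ - 1) ⟨dλ(z), X⟩`. -/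
def dLamSigma (u σ z : ℂ) (X : Test) : ℂ := σ * dLamBar u z X + (σ - 1) * dLam u z X

/-- The holomorphic branch of `(λ_{σ(p)}(z) - u_p)^{1/2} = (z/p - 1) (e^u/z)^{1/2}` near `z = p`,
with the determination `(e^u/p)^{1/2} = -e^{(u - iφ)/2}` at `z = p`. -/
def rootLam (u : ℂ) (φ : ℝ) (z : ℂ) : ℂ :=
  (z / pt φ - 1) * (-Complex.exp ((u - φ * Complex.I) / 2)) *
    Complex.exp (-(Complex.log (z / pt φ) / 2))

theorem pt_ne_zero (φ : ℝ) : pt φ ≠ 0 := Complex.exp_ne_zero _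

theorem sigma_pt (u v : ℂ) (φ : ℝ) :
    sigma u v (pt φ) = 1 + Complex.exp u / pt φ ^ 2 := by
  have hp := pt_ne_zero φ
  have h0 : HasDerivAt (fun z : ℂ => Complex.exp u / z) (-(Complex.exp u / pt φ ^ 2)) (pt φ) := by
    have h := (hasDerivAt_inv hp).const_mul (Complex.exp u)
    simp only [← div_eq_mul_inv] at h
    have e : -(Complex.exp u / pt φ ^ 2) = Complex.exp u * -(pt φ ^ 2)⁻¹ := by
      rw [div_eq_mul_inv]; ring
    rw [e]
    exact h
  have h1 : deriv (lam u v) (pt φ) = 1 + Complex.exp u / pt φ ^ 2 := by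
    have h : HasDerivAt (lam u v) (1 - -(Complex.exp u / pt φ ^ 2)) (pt φ) :=
      ((hasDerivAt_id (pt φ)).sub_const v).sub h0
    rw [h.deriv]; ring
  have h2 : deriv (lamBar u v) (pt φ) = -(Complex.exp u / pt φ ^ 2) := by
    have h : HasDerivAt (lamBar u v) (-(Complex.exp u / pt φ ^ 2)) (pt φ) := h0.const_add v
    exact h.deriv
  rw [sigma, h1, h2]
  simp

theorem rootLam_sq (u v : ℂ) (φ : ℝ) {z : ℂ} (hz : z ≠ 0) :
    rootLam u φ z ^ 2 = lamSigma u v (sigma u v (pt φ)) z - canon u v φ := by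
  have hp := pt_ne_zero φ
  have hw : z / pt φ ≠ 0 := div_ne_zero hz hp
  have e1 : Complex.exp ((u - φ * Complex.I) / 2) ^ 2 = Complex.exp u / pt φ := by
    rw [← Complex.exp_nat_mul, pt, ← Complex.exp_sub]; congr 1; push_cast; ring
  have e2 : Complex.exp (-(Complex.log (z / pt φ) / 2)) ^ 2 = (z / pt φ)⁻¹ := by
    rw [← Complex.exp_nat_mul, ← Complex.exp_log hw, ← Complex.exp_neg, Complex.exp_log hw]
    congr 1; push_cast; ring
  rw [rootLam, mul_pow, mul_pow, neg_sq, e1, e2, canon, sigma_pt]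
  simp only [lamSigma, lam, lamBar]
  field_simp
  ring

/-- `⟨r_p^k, X⟩`, where `⟨dy_p^formal, X⟩ = e^{ζ u_p} ∑ₖ ⟨r_p^k, X⟩ ζ^{-k}`: that is
`(2 Γ(1/2 - k))⁻¹ (2πi)⁻¹ ∮_p ⟨dλ_σ(z), X⟩ (λ_σ(z) - u_p)^{-(k + 1/2)} dz/z`, `σ = σ(p)`. -/
def dyFormalCoeff (u v : ℂ) (φ : ℝ) (k : ℕ) (X : Test) : ℂ :=
  1 / (2 * Complex.Gamma (1 / 2 - k)) * (1 / (2 * Real.pi * Complex.I)) *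
    ∮ z in C(pt φ, 1 / 2),
      dLamSigma u (sigma u v (pt φ)) z X / rootLam u φ z ^ (2 * k + 1) * (1 / z)

/-! ### The resummed weak functionals -/

/-- The logarithm of `-2 ζ e^u / p`, where `-1 = e^{iπ}`. -/
def logArg (u : ℂ) (φ : ℝ) (l : ℂ) : ℂ :=
  l + Real.pi * Complex.I + Complex.log 2 + u - φ * Complex.I

/-- The weak functional `ds_p(ζ)`, `p = e^{iφ}`, `ζ = e^l`. -/
def ds (u v : ℂ) (φ : ℝ) (l : ℂ) : WeakDual :=
  ofCoeffs
    (fun m : ℤ =>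
      1 / (Complex.I * Real.pi) *
        (if 1 ≤ m then Complex.exp u / pt φ ^ 2 + 1 else Complex.exp u / pt φ ^ 2) *
        pt φ ^ m * Complex.exp (Complex.exp l * v) * Complex.exp (l / 2) *
        besselK m (logArg u φ l))
    (1 / (Complex.I * Real.pi) * Complex.exp (Complex.exp l * v) * Complex.exp (l / 2) *
      besselK 0 (logArg u φ l))
    (1 / (Complex.I * Real.pi) * (Complex.exp u / pt φ) * Complex.exp (Complex.exp l * v) *
      Complex.exp (l / 2) * besselK 1 (logArg u φ l))

/-! ### Borel sums and asymptotic expansions -/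

/-- `s` is the Borel sum, in the direction `θ` and at the point `ζ`, of the formal series
`∑ₖ aₖ ζ^{-k}`: the Borel transform `∑ₖ aₖ χ^k / k!` converges near `0`, its sum continues
analytically to a function `F` along the ray `e^{iθ} ℝ₊`, and
`s = ζ ∫_{e^{iθ} ℝ₊} F(χ) e^{-ζχ} dχ`, the integral converging absolutely. -/
def IsBorelSum (a : ℕ → ℂ) (θ : ℝ) (ζ s : ℂ) : Prop :=
  ∃ (D : Set ℂ) (F : ℂ → ℂ),
    IsOpen D ∧ (∀ t : ℝ, 0 ≤ t → t * Complex.exp (θ * Complex.I) ∈ D) ∧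
    DifferentiableOn ℂ F D ∧
    (∀ᶠ χ in nhds (0 : ℂ), HasSum (fun k : ℕ => a k / (k.factorial : ℂ) * χ ^ k) (F χ)) ∧
    MeasureTheory.IntegrableOn
      (fun t : ℝ => F (t * Complex.exp (θ * Complex.I)) *
        Complex.exp (-(ζ * (t * Complex.exp (θ * Complex.I))))) (Set.Ioi 0) ∧
    s = ζ * ∫ t in Set.Ioi (0 : ℝ), F (t * Complex.exp (θ * Complex.I)) *
        Complex.exp (-(ζ * (t * Complex.exp (θ * Complex.I)))) * Complex.exp (θ * Complex.I)

/-- `f(ζ) ∼ e^{ζ μ} ∑ₖ aₖ ζ^{-k}` for `|ζ| → ∞` in the sector `|arg ζ + θ₀| < β` of the universal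
covering, uniformly in closed subsectors. -/
def HasExpansion (f : ℂ → ℂ) (μ : ℂ) (a : ℕ → ℂ) (θ₀ β : ℝ) : Prop :=
  ∀ α : ℝ, α < β → ∀ N : ℕ, ∃ C R : ℝ, ∀ l : ℂ, |l.im + θ₀| ≤ α → R ≤ ‖Complex.exp l‖ →
    ‖Complex.exp (-(Complex.exp l * μ)) * f l -
        ∑ k ∈ Finset.range N, a k * ((Complex.exp l)⁻¹) ^ k‖ ≤ C * (‖Complex.exp l‖⁻¹) ^ N

/-- `θ₀ = π + arg e^u - arg p`. -/
def theta0 (u : ℂ) (φ : ℝ) : ℝ := Real.pi + u.im - φ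

end TodaDubrovin

end

noncomputable section

namespace TodaDubrovin

/-! ### The functions `I_ν` -/

/-! All claims reduce to scalar facts about `K_m`, because every condition is linear in the test
vector and can be checked on the basis. Since `u_p = v + 2e^u/p` and `x = -2ζe^u/p`, one has `e^{ζv}
= e^{ζu_p} e^x`. Hence on a basis vector both `ds_p` and the formal solution carry the same constant
prefactor, and what has to be resummed and expanded is `ζ^{1/2} e^x K_m(x) / (iπ)`
(`scaledBesselK`).

The Dubrovin equation becomes the two first order recurrences `x K_m' = -x K_{m-1} - m K_m` and `x
K_m' = -x K_{m+1} + m K_m` (`hasDerivAt_besselK`, `hasDerivAt_besselK'`). The monodromy comes from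
`K_m(xe^{iπ}) + K_m(xe^{-iπ}) = 2(-1)^m K_m(x)` (`besselK_add_sub`), combined with the sign that
`ζ^{1/2}` acquires.

For the resummation, `K_m`, defined as a limit in the order, is first identified with `(1/2) ∫ e^{-x
cosh t + mt} dt` (`besselK_eq_kap`). Constant Wronskians, evaluated at `x → 0`, give this for orders
`0 < Re μ < 1`; the limit `μ → 0` and a recurrence then reach the integers. With `2τ² = cosh t - 1`
this integral turns into a Gaussian integral of `g_m(2τ²)`, where `g_m(r) = T_m(1+r)(2+r)^{-1/2}`.
Multiplying by a second Gaussian integral and passing to polar coordinates yields `e^x K_m(x) = √x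
∫₀^∞ B_m(s) e^{-xs} ds`, with `B_m(s)` proportional to the mean over `α` of `g_m(s sin² α)`
(`laplace_borelB_real`). `B_m` is holomorphic off `(-∞, -2]` and polynomially bounded in closed
sectors avoiding the cut. The ray of integration can therefore be turned by any angle below `π`, so
the formula continues to `|arg x| < 3π/2` (`laplace_borelB`), and Watson's lemma gives the expansion
there (`besselK_expansion`).

It remains to recognise the formal series. The `k`-th Taylor coefficient of `g_m` is `2^{-1/2} 2^k`
times the binomial coefficient of `m + k - 1/2` over `2k` (`hasSum_gFun`). On the other side, `(λ_σ
- u_p)^{k+1/2}` contributes a pole of order `2k+1` at `p` and otherwise only powers of `z/p`, so the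
residue defining `r_p^k` is the `2k`-th Taylor coefficient of `(z/p)^{m+k-1/2}`: the same binomial
coefficient (`circleIntegral_zpow_div_rootLam`). The reflection formula for `Γ` matches the
constants (`circleIntegral_eq_besselKCoeff`). -/

theorem exists_bound_inv_Gamma_add_nat (R : ℝ) :
    ∃ M : ℝ, 0 ≤ M ∧ ∀ ν : ℂ, ‖ν‖ ≤ R → ∀ k : ℕ, ‖(Complex.Gamma (k + ν + 1))⁻¹‖ ≤ M := by
  obtain ⟨N, hN⟩ := exists_nat_ge (R + 1)
  obtain ⟨M, hM⟩ := (isCompact_closedBall (0 : ℂ) (N + R + 1)).exists_bound_of_continuousOn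
    Complex.differentiable_one_div_Gamma.continuous.continuousOn
  refine ⟨max M 0, le_max_right _ _, fun ν hν k => le_max_of_le_left ?_⟩
  induction k with
  | zero =>
    refine hM _ ?_
    rw [mem_closedBall_zero_iff]
    calc ‖((0 : ℕ) : ℂ) + ν + 1‖ ≤ ‖((0 : ℕ) : ℂ) + ν‖ + ‖(1 : ℂ)‖ := norm_add_le _ _
      _ ≤ N + R + 1 := by simp; linarith [Nat.cast_nonneg (α := ℝ) N]
  | succ k ih =>
    by_cases hk : k + 1 ≤ N
    · refine hM _ ?_
      rw [mem_closedBall_zero_iff]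
      have hk' : ((k + 1 : ℕ) : ℝ) ≤ N := by exact_mod_cast hk
      calc ‖((k + 1 : ℕ) : ℂ) + ν + 1‖ ≤ ‖((k + 1 : ℕ) : ℂ)‖ + ‖ν‖ + ‖(1 : ℂ)‖ := norm_add₃_le
        _ ≤ N + R + 1 := by rw [Complex.norm_natCast, norm_one]; linarith
    · have hk' : (N : ℝ) + 1 ≤ ((k + 1 : ℕ) : ℝ) := by exact_mod_cast Nat.succ_le_of_lt (not_le.mp hk)
      -- Beyond the compact range `1/Γ` can only shrink: `1/Γ(z) = z/Γ(z+1)` with `|z| ≥ 1` gives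
      -- `|1/Γ(z+1)| ≤ |1/Γ(z)|`.
      have h1 : 1 ≤ ‖(k : ℂ) + ν + 1‖ := by
        have h := norm_sub_norm_le ((k + 1 : ℕ) : ℂ) (-ν)
        rw [Complex.norm_natCast, norm_neg, sub_neg_eq_add] at h
        have e : ((k + 1 : ℕ) : ℂ) + ν = (k : ℂ) + ν + 1 := by push_cast; ring
        rw [e] at h; linarith
      have h2 : (Complex.Gamma (k + ν + 1))⁻¹ =
          (k + ν + 1) * (Complex.Gamma (k + ν + 1 + 1))⁻¹ := by
        exact Complex.one_div_Gamma_eq_self_mul_one_div_Gamma_add_one _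
      have e : ((k + 1 : ℕ) : ℂ) + ν + 1 = k + ν + 1 + 1 := by push_cast; ring
      rw [e]
      rw [h2, norm_mul] at ih
      exact (le_mul_of_one_le_left (norm_nonneg _) h1).trans ih

/-- The terms of the series of `I_ν`. -/
def besselITerm (k : ℕ) (ν l : ℂ) : ℂ :=
  Complex.exp ((2 * k + ν) * (l - Complex.log 2)) /
    (Complex.Gamma (k + ν + 1) * (k.factorial : ℂ))

theorem besselITerm_eq (k : ℕ) (ν l : ℂ) :
    besselITerm k ν l = Complex.exp ((2 * k + ν) * (l - Complex.log 2)) *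
      (Complex.Gamma (k + ν + 1))⁻¹ * (k.factorial : ℂ)⁻¹ := by
  rw [besselITerm, div_eq_mul_inv, mul_inv, mul_assoc]

/-- A Weierstrass majorant uniform in the order and in `l` at once. Joint continuity, holomorphy in
`ν` and termwise differentiation in `l` all rest on it. -/
theorem exists_summable_bound_besselITerm (R : ℝ) :
    ∃ b : ℕ → ℝ, Summable b ∧ ∀ k : ℕ, ∀ ν l : ℂ, ‖ν‖ ≤ R → ‖l - Complex.log 2‖ ≤ R →
      ‖besselITerm k ν l‖ ≤ b k := by
  obtain ⟨M, hM0, hM⟩ := exists_bound_inv_Gamma_add_nat R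
  refine ⟨fun k => Real.exp (R * R) * M * (Real.exp (2 * R) ^ k / (k.factorial : ℝ)),
    (Real.summable_pow_div_factorial _).mul_left _, fun k ν l hν hl => ?_⟩
  have h1 : ‖Complex.exp ((2 * k + ν) * (l - Complex.log 2))‖ ≤
      Real.exp (R * R) * Real.exp (2 * R) ^ k := by
    rw [Complex.norm_exp, ← Real.exp_nat_mul, ← Real.exp_add, Real.exp_le_exp]
    calc ((2 * k + ν) * (l - Complex.log 2)).re ≤ ‖(2 * k + ν) * (l - Complex.log 2)‖ :=
          Complex.re_le_norm _
      _ ≤ (2 * k + R) * R := by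
          rw [norm_mul]
          refine mul_le_mul ((norm_add_le _ _).trans ?_) hl (norm_nonneg _) ?_
          · rw [norm_mul, Complex.norm_natCast, Complex.norm_ofNat]; linarith
          · have := (norm_nonneg ν).trans hν
            positivity
      _ = R * R + k * (2 * R) := by ring
  rw [besselITerm_eq, norm_mul, norm_mul, norm_inv (k.factorial : ℂ), Complex.norm_natCast]
  calc _ ≤ Real.exp (R * R) * Real.exp (2 * R) ^ k * M * (k.factorial : ℝ)⁻¹ := by
        gcongr; exact hM ν hν k
    _ = _ := by ring

theorem summable_besselITerm (ν l : ℂ) : Summable fun k => besselITerm k ν l := by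
  obtain ⟨b, hb, h⟩ := exists_summable_bound_besselITerm (max ‖ν‖ ‖l - Complex.log 2‖)
  exact Summable.of_norm_bounded hb fun k => h k ν l (le_max_left _ _) (le_max_right _ _)

theorem hasSum_besselITerm (ν l : ℂ) : HasSum (fun k => besselITerm k ν l) (besselI ν l) :=
  (summable_besselITerm ν l).hasSum

theorem continuous_besselITerm (k : ℕ) :
    Continuous fun q : ℂ × ℂ => besselITerm k q.1 q.2 := by
  simp only [besselITerm_eq]
  have h : Continuous fun q : ℂ × ℂ => (Complex.Gamma (k + q.1 + 1))⁻¹ :=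
    Complex.differentiable_one_div_Gamma.continuous.comp
      (show Continuous fun q : ℂ × ℂ => (k : ℂ) + q.1 + 1 by fun_prop)
  exact (Continuous.mul (by fun_prop) h).mul continuous_const

theorem continuous_besselI : Continuous fun q : ℂ × ℂ => besselI q.1 q.2 := by
  rw [continuous_iff_continuousAt]
  intro q
  set R := ‖q.1‖ + ‖q.2 - Complex.log 2‖ + 1
  obtain ⟨b, hb, h⟩ := exists_summable_bound_besselITerm R
  have hU : {r : ℂ × ℂ | ‖r.1‖ < R ∧ ‖r.2 - Complex.log 2‖ < R} ∈ nhds q := by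
    refine IsOpen.mem_nhds ?_ ⟨?_, ?_⟩
    · exact (isOpen_lt continuous_fst.norm continuous_const).inter
        (isOpen_lt (continuous_snd.sub continuous_const).norm continuous_const)
    · linarith [norm_nonneg (q.2 - Complex.log 2)]
    · linarith [norm_nonneg q.1]
  refine (continuousOn_tsum (fun k => (continuous_besselITerm k).continuousOn) hb
    fun k r hr => h k r.1 r.2 hr.1.le hr.2.le).continuousAt hU

theorem differentiable_besselI_order (l : ℂ) : Differentiable ℂ fun ν => besselI ν l := by
  intro ν
  set R := ‖ν‖ + ‖l - Complex.log 2‖ + 1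
  obtain ⟨b, hb, h⟩ := exists_summable_bound_besselITerm R
  refine (Complex.differentiableOn_tsum_of_summable_norm (U := Metric.ball 0 R) hb
    (F := fun k ν => besselITerm k ν l) (fun k => ?_)
    Metric.isOpen_ball fun k w hw => h k w l (mem_ball_zero_iff.mp hw).le ?_).differentiableAt
      (Metric.isOpen_ball.mem_nhds (mem_ball_zero_iff.mpr ?_))
  · simp only [besselITerm_eq]
    have h : Differentiable ℂ fun ν : ℂ => (Complex.Gamma (k + ν + 1))⁻¹ :=
      Complex.differentiable_one_div_Gamma.comp
        (show Differentiable ℂ fun ν : ℂ => (k : ℂ) + ν + 1 by fun_prop)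
    exact ((Differentiable.mul (by fun_prop) h).mul (differentiable_const _)).differentiableOn
  · linarith [norm_nonneg ν]
  · linarith [norm_nonneg (l - Complex.log 2)]

theorem hasDerivAt_besselITerm (k : ℕ) (ν l : ℂ) :
    HasDerivAt (fun l => besselITerm k ν l) ((2 * k + ν) * besselITerm k ν l) l := by
  simp only [besselITerm]
  have h := ((((hasDerivAt_id l).sub_const (Complex.log 2)).const_mul (2 * (k : ℂ) + ν)).cexp).div_const
    (Complex.Gamma (k + ν + 1) * (k.factorial : ℂ))
  convert! h using 1
  simp only [id]
  ring

/-- The derivative is kept as a sum of a known series, so that each recurrence below reduces to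
comparing coefficients and uniqueness of sums. -/
theorem exists_hasDerivAt_besselI (ν l : ℂ) :
    ∃ d, HasDerivAt (fun l => besselI ν l) d l ∧
      HasSum (fun k : ℕ => (2 * k + ν) * besselITerm k ν l) d := by
  set R := ‖ν‖ + ‖l - Complex.log 2‖ + 1
  obtain ⟨b, hb, h⟩ := exists_summable_bound_besselITerm R
  have hU : IsOpen (Metric.ball (Complex.log 2) R) := Metric.isOpen_ball
  have hl : l ∈ Metric.ball (Complex.log 2) R := by
    rw [mem_ball_iff_norm]; linarith [norm_nonneg ν]
  have hd : ∀ k, DifferentiableOn ℂ (fun l => besselITerm k ν l) (Metric.ball (Complex.log 2) R) :=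
    fun k l _ => (hasDerivAt_besselITerm k ν l).differentiableAt.differentiableWithinAt
  have hle : ∀ k w, w ∈ Metric.ball (Complex.log 2) R → ‖besselITerm k ν w‖ ≤ b k :=
    fun k w hw => h k ν w (by linarith [norm_nonneg (l - Complex.log 2)])
      (mem_ball_iff_norm.mp hw).le
  refine ⟨_, ((Complex.differentiableOn_tsum_of_summable_norm hb hd hU hle).differentiableAt
    (hU.mem_nhds hl)).hasDerivAt, ?_⟩
  simpa only [(hasDerivAt_besselITerm _ ν l).deriv] using
    Complex.hasSum_deriv_of_summable_norm hb hd hU hle hl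

theorem exp_eq_two_mul (l : ℂ) : Complex.exp l = 2 * Complex.exp (l - Complex.log 2) := by
  rw [Complex.exp_sub, Complex.exp_log two_ne_zero]; field_simp

/-- `x I_ν' = x I_{ν-1} - ν I_ν`. -/
theorem hasDerivAt_besselI (ν l : ℂ) :
    HasDerivAt (fun l => besselI ν l) (Complex.exp l * besselI (ν - 1) l - ν * besselI ν l) l := by
  obtain ⟨d, hd, hs⟩ := exists_hasDerivAt_besselI ν l
  convert! hd using 1
  refine HasSum.unique (((hasSum_besselITerm (ν - 1) l).mul_left (Complex.exp l)).sub
    ((hasSum_besselITerm ν l).mul_left ν)) ?_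
  convert! hs using 2 with k
  rw [besselITerm_eq, besselITerm_eq, exp_eq_two_mul]
  have e : (k : ℂ) + (ν - 1) + 1 = k + ν := by ring
  have h := Complex.one_div_Gamma_eq_self_mul_one_div_Gamma_add_one (k + ν)
  rw [e, h]
  have e2 : Complex.exp (l - Complex.log 2) *
      Complex.exp ((2 * k + (ν - 1)) * (l - Complex.log 2)) =
      Complex.exp ((2 * k + ν) * (l - Complex.log 2)) := by
    rw [← Complex.exp_add]; congr 1; ring
  rw [← e2]
  ring

/-- `x I_ν' = x I_{ν+1} + ν I_ν`. -/
theorem hasDerivAt_besselI' (ν l : ℂ) :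
    HasDerivAt (fun l => besselI ν l) (Complex.exp l * besselI (ν + 1) l + ν * besselI ν l) l := by
  obtain ⟨d, hd, hs⟩ := exists_hasDerivAt_besselI ν l
  convert! hd using 1
  have h1 : HasSum (fun k : ℕ => (2 * (k : ℂ)) * besselITerm k ν l)
      (Complex.exp l * besselI (ν + 1) l) := by
    -- The term `k = 0` vanishes because of the factor `2k`; the remaining series is that of `x
    -- I_{ν+1}` shifted by one.
    rw [← hasSum_nat_add_iff' 1]
    simp only [Finset.range_one, Finset.sum_singleton, Nat.cast_zero, mul_zero, zero_mul, sub_zero]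
    convert! (hasSum_besselITerm (ν + 1) l).mul_left (Complex.exp l) using 2 with k
    rw [besselITerm_eq, besselITerm_eq, exp_eq_two_mul l, Nat.factorial_succ]
    have e2 : Complex.exp (l - Complex.log 2) *
        Complex.exp ((2 * k + (ν + 1)) * (l - Complex.log 2)) =
        Complex.exp ((2 * (k + 1 : ℕ) + ν) * (l - Complex.log 2)) := by
      rw [← Complex.exp_add]; congr 1; push_cast; ring
    have e : (k : ℂ) + (ν + 1) + 1 = (k + 1 : ℕ) + ν + 1 := by push_cast; ring
    rw [← e2, e]
    have : ((k : ℂ) + 1) ≠ 0 := Nat.cast_add_one_ne_zero k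
    push_cast
    field_simp
  refine HasSum.unique (h1.add ((hasSum_besselITerm ν l).mul_left ν)) ?_
  convert! hs using 2 with k
  ring

theorem besselI_neg_nat (m : ℕ) (l : ℂ) : besselI (-m) l = besselI m l := by
  refine HasSum.unique (hasSum_besselITerm _ l) ?_
  rw [← hasSum_nat_add_iff' m]
  have h0 : ∑ i ∈ Finset.range m, besselITerm i (-m) l = 0 := by
    refine Finset.sum_eq_zero fun i hi => ?_
    have hi' := Finset.mem_range.mp hi
    -- `Complex.Gamma` takes the value `0` at its poles and division by zero gives `0`, which is the
    -- correct value of `1/Γ` there; so the first `m` terms drop out.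
    have : Complex.Gamma (i + -m + 1) = 0 := by
      rw [Complex.Gamma_eq_zero_iff]
      refine ⟨m - i - 1, ?_⟩
      rw [Nat.cast_sub (by omega), Nat.cast_sub hi'.le]; push_cast; ring
    rw [besselITerm, this, zero_mul, div_zero]
  rw [h0, sub_zero]
  convert! hasSum_besselITerm (m : ℂ) l using 2 with k
  have e1 : ((k + m : ℕ) : ℂ) + -m + 1 = (k : ℕ) + 1 := by push_cast; ring
  have e2 : (k : ℂ) + m + 1 = (k + m : ℕ) + 1 := by push_cast; ring
  have e3 : 2 * ((k + m : ℕ) : ℂ) + -m = 2 * k + m := by push_cast; ring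
  rw [besselITerm, besselITerm, e1, e2, e3, Complex.Gamma_nat_eq_factorial,
    Complex.Gamma_nat_eq_factorial, mul_comm (k.factorial : ℂ)]

theorem besselI_neg_int (m : ℤ) (l : ℂ) : besselI (-m) l = besselI m l := by
  obtain ⟨n, rfl | rfl⟩ := m.eq_nat_or_neg
  · exact besselI_neg_nat n l
  · push_cast
    rw [neg_neg]
    exact (besselI_neg_nat n l).symm

theorem besselI_add_pi_mul_I (ν l : ℂ) :
    besselI ν (l + Real.pi * Complex.I) =
      Complex.exp (Real.pi * ν * Complex.I) * besselI ν l := by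
  refine HasSum.unique (hasSum_besselITerm _ _) ?_
  convert! (hasSum_besselITerm ν l).mul_left (Complex.exp (Real.pi * ν * Complex.I)) using 2 with k
  have e : Complex.exp ((2 * k + ν) * (l + Real.pi * Complex.I - Complex.log 2)) =
      Complex.exp (Real.pi * ν * Complex.I) *
        Complex.exp ((2 * k + ν) * (l - Complex.log 2)) := by
    have := Complex.exp_nat_mul_two_pi_mul_I k
    calc _ = Complex.exp (Real.pi * ν * Complex.I) *
        Complex.exp ((2 * k + ν) * (l - Complex.log 2)) * Complex.exp (k * (2 * Real.pi * Complex.I)) := by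
          rw [← Complex.exp_add, ← Complex.exp_add]; congr 1; ring
      _ = _ := by rw [this, mul_one]
  rw [besselITerm_eq, besselITerm_eq, e]
  ring

/-- Removing the factor `x^ν` leaves a power series in `x²`, whose limit at `x → 0` is its constant
term. -/
theorem norm_exp_neg_mul_besselITerm (ν l : ℂ) (k : ℕ) :
    Complex.exp (-ν * l) * besselITerm k ν l =
      Complex.exp (2 * k * l) * besselITerm k ν 0 := by
  rw [besselITerm_eq, besselITerm_eq]
  have : Complex.exp (-ν * l) * Complex.exp ((2 * k + ν) * (l - Complex.log 2)) =
      Complex.exp (2 * k * l) * Complex.exp ((2 * k + ν) * (0 - Complex.log 2)) := by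
    rw [← Complex.exp_add, ← Complex.exp_add]; congr 1; ring
  rw [← mul_assoc, ← mul_assoc, this]
  ring

/-- `x^{-ν} I_ν(x) → 2^{-ν} / Γ(ν + 1)` as `x → 0+`. -/
theorem tendsto_besselI_atBot (ν : ℂ) :
    Filter.Tendsto (fun l : ℝ => Complex.exp (-ν * l) * besselI ν l) Filter.atBot
      (nhds (Complex.exp (-ν * Complex.log 2) * (Complex.Gamma (ν + 1))⁻¹)) := by
  have h0 : besselITerm 0 ν 0 = Complex.exp (-ν * Complex.log 2) * (Complex.Gamma (ν + 1))⁻¹ := by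
    rw [besselITerm_eq]; simp
  have hE : ∀ l : ℝ, Complex.exp (-ν * l) * besselI ν l =
      ∑' k : ℕ, Complex.exp (2 * k * l) * besselITerm k ν 0 := fun l => by
    refine HasSum.unique ((hasSum_besselITerm ν l).mul_left _) ?_
    simp only [norm_exp_neg_mul_besselITerm]
    have := ((hasSum_besselITerm ν l).mul_left (Complex.exp (-ν * l))).summable
    simp only [norm_exp_neg_mul_besselITerm] at this
    exact this.hasSum
  simp only [hE]
  rw [← h0]
  have hs : Summable fun k => ‖besselITerm k ν 0‖ := (summable_besselITerm ν 0).norm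
  have hT : ∑' k : ℕ, (if k = 0 then besselITerm 0 ν 0 else 0) = besselITerm 0 ν 0 := by
    rw [tsum_ite_eq]
  rw [← hT]
  refine tendsto_tsum_of_dominated_convergence hs (fun k => ?_) ?_
  · rcases Nat.eq_zero_or_pos k with rfl | hk
    · simp
    · rw [if_neg hk.ne']
      suffices h : Filter.Tendsto (fun l : ℝ => Complex.exp (2 * k * l)) Filter.atBot (nhds 0) by
        simpa using h.mul_const (besselITerm k ν 0)
      rw [tendsto_zero_iff_norm_tendsto_zero]
      simp only [Complex.norm_exp]
      refine Real.tendsto_exp_atBot.comp ?_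
      have : ∀ l : ℝ, (2 * (k : ℂ) * l).re = (2 * k) * l := fun l => by
        rw [← Complex.ofReal_natCast, ← Complex.ofReal_ofNat, ← Complex.ofReal_mul,
          ← Complex.ofReal_mul, Complex.ofReal_re]
      simp only [this]
      exact Filter.tendsto_id.const_mul_atBot (by positivity)
  · filter_upwards [Filter.eventually_le_atBot 0] with l hl k
    rw [norm_mul]
    refine mul_le_of_le_one_left (norm_nonneg _) ?_
    rw [Complex.norm_exp, Real.exp_le_one_iff]
    have : (2 * (k : ℂ) * l).re = (2 * k) * l := by
      rw [← Complex.ofReal_natCast, ← Complex.ofReal_ofNat, ← Complex.ofReal_mul,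
        ← Complex.ofReal_mul, Complex.ofReal_re]
    rw [this]
    exact mul_nonpos_of_nonneg_of_nonpos (by positivity) hl

/-! ### The functions `K_m`, `m ∈ ℤ` -/

theorem sin_pi_mul_int (m : ℤ) : Complex.sin (Real.pi * m) = 0 := by
  rw [mul_comm]; exact Complex.sin_int_mul_pi m

theorem cos_pi_mul_int (m : ℤ) : Complex.cos (Real.pi * m) = (-1) ^ m := by
  have h := congrArg (fun r : ℝ => (r : ℂ)) (Real.cos_int_mul_pi m)
  push_cast at h
  rw [mul_comm, h]

theorem hasDerivAt_sin_pi_mul (μ : ℂ) :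
    HasDerivAt (fun μ : ℂ => Complex.sin (Real.pi * μ)) (Real.pi * Complex.cos (Real.pi * μ)) μ := by
  have := ((hasDerivAt_id μ).const_mul (Real.pi : ℂ)).csin
  convert! this using 1
  simp [mul_comm]

/-- Numerator and denominator both vanish at `μ = m`, and `sin(πμ)` has nonzero derivative there.
The quotient of slopes converges, so the `limUnder` in `besselK` is a genuine limit. -/
theorem tendsto_besselKNonint (m : ℤ) (l : ℂ) :
    Filter.Tendsto (fun μ : ℂ => besselKNonint μ l) (nhdsWithin (m : ℂ) {(m : ℂ)}ᶜ)
      (nhds (besselK m l)) := by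
  refine tendsto_nhds_limUnder ?_
  set N : ℂ → ℂ := fun μ => besselI (-μ) l - besselI μ l
  have hN : DifferentiableAt ℂ N m :=
    (((differentiable_besselI_order l).comp differentiable_neg).sub
      (differentiable_besselI_order l)) m
  have hN0 : N m = 0 := sub_eq_zero.mpr (besselI_neg_int m l)
  have h1 := hasDerivAt_iff_tendsto_slope.mp hN.hasDerivAt
  have h2 := hasDerivAt_iff_tendsto_slope.mp (hasDerivAt_sin_pi_mul (m : ℂ))
  have hne : (Real.pi : ℂ) * Complex.cos (Real.pi * m) ≠ 0 := by
    rw [cos_pi_mul_int]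
    exact mul_ne_zero (by exact_mod_cast Real.pi_ne_zero) (zpow_ne_zero _ (by norm_num))
  refine ⟨_, ((h1.div h2 hne).const_mul (Real.pi / 2 : ℂ)).congr' ?_⟩
  filter_upwards [self_mem_nhdsWithin] with μ hμ
  have hμ' : μ - m ≠ 0 := sub_ne_zero.mpr hμ
  simp only [Pi.div_apply]
  rw [slope_def_field, slope_def_field, hN0, sin_pi_mul_int, sub_zero, sub_zero,
    div_div_div_cancel_right₀ hμ', besselKNonint, mul_div_assoc]

theorem besselKNonint_neg (μ l : ℂ) : besselKNonint (-μ) l = besselKNonint μ l := by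
  rw [besselKNonint, besselKNonint, neg_neg, mul_neg, Complex.sin_neg, div_neg, ← neg_div]
  congr 1; ring

theorem besselK_neg (m : ℤ) (l : ℂ) : besselK (-m) l = besselK m l := by
  have h1 := tendsto_besselKNonint (-m) l
  have h2 : Filter.Tendsto (fun μ : ℂ => -μ) (nhdsWithin (m : ℂ) {(m : ℂ)}ᶜ)
      (nhdsWithin ((-m : ℤ) : ℂ) {((-m : ℤ) : ℂ)}ᶜ) := by
    refine tendsto_nhdsWithin_iff.mpr ⟨?_, ?_⟩
    · push_cast
      exact (continuous_neg.tendsto (m : ℂ)).mono_left nhdsWithin_le_nhds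
    · filter_upwards [self_mem_nhdsWithin] with μ hμ
      simpa using hμ
  refine tendsto_nhds_unique ((h1.comp h2).congr fun μ => ?_) (tendsto_besselKNonint m l)
  exact besselKNonint_neg μ l

theorem besselI_sub_pi_mul_I (ν l : ℂ) :
    besselI ν (l - Real.pi * Complex.I) =
      Complex.exp (-(Real.pi * ν * Complex.I)) * besselI ν l := by
  have h := besselI_add_pi_mul_I ν (l - Real.pi * Complex.I)
  rw [sub_add_cancel] at h
  rw [h, ← mul_assoc, ← Complex.exp_add, neg_add_cancel, Complex.exp_zero, one_mul]

/-- Turning by `±π` multiplies `I_{±μ}` by exponentials whose sum is `2cos(πμ)` for either sign of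
the order; this is the source of the monodromy relations. -/
theorem besselKNonint_add_sub (μ l : ℂ) :
    besselKNonint μ (l + Real.pi * Complex.I) + besselKNonint μ (l - Real.pi * Complex.I) =
      2 * Complex.cos (Real.pi * μ) * besselKNonint μ l := by
  simp only [besselKNonint, besselI_add_pi_mul_I, besselI_sub_pi_mul_I, mul_neg, neg_mul, neg_neg,
    Complex.cos]
  ring

theorem besselK_add_sub (m : ℤ) (l : ℂ) :
    besselK m (l + Real.pi * Complex.I) + besselK m (l - Real.pi * Complex.I) =
      2 * (-1) ^ m * besselK m l := by
  have h1 := (tendsto_besselKNonint m (l + Real.pi * Complex.I)).add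
    (tendsto_besselKNonint m (l - Real.pi * Complex.I))
  simp only [besselKNonint_add_sub] at h1
  refine tendsto_nhds_unique h1 (Filter.Tendsto.mul ?_ (tendsto_besselKNonint m l))
  rw [← cos_pi_mul_int]
  exact (Continuous.tendsto (f := fun μ : ℂ => 2 * Complex.cos (Real.pi * μ))
    (by fun_prop) m).mono_left nhdsWithin_le_nhds

theorem hasDerivAt_besselKNonint (μ l : ℂ) :
    HasDerivAt (fun l => besselKNonint μ l)
      (-(Complex.exp l * besselKNonint (μ - 1) l) - μ * besselKNonint μ l) l := by
  have h := (((hasDerivAt_besselI' (-μ) l).sub (hasDerivAt_besselI μ l)).const_mul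
    (Real.pi / 2 : ℂ)).div_const (Complex.sin (Real.pi * μ))
  -- The raising recurrence on `I_{-μ}` and the lowering one on `I_μ` produce the orders `1 - μ` and
  -- `μ - 1`, which together form `K_{μ-1}`.
  convert! h using 1
  have e : Complex.sin (Real.pi * (μ - 1)) = -Complex.sin (Real.pi * μ) := by
    rw [mul_sub, mul_one, Complex.sin_sub_pi]
  rw [besselKNonint, besselKNonint, e, div_neg, neg_sub, neg_add_eq_sub]
  ring

theorem sin_pi_mul_ne_zero {m : ℤ} {μ : ℂ} (h : ‖μ - m‖ ≤ 1 / 2) (hne : μ ≠ m) :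
    Complex.sin (Real.pi * μ) ≠ 0 := by
  intro h0
  obtain ⟨k, hk⟩ := Complex.sin_eq_zero_iff.mp h0
  have hμ : μ = k := by
    have : (Real.pi : ℂ) ≠ 0 := by exact_mod_cast Real.pi_ne_zero
    rw [mul_comm] at hk
    exact mul_right_cancel₀ this hk
  subst hμ
  rw [← Int.cast_sub, Complex.norm_intCast] at h
  have h2 : |k - m| < 1 := by
    have : ((|k - m| : ℤ) : ℝ) < 1 := by push_cast; push_cast at h; linarith
    exact_mod_cast this
  exact hne (by rw [sub_eq_zero.mp (Int.abs_lt_one_iff.mp h2)])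

theorem circleMap_half_ne (m : ℤ) (θ : ℝ) : circleMap (m : ℂ) (1 / 2) θ ≠ m :=
  circleMap_ne_center (by norm_num)

theorem norm_circleMap_half_sub (m : ℤ) (θ : ℝ) :
    ‖circleMap (m : ℂ) (1 / 2) θ - m‖ ≤ 1 / 2 := by
  simp [circleMap]

theorem differentiableAt_besselKNonint_order {μ : ℂ} (l : ℂ) (h : Complex.sin (Real.pi * μ) ≠ 0) :
    DifferentiableAt ℂ (fun μ => besselKNonint μ l) μ := by
  refine DifferentiableAt.div ?_ (hasDerivAt_sin_pi_mul μ).differentiableAt h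
  exact ((((differentiable_besselI_order l).comp differentiable_neg).sub
      (differentiable_besselI_order l)) μ).const_mul _

/-- A function holomorphic away from integral orders with a limit at `m` has a removable
singularity, and the circle of radius `1/2` encloses no other integer. A limit in the order thus
becomes an integral over non-integral orders, under which one may differentiate in `l`. -/
theorem cauchy_formula_punctured {f : ℂ → ℂ} {m : ℤ} {y : ℂ}
    (hd : ∀ μ : ℂ, Complex.sin (Real.pi * μ) ≠ 0 → DifferentiableAt ℂ f μ)
    (hy : Filter.Tendsto f (nhdsWithin (m : ℂ) {(m : ℂ)}ᶜ) (nhds y)) :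
    ∮ μ in C((m : ℂ), 1 / 2), (μ - m)⁻¹ • f μ = (2 * Real.pi * Complex.I : ℂ) • y := by
  refine Complex.circleIntegral_sub_center_inv_smul_of_differentiable_on_off_countable_of_tendsto
    (by norm_num) Set.countable_empty ?_ ?_ hy
  · rintro μ ⟨h1, h2⟩
    exact (hd μ (sin_pi_mul_ne_zero (mem_closedBall_iff_norm.mp h1) h2)).continuousAt.continuousWithinAt
  · rintro μ ⟨⟨h1, h2⟩, -⟩
    exact hd μ (sin_pi_mul_ne_zero (mem_ball_iff_norm.mp h1).le h2)

theorem hasDerivAt_intervalIntegral_of_continuous {G G' : ℂ → ℝ → ℂ} (a b : ℝ)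
    (hG : Continuous (Function.uncurry G)) (hG' : Continuous (Function.uncurry G'))
    (h : ∀ l θ, HasDerivAt (fun l => G l θ) (G' l θ) l) (l : ℂ) :
    HasDerivAt (fun l => ∫ θ in a..b, G l θ) (∫ θ in a..b, G' l θ) l := by
  obtain ⟨M, hM⟩ := ((isCompact_closedBall l 1).prod
    (isCompact_uIcc (a := a) (b := b))).exists_bound_of_continuousOn hG'.continuousOn
  have hc : ∀ l, Continuous (G l) := fun l => hG.comp (Continuous.prodMk_right l)
  refine (intervalIntegral.hasDerivAt_integral_of_dominated_loc_of_deriv_le (bound := fun _ => M)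
    (Metric.closedBall_mem_nhds l one_pos) (Filter.Eventually.of_forall fun l =>
      (hc l).aestronglyMeasurable) ((hc l).intervalIntegrable _ _)
    (hG'.comp (Continuous.prodMk_right l)).aestronglyMeasurable ?_
    intervalIntegrable_const ?_).2
  · exact Filter.Eventually.of_forall fun θ hθ l' hl' =>
      hM (l', θ) ⟨hl', Set.uIoc_subset_uIcc hθ⟩
  · exact Filter.Eventually.of_forall fun θ _ l' _ => h l' θ

theorem continuous_besselKNonint_circle (m : ℤ) (j : ℂ)
    (hj : ∀ θ, Complex.sin (Real.pi * (circleMap (m : ℂ) (1 / 2) θ - j)) ≠ 0) :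
    Continuous fun q : ℂ × ℝ => besselKNonint (circleMap (m : ℂ) (1 / 2) q.2 - j) q.1 := by
  have hc : Continuous fun q : ℂ × ℝ => circleMap (m : ℂ) (1 / 2) q.2 - j :=
    ((continuous_circleMap _ _).comp continuous_snd).sub continuous_const
  refine Continuous.div (continuous_const.mul (Continuous.sub ?_ ?_)) ?_ fun q => hj q.2
  · exact continuous_besselI.comp (hc.neg.prodMk continuous_fst)
  · exact continuous_besselI.comp (hc.prodMk continuous_fst)
  · exact Complex.continuous_sin.comp (continuous_const.mul hc)

theorem sin_pi_mul_sub_one_ne_zero {μ : ℂ} (h : Complex.sin (Real.pi * μ) ≠ 0) :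
    Complex.sin (Real.pi * (μ - 1)) ≠ 0 := by
  rw [mul_sub, mul_one, Complex.sin_sub_pi]
  exact neg_ne_zero.mpr h

/-- `x K_m' = -x K_{m-1} - m K_m`. -/
theorem hasDerivAt_besselK (m : ℤ) (l : ℂ) :
    HasDerivAt (fun l => besselK m l)
      (-(Complex.exp l * besselK (m - 1) l) - m * besselK m l) l := by
  have hpi : (2 * Real.pi * Complex.I : ℂ) ≠ 0 := Complex.two_pi_I_ne_zero
  -- The `l`-derivative at non-integral order. Both `K_m` and the claimed derivative are Cauchy
  -- integrals, of `K_μ` and of `D'`, so differentiation under the integral sign replaces an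
  -- interchange of limits.
  set D' : ℂ → ℂ → ℂ := fun μ l =>
    -(Complex.exp l * besselKNonint (μ - 1) l) - μ * besselKNonint μ l
  have hs : ∀ θ, Complex.sin (Real.pi * circleMap (m : ℂ) (1 / 2) θ) ≠ 0 := fun θ =>
    sin_pi_mul_ne_zero (norm_circleMap_half_sub m θ) (circleMap_half_ne m θ)
  have h0 : ∀ l, besselK m l = (2 * Real.pi * Complex.I : ℂ)⁻¹ *
      ∮ μ in C((m : ℂ), 1 / 2), (μ - m)⁻¹ • besselKNonint μ l := fun l => by
    rw [cauchy_formula_punctured (fun μ hμ => differentiableAt_besselKNonint_order l hμ)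
      (tendsto_besselKNonint m l), smul_eq_mul, inv_mul_cancel_left₀ hpi]
  have hD : ∀ μ, Complex.sin (Real.pi * μ) ≠ 0 → DifferentiableAt ℂ (fun μ => D' μ l) μ := by
    intro μ hμ
    have h1 := differentiableAt_besselKNonint_order l hμ
    have h2 := (differentiableAt_besselKNonint_order l (sin_pi_mul_sub_one_ne_zero hμ)).comp μ
      (differentiableAt_id.sub_const (1 : ℂ))
    exact ((h2.const_mul _).neg).sub (differentiableAt_id.mul h1)
  have hsub : Filter.Tendsto (fun μ : ℂ => μ - 1) (nhdsWithin (m : ℂ) {(m : ℂ)}ᶜ)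
      (nhdsWithin ((m - 1 : ℤ) : ℂ) {((m - 1 : ℤ) : ℂ)}ᶜ) := by
    refine tendsto_nhdsWithin_iff.mpr ⟨?_, ?_⟩
    · push_cast
      exact (Continuous.tendsto (by fun_prop) (m : ℂ)).mono_left nhdsWithin_le_nhds
    · filter_upwards [self_mem_nhdsWithin] with μ hμ
      simpa using hμ
  have hT : Filter.Tendsto (fun μ => D' μ l) (nhdsWithin (m : ℂ) {(m : ℂ)}ᶜ)
      (nhds (-(Complex.exp l * besselK (m - 1) l) - m * besselK m l)) :=
    ((((tendsto_besselKNonint (m - 1) l).comp hsub).const_mul _).neg).sub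
      ((Filter.tendsto_id.mono_left nhdsWithin_le_nhds).mul (tendsto_besselKNonint m l))
  have h1 := cauchy_formula_punctured hD hT
  have h2 : -(Complex.exp l * besselK (m - 1) l) - m * besselK m l =
      (2 * Real.pi * Complex.I : ℂ)⁻¹ * ∮ μ in C((m : ℂ), 1 / 2), (μ - m)⁻¹ • D' μ l := by
    rw [h1, smul_eq_mul, inv_mul_cancel_left₀ hpi]
  rw [h2]
  simp only [h0, circleIntegral]
  refine HasDerivAt.const_mul _ (hasDerivAt_intervalIntegral_of_continuous 0 (2 * Real.pi)
    (G := fun l θ => deriv (circleMap (m : ℂ) (1 / 2)) θ •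
      (circleMap (m : ℂ) (1 / 2) θ - m)⁻¹ • besselKNonint (circleMap (m : ℂ) (1 / 2) θ) l)
    (G' := fun l θ => deriv (circleMap (m : ℂ) (1 / 2)) θ •
      (circleMap (m : ℂ) (1 / 2) θ - m)⁻¹ • D' (circleMap (m : ℂ) (1 / 2) θ) l) ?_ ?_ ?_ l)
  all_goals
    have hk0 := continuous_besselKNonint_circle m 0 (by simpa using hs)
    simp only [sub_zero] at hk0
    have hk1 := continuous_besselKNonint_circle m 1 fun θ => sin_pi_mul_sub_one_ne_zero (hs θ)
    have hw : Continuous fun q : ℂ × ℝ => deriv (circleMap (m : ℂ) (1 / 2)) q.2 := by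
      simp only [deriv_circleMap]
      exact ((continuous_circleMap _ _).comp continuous_snd).mul continuous_const
    have hcm : Continuous fun q : ℂ × ℝ => circleMap (m : ℂ) (1 / 2) q.2 :=
      (continuous_circleMap _ _).comp continuous_snd
    have hi : Continuous fun q : ℂ × ℝ => (circleMap (m : ℂ) (1 / 2) q.2 - m)⁻¹ :=
      (hcm.sub continuous_const).inv₀ fun q => sub_ne_zero.mpr (circleMap_half_ne m q.2)
  · exact hw.smul (hi.smul hk0)
  · exact hw.smul (hi.smul
      ((((Complex.continuous_exp.comp continuous_fst).mul hk1).neg).sub (hcm.mul hk0)))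
  · intro l θ
    simp only [smul_eq_mul]
    exact ((hasDerivAt_besselKNonint _ l).const_mul _).const_mul _

theorem differentiable_besselK (m : ℤ) : Differentiable ℂ fun l => besselK m l :=
  fun l => (hasDerivAt_besselK m l).differentiableAt

/-! ### Holomorphic dependence of integrals on a parameter -/

open MeasureTheory in
-- For holomorphic integrands a majorant of the functions suffices: Cauchy's estimate turns it into
-- one for the derivatives on a smaller ball.
theorem hasDerivAt_integral_of_norm_le {α : Type*} [MeasurableSpace α] {ν : Measure α}
    {F : ℂ → α → ℂ} {z₀ : ℂ} {r : ℝ} (hr : 0 < r) {b : α → ℝ} (hb : Integrable b ν)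
    (hm : ∀ z ∈ Metric.ball z₀ r, AEStronglyMeasurable (F z) ν)
    (hd : ∀ᵐ t ∂ν, DifferentiableOn ℂ (fun z => F z t) (Metric.ball z₀ r))
    (hle : ∀ᵐ t ∂ν, ∀ z ∈ Metric.ball z₀ r, ‖F z t‖ ≤ b t) :
    HasDerivAt (fun z => ∫ t, F z t ∂ν) (∫ t, deriv (fun z => F z t) z₀ ∂ν) z₀ := by
  have h0 : z₀ ∈ Metric.ball z₀ r := Metric.mem_ball_self hr
  have hmeas : AEStronglyMeasurable (fun t => deriv (fun z => F z t) z₀) ν := by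
    -- A sequence in the ball tending to `z₀`; the derivative is a limit of the corresponding
    -- difference quotients and so inherits measurability.
    set c : ℕ → ℂ := fun n => z₀ + ((r / 2 : ℝ) : ℂ) * (1 / ((n : ℂ) + 1))
    have hc1 : ∀ n, c n ∈ Metric.ball z₀ r := fun n => by
      have h1 : ‖(n : ℂ) + 1‖ = n + 1 := by
        rw [← Nat.cast_add_one, Complex.norm_natCast]; push_cast; ring
      rw [mem_ball_iff_norm, add_sub_cancel_left, norm_mul, norm_div, h1, norm_one,
        Complex.norm_real, Real.norm_of_nonneg (by positivity)]
      have h2 : 1 / ((n : ℝ) + 1) ≤ 1 := by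
        rw [div_le_one (by positivity)]; linarith [Nat.cast_nonneg (α := ℝ) n]
      nlinarith
    have hc2 : Filter.Tendsto c Filter.atTop (nhdsWithin z₀ {z₀}ᶜ) := by
      refine tendsto_nhdsWithin_iff.mpr ⟨?_, Filter.Eventually.of_forall fun n => ?_⟩
      · simpa [c] using (tendsto_one_div_add_atTop_nhds_zero_nat (𝕜 := ℂ)).const_mul
          ((r / 2 : ℝ) : ℂ) |>.const_add z₀
      · have : ((n : ℂ) + 1) ≠ 0 := Nat.cast_add_one_ne_zero n
        simp [c, hr.ne', this]
    refine aestronglyMeasurable_of_tendsto_ae Filter.atTop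
      (f := fun n t => slope (fun z => F z t) z₀ (c n)) (fun n => ?_) ?_
    · simp only [slope_def_field, div_eq_mul_inv]
      exact ((hm _ (hc1 n)).sub (hm _ h0)).mul_const _
    · filter_upwards [hd] with t ht
      have := (ht.differentiableAt (Metric.isOpen_ball.mem_nhds h0)).hasDerivAt
      exact (hasDerivAt_iff_tendsto_slope.mp this).comp hc2
  refine (hasDerivAt_integral_of_dominated_loc_of_deriv_le (bound := fun t => b t / (r / 4))
    (F' := fun z t => deriv (fun z => F z t) z) (Metric.ball_mem_nhds z₀ (half_pos hr)) ?_ ?_ hmeas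
    ?_ (hb.div_const _) ?_).2
  · filter_upwards [Metric.ball_mem_nhds z₀ hr] with z hz using hm z hz
  · exact hb.mono' (hm _ h0) (by filter_upwards [hle] with t ht using ht _ h0)
  · filter_upwards [hd, hle] with t ht hlt z hz
    -- For `z` within `r/2` of the centre, Cauchy's estimate on radius `r/4` stays inside the region
    -- where the majorant holds.
    have hsub : Metric.closedBall z (r / 4) ⊆ Metric.ball z₀ r := by
      refine Metric.closedBall_subset_ball' ?_
      have := Metric.mem_ball.mp hz
      linarith
    refine Complex.norm_deriv_le_of_forall_mem_sphere_norm_le (by positivity) ?_ fun w hw =>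
      hlt w (hsub (Metric.sphere_subset_closedBall hw))
    exact (ht.mono hsub).diffContOnCl_ball subset_rfl
  · filter_upwards [hd] with t ht z hz
    exact (ht.differentiableAt (Metric.isOpen_ball.mem_nhds
      (Metric.ball_subset_ball (half_le_self hr.le) hz))).hasDerivAt

/-! ### The integral representation of `K_μ` -/

/-- The integrand of `K_μ(x) = (1/2) ∫ e^{-x cosh t + μ t} dt`. -/
def kapIntegrand (x μ : ℂ) (t : ℝ) : ℂ := Complex.exp (-(x * Complex.cosh t) + μ * t)

/-- `(1/2) ∫ e^{-x cosh t + μ t} dt`, `x = e^l`. -/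
def kap (μ l : ℂ) : ℂ := 1 / 2 * ∫ t : ℝ, kapIntegrand (Complex.exp l) μ t

theorem continuous_kapIntegrand (x μ : ℂ) : Continuous (kapIntegrand x μ) := by
  unfold kapIntegrand
  fun_prop

theorem sq_div_four_le_cosh (t : ℝ) : t ^ 2 / 4 ≤ Real.cosh t := by
  rw [← Real.cosh_abs, Real.cosh_eq, ← sq_abs]
  have := Real.quadratic_le_exp_of_nonneg (abs_nonneg t)
  have := Real.exp_pos (-|t|)
  linarith [abs_nonneg t]

theorem norm_kapIntegrand (x μ : ℂ) (t : ℝ) :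
    ‖kapIntegrand x μ t‖ = Real.exp (-(x.re * Real.cosh t) + μ.re * t) := by
  rw [kapIntegrand, Complex.norm_exp, ← Complex.ofReal_cosh]
  simp

/-- A Gaussian majorant, uniform in `x` and `μ`: half of the decay `εt²/4` coming from `cosh t ≥
t²/4` absorbs the linear term `R|t|`. -/
theorem norm_kapIntegrand_le {x μ : ℂ} {ε R : ℝ} (hε : 0 < ε) (hx : ε ≤ x.re) (hμ : ‖μ‖ ≤ R)
    (t : ℝ) : ‖kapIntegrand x μ t‖ ≤
      Real.exp (2 * R ^ 2 / ε) * Real.exp (-(ε / 8) * t ^ 2) := by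
  rw [norm_kapIntegrand, ← Real.exp_add, Real.exp_le_exp]
  have h1 : ε * (t ^ 2 / 4) ≤ x.re * Real.cosh t :=
    mul_le_mul hx (sq_div_four_le_cosh t) (by positivity) (hε.le.trans hx)
  have h2 : μ.re * t ≤ R * |t| :=
    (le_abs_self _).trans ((abs_mul _ _).le.trans
      (mul_le_mul_of_nonneg_right ((Complex.abs_re_le_norm μ).trans hμ) (abs_nonneg t)))
  have h3 : R * |t| ≤ 2 * R ^ 2 / ε + ε / 8 * t ^ 2 := by
    -- Completing the square; the constant `2R²/ε` of the bound originates here.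
    have h4 : 0 ≤ (4 * R - ε * |t|) ^ 2 / (8 * ε) := by positivity
    have h5 : (4 * R - ε * |t|) ^ 2 / (8 * ε) = 2 * R ^ 2 / ε + ε / 8 * t ^ 2 - R * |t| := by
      rw [← sq_abs t]; field_simp; ring
    linarith
  linarith

open MeasureTheory in
theorem integrable_kapBound {ε : ℝ} (hε : 0 < ε) (R : ℝ) :
    Integrable fun t : ℝ => Real.exp (2 * R ^ 2 / ε) * Real.exp (-(ε / 8) * t ^ 2) :=
  (integrable_exp_neg_mul_sq (by positivity)).const_mul _

open MeasureTheory in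
theorem integrable_kapIntegrand {x : ℂ} (hx : 0 < x.re) (μ : ℂ) :
    Integrable (kapIntegrand x μ) :=
  (integrable_kapBound hx ‖μ‖).mono' (continuous_kapIntegrand x μ).aestronglyMeasurable
    (Filter.Eventually.of_forall fun t => norm_kapIntegrand_le hx le_rfl le_rfl t)

theorem kapIntegrand_mul_exp (x μ : ℂ) (t : ℝ) :
    kapIntegrand x μ t * Complex.exp t = kapIntegrand x (μ + 1) t := by
  rw [kapIntegrand, kapIntegrand, ← Complex.exp_add]; congr 1; ring

theorem kapIntegrand_mul_exp_neg (x μ : ℂ) (t : ℝ) :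
    kapIntegrand x μ t * Complex.exp (-t) = kapIntegrand x (μ - 1) t := by
  rw [kapIntegrand, kapIntegrand, ← Complex.exp_add]; congr 1; ring

open MeasureTheory in
/-- Integration by parts: `x ∫ sinh t e^{-x cosh t + μ t} dt = μ ∫ e^{-x cosh t + μ t} dt`. -/
theorem integral_kapIntegrand_parts {x : ℂ} (hx : 0 < x.re) (μ : ℂ) :
    x * ((∫ t, kapIntegrand x (μ + 1) t) - ∫ t, kapIntegrand x (μ - 1) t) / 2 =
      μ * ∫ t, kapIntegrand x μ t := by
  have h1 := integrable_kapIntegrand hx (μ + 1)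
  have h2 := integrable_kapIntegrand hx (μ - 1)
  have h3 := integrable_kapIntegrand hx μ
  have hd : ∀ t : ℝ, HasDerivAt (kapIntegrand x μ)
      (μ * kapIntegrand x μ t - x / 2 * (kapIntegrand x (μ + 1) t - kapIntegrand x (μ - 1) t)) t := by
    intro t
    have e1 : HasDerivAt (fun z : ℂ => Complex.exp (-(x * Complex.cosh z) + μ * z))
        (Complex.exp (-(x * Complex.cosh t) + μ * t) * (-(x * Complex.sinh t) + μ * 1)) (t : ℂ) :=
      (((Complex.hasDerivAt_cosh t).const_mul x).neg.add ((hasDerivAt_id _).const_mul μ)).cexp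
    have e2 := e1.comp_ofReal
    convert! e2 using 1
    rw [← kapIntegrand_mul_exp, ← kapIntegrand_mul_exp_neg, Complex.sinh, kapIntegrand]
    ring
  have hi := (h3.const_mul μ).sub ((h1.sub h2).const_mul (x / 2))
  have h0 := integral_eq_zero_of_hasDerivAt_of_integrable hd hi h3
  have e := integral_sub (h3.const_mul μ) ((h1.sub h2).const_mul (x / 2))
  simp only [Pi.sub_apply] at e
  rw [e, integral_const_mul, integral_const_mul, integral_sub h1 h2] at h0
  linear_combination -h0

theorem exp_re_pos {l : ℂ} (hl : |l.im| < Real.pi / 2) : 0 < (Complex.exp l).re := by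
  rw [Complex.exp_re]
  exact mul_pos (Real.exp_pos _) (Real.cos_pos_of_mem_Ioo (abs_lt.mp hl))

theorem exists_ball_re_exp {l : ℂ} (hl : |l.im| < Real.pi / 2) :
    ∃ ε > 0, ∃ r > 0, ∀ z ∈ Metric.ball l r, ε ≤ (Complex.exp z).re := by
  have h := exp_re_pos hl
  have h2 : ∀ᶠ z in nhds l, (Complex.exp l).re / 2 < (Complex.exp z).re :=
    (Complex.continuous_re.comp Complex.continuous_exp).continuousAt.eventually
      (lt_mem_nhds (half_lt_self h))
  obtain ⟨r, hr, hb⟩ := Metric.eventually_nhds_iff_ball.mp h2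
  exact ⟨_, half_pos h, r, hr, fun z hz => (hb z hz).le⟩

open MeasureTheory in
/-- `x K_μ' = -x K_{μ-1} - μ K_μ` for the integral representation. -/
theorem hasDerivAt_kap (μ : ℂ) {l : ℂ} (hl : |l.im| < Real.pi / 2) :
    HasDerivAt (kap μ) (-(Complex.exp l * kap (μ - 1) l) - μ * kap μ l) l := by
  obtain ⟨ε, hε, r, hr, hb⟩ := exists_ball_re_exp hl
  have hx := exp_re_pos hl
  have hF : ∀ (t : ℝ) (z : ℂ), HasDerivAt (fun z => kapIntegrand (Complex.exp z) μ t)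
      (-(Complex.exp z / 2) * (kapIntegrand (Complex.exp z) (μ + 1) t +
        kapIntegrand (Complex.exp z) (μ - 1) t)) z := by
    intro t z
    have := ((((Complex.hasDerivAt_exp z).mul_const (Complex.cosh t)).neg).add_const (μ * t)).cexp
    convert! this using 1
    rw [← kapIntegrand_mul_exp, ← kapIntegrand_mul_exp_neg, Pi.neg_apply, Complex.cosh,
      kapIntegrand, Complex.cosh]
    ring
  have h := hasDerivAt_integral_of_norm_le (ν := volume)
    (F := fun z t => kapIntegrand (Complex.exp z) μ t) hr
    (integrable_kapBound hε ‖μ‖) (fun z _ => (continuous_kapIntegrand _ μ).aestronglyMeasurable)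
    (Filter.Eventually.of_forall fun t z _ => (hF t z).differentiableAt.differentiableWithinAt)
    (Filter.Eventually.of_forall fun t z hz => norm_kapIntegrand_le hε (hb z hz) le_rfl t)
  have h2 := h.const_mul (1 / 2 : ℂ)
  convert! h2 using 1
  simp only [(hF _ l).deriv]
  rw [integral_const_mul, integral_add (integrable_kapIntegrand hx _)
    (integrable_kapIntegrand hx _), kap, kap]
  have := integral_kapIntegrand_parts hx μ
  linear_combination (1 / 2 : ℂ) * this

open MeasureTheory in
theorem kap_neg (μ l : ℂ) : kap (-μ) l = kap μ l := by
  rw [kap, kap, ← integral_neg_eq_self]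
  simp [kapIntegrand]

open MeasureTheory in
theorem continuous_kap_order {l : ℂ} (hl : |l.im| < Real.pi / 2) :
    Continuous fun μ => kap μ l := by
  have hx := exp_re_pos hl
  refine continuous_const.mul (continuous_iff_continuousAt.mpr fun μ => ?_)
  refine continuousAt_of_dominated
    (Filter.Eventually.of_forall fun ν => (continuous_kapIntegrand _ ν).aestronglyMeasurable)
    ?_ (integrable_kapBound hx (‖μ‖ + 1)) (Filter.Eventually.of_forall fun t => ?_)
  · filter_upwards [Metric.ball_mem_nhds μ one_pos] with ν hν
    refine Filter.Eventually.of_forall fun t => norm_kapIntegrand_le hx le_rfl ?_ t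
    have h1 := norm_sub_norm_le ν μ
    have h2 := mem_ball_iff_norm.mp hν
    linarith
  · unfold kapIntegrand
    fun_prop

open MeasureTheory in
-- Euler's integral for `Γ` after substituting the exponential for the variable.
theorem integrable_gamma_exp {s : ℂ} (hs : 0 < s.re) :
    Integrable (fun t : ℝ => Complex.exp (-Complex.exp t + s * t)) ∧
      ∫ t : ℝ, Complex.exp (-Complex.exp t + s * t) = Complex.Gamma s := by
  have hi : Real.exp '' Set.univ = Set.Ioi 0 := by rw [Set.image_univ, Real.range_exp]
  have hd : ∀ t ∈ Set.univ, HasDerivWithinAt Real.exp (Real.exp t) Set.univ t :=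
    fun t _ => (Real.hasDerivAt_exp t).hasDerivWithinAt
  have e : ∀ t : ℝ, |Real.exp t| • (((Real.exp (-Real.exp t) : ℝ) : ℂ) *
      ((Real.exp t : ℝ) : ℂ) ^ (s - 1)) = Complex.exp (-Complex.exp t + s * t) := by
    intro t
    rw [abs_of_pos (Real.exp_pos t), Complex.real_smul, Complex.cpow_def_of_ne_zero
      (by exact_mod_cast (Real.exp_pos t).ne'), ← Complex.ofReal_log (Real.exp_pos t).le,
      Real.log_exp]
    push_cast
    rw [← Complex.exp_add, ← Complex.exp_add]
    congr 1; ring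
  have h1 := integrableOn_image_iff_integrableOn_abs_deriv_smul MeasurableSet.univ hd
    Real.exp_injective.injOn (fun x : ℝ => ((Real.exp (-x) : ℝ) : ℂ) * (x : ℂ) ^ (s - 1))
  have h2 := integral_image_eq_integral_abs_deriv_smul MeasurableSet.univ hd
    Real.exp_injective.injOn (fun x : ℝ => ((Real.exp (-x) : ℝ) : ℂ) * (x : ℂ) ^ (s - 1))
  simp only [e] at h1 h2
  rw [hi] at h1 h2
  rw [Measure.restrict_univ] at h2
  rw [integrableOn_univ] at h1
  exact ⟨h1.mp (Complex.GammaIntegral_convergent hs), by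
    rw [← h2, Complex.Gamma_eq_integral hs, Complex.GammaIntegral]⟩

open MeasureTheory in
theorem exp_mul_kap (μ : ℂ) (l : ℝ) :
    Complex.exp (μ * l) * kap μ l = 1 / 2 * Complex.exp (μ * Complex.log 2) *
      ∫ t : ℝ, Complex.exp (-(Complex.exp (2 * l) / 4 * Complex.exp (-t))) *
        Complex.exp (-Complex.exp t + μ * t) := by
  have h2 : (Real.log 2 : ℂ) = Complex.log 2 := by
    rw [Complex.ofReal_log (by norm_num)]; norm_num
  -- The shift by `log 2 - l` turns `x cosh t` into `e^t + (x²/4) e^{-t}`. As `x → 0` the second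
  -- part disappears and Euler's integral for `Γ(μ)` remains.
  rw [kap, ← integral_add_right_eq_self _ (Real.log 2 - l), mul_left_comm, mul_assoc]
  congr 1
  rw [← integral_const_mul, ← integral_const_mul]
  refine integral_congr_ae (Filter.Eventually.of_forall fun t => ?_)
  simp only [kapIntegrand]
  rw [← Complex.exp_add, ← Complex.exp_add, ← Complex.exp_add]
  congr 1
  push_cast
  rw [Complex.cosh, h2]
  have e1 : Complex.exp (t + (Complex.log 2 - l)) = Complex.exp t * 2 / Complex.exp l := by
    rw [Complex.exp_add, Complex.exp_sub, Complex.exp_log two_ne_zero, mul_div_assoc]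
  have e2 : Complex.exp (-(t + (Complex.log 2 - l))) = Complex.exp (-t) * Complex.exp l / 2 := by
    rw [neg_add, neg_sub, Complex.exp_add, Complex.exp_sub, Complex.exp_log two_ne_zero,
      mul_div_assoc]
  have e3 : Complex.exp (2 * l) = Complex.exp l ^ 2 := by
    rw [← Complex.exp_nat_mul]; norm_num
  rw [e1, e2, e3]
  have := Complex.exp_ne_zero (l : ℂ)
  field_simp
  ring

open MeasureTheory in
theorem tendsto_kap_atBot {μ : ℂ} (hμ : 0 < μ.re) :
    Filter.Tendsto (fun l : ℝ => Complex.exp (μ * l) * kap μ l) Filter.atBot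
      (nhds (1 / 2 * Complex.exp (μ * Complex.log 2) * Complex.Gamma μ)) := by
  simp only [exp_mul_kap]
  refine Filter.Tendsto.const_mul _ ?_
  obtain ⟨hi, hg⟩ := integrable_gamma_exp hμ
  rw [← hg]
  refine tendsto_integral_filter_of_dominated_convergence _
    (Filter.Eventually.of_forall fun l => Continuous.aestronglyMeasurable (by fun_prop))
    (Filter.Eventually.of_forall fun l => Filter.Eventually.of_forall fun t => ?_) hi.norm
    (Filter.Eventually.of_forall fun t => ?_)
  · rw [norm_mul]
    refine mul_le_of_le_one_left (norm_nonneg _) ?_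
    rw [Complex.norm_exp, Real.exp_le_one_iff]
    have : (-(Complex.exp (2 * l) / 4 * Complex.exp (-t))).re =
        -(Real.exp (2 * l) / 4 * Real.exp (-t)) := by
      rw [← Complex.ofReal_re (-(Real.exp (2 * l) / 4 * Real.exp (-t)))]
      push_cast
      rfl
    rw [this, neg_nonpos]
    positivity
  · have h1 : Filter.Tendsto (fun l : ℝ => Complex.exp (2 * l)) Filter.atBot (nhds 0) := by
      rw [tendsto_zero_iff_norm_tendsto_zero]
      simp only [Complex.norm_exp]
      refine Real.tendsto_exp_atBot.comp ?_
      simp only [Complex.mul_re, Complex.re_ofNat, Complex.ofReal_re, Complex.im_ofNat, zero_mul,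
        sub_zero]
      exact Filter.tendsto_id.const_mul_atBot two_pos
    have h2 : Filter.Tendsto (fun l : ℝ =>
        Complex.exp (-(Complex.exp (2 * l) / 4 * Complex.exp (-t)))) Filter.atBot (nhds 1) := by
      have := ((h1.div_const 4).mul_const (Complex.exp (-t))).neg.cexp
      simpa using this
    simpa using h2.mul_const (Complex.exp (-Complex.exp t + μ * t))

/-! ### Wronskians -/

theorem eq_of_hasDerivAt_zero_of_tendsto {f : ℂ → ℂ} {c : ℂ}
    (hf : ∀ l : ℝ, HasDerivAt f 0 (l : ℂ))
    (hc : Filter.Tendsto (fun l : ℝ => f l) Filter.atBot (nhds c)) (l : ℝ) : f l = c := by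
  have hd : ∀ l : ℝ, HasDerivAt (fun l : ℝ => f l) 0 l := fun l => (hf l).comp_ofReal
  have h : ∀ l' : ℝ, f l' = f l := fun l' =>
    is_const_of_deriv_eq_zero (f := fun l : ℝ => f l) (fun l => (hd l).differentiableAt)
      (fun l => (hd l).deriv) l' l
  simp only [h] at hc
  exact tendsto_nhds_unique tendsto_const_nhds hc

theorem abs_im_ofReal_lt (l : ℝ) : |(l : ℂ).im| < Real.pi / 2 := by
  rw [Complex.ofReal_im, abs_zero]; positivity

/-- The hypotheses on `(p, q)` are the first order system satisfied by `(I_{μ-1}, I_μ)` and by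
`(I_{1-μ}, I_{-μ})`. The pair `(kap μ, kap (1 - μ))` solves it up to a sign, hence the plus in the
conserved combination. -/
theorem hasDerivAt_wronskian_kap (μ : ℂ) (l : ℝ) {p q : ℂ → ℂ}
    (hp : HasDerivAt p (Complex.exp l * q l - (1 - μ) * p l) l)
    (hq : HasDerivAt q (Complex.exp l * p l - μ * q l) l) :
    HasDerivAt (fun l => Complex.exp l * (kap μ l * p l + kap (1 - μ) l * q l)) 0 l := by
  have ha := hasDerivAt_kap μ (abs_im_ofReal_lt l)
  have hb := hasDerivAt_kap (1 - μ) (abs_im_ofReal_lt l)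
  have e1 : kap (μ - 1) l = kap (1 - μ) l := by rw [← kap_neg, neg_sub]
  have e2 : kap (1 - μ - 1) l = kap μ l := by rw [← kap_neg]; congr 1; ring
  rw [e1] at ha
  rw [e2] at hb
  convert! (Complex.hasDerivAt_exp (l : ℂ)).mul ((ha.mul hp).add (hb.mul hq)) using 1
  simp only [Pi.add_apply, Pi.mul_apply]
  ring

theorem hasDerivAt_wronskian {μ l : ℂ} {p q i j : ℂ → ℂ}
    (hp : HasDerivAt p (Complex.exp l * q l - (1 - μ) * p l) l)
    (hq : HasDerivAt q (Complex.exp l * p l - μ * q l) l)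
    (hi : HasDerivAt i (Complex.exp l * j l - (1 - μ) * i l) l)
    (hj : HasDerivAt j (Complex.exp l * i l - μ * j l) l) :
    HasDerivAt (fun l => Complex.exp l * (q l * i l - j l * p l)) 0 l := by
  convert! (Complex.hasDerivAt_exp l).mul ((hq.mul hi).sub (hj.mul hp)) using 1
  simp only [Pi.sub_apply, Pi.mul_apply]
  ring

theorem tendsto_exp_mul_atBot {c : ℂ} (hc : 0 < c.re) :
    Filter.Tendsto (fun l : ℝ => Complex.exp (c * l)) Filter.atBot (nhds 0) := by
  rw [tendsto_zero_iff_norm_tendsto_zero]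
  simp only [Complex.norm_exp]
  refine Real.tendsto_exp_atBot.comp ?_
  simp only [Complex.mul_re, Complex.ofReal_re, Complex.ofReal_im, mul_zero, sub_zero]
  exact Filter.tendsto_id.const_mul_atBot hc

/-- Three constant Wronskians, evaluated at `x → 0`, are linear relations among `kap μ`, `kap (1 -
μ)` and the `I`'s; eliminating `kap (1 - μ)` gives the claim. The strip `0 < Re μ < 1` makes the
small-`x` behaviour of both `kap μ` and `kap (1 - μ)` available. -/
theorem besselKNonint_eq_kap {μ : ℂ} (h0 : 0 < μ.re) (h1 : μ.re < 1) (l : ℝ) :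
    besselKNonint μ l = kap μ l := by
  have h1' : 0 < (1 - μ).re := by simpa using h1
  have hpi : (Real.pi : ℂ) ≠ 0 := by exact_mod_cast Real.pi_ne_zero
  have hG0 : Complex.Gamma μ ≠ 0 := Complex.Gamma_ne_zero_of_re_pos h0
  have hG1 : Complex.Gamma (1 - μ) ≠ 0 := Complex.Gamma_ne_zero_of_re_pos h1'
  have hGG := Complex.Gamma_mul_Gamma_one_sub μ
  have hs : Complex.sin (Real.pi * μ) ≠ 0 := by
    intro h
    rw [h, div_zero] at hGG
    exact mul_ne_zero hG0 hG1 hGG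
  -- the solutions of the first order system
  have hi : ∀ l, HasDerivAt (fun l => besselI (μ - 1) l)
      (Complex.exp l * besselI μ l - (1 - μ) * besselI (μ - 1) l) l := fun l => by
    have := hasDerivAt_besselI' (μ - 1) l
    rw [sub_add_cancel] at this
    convert! this using 1; ring
  have hj := fun l => hasDerivAt_besselI μ l
  have hp : ∀ l, HasDerivAt (fun l => besselI (1 - μ) l)
      (Complex.exp l * besselI (-μ) l - (1 - μ) * besselI (1 - μ) l) l := fun l => by
    have := hasDerivAt_besselI (1 - μ) l
    rwa [sub_sub_cancel_left] at this
  have hq : ∀ l, HasDerivAt (fun l => besselI (-μ) l)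
      (Complex.exp l * besselI (1 - μ) l - μ * besselI (-μ) l) l := fun l => by
    have := hasDerivAt_besselI' (-μ) l
    rw [neg_add_eq_sub] at this
    convert! this using 1; ring
  -- behaviour at `0`
  have ta := tendsto_kap_atBot h0
  have tb := tendsto_kap_atBot h1'
  have ti := tendsto_besselI_atBot (μ - 1)
  have tj := tendsto_besselI_atBot μ
  have tp := tendsto_besselI_atBot (1 - μ)
  have tq := tendsto_besselI_atBot (-μ)
  have e2 : Complex.exp (μ * Complex.log 2) * Complex.exp ((1 - μ) * Complex.log 2) = 2 := by
    rw [← Complex.exp_add, ← add_mul, add_sub_cancel, one_mul, Complex.exp_log two_ne_zero]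
  have ei : Complex.exp (-(μ - 1) * Complex.log 2) = Complex.exp ((1 - μ) * Complex.log 2) := by
    congr 1; ring
  have eq' : Complex.exp (- -μ * Complex.log 2) = Complex.exp (μ * Complex.log 2) := by
    rw [neg_neg]
  rw [ei, sub_add_cancel] at ti
  rw [eq', neg_add_eq_sub] at tq
  have tμ : Filter.Tendsto (fun l : ℝ => Complex.exp (2 * μ * l)) Filter.atBot (nhds 0) :=
    tendsto_exp_mul_atBot (by simpa using h0)
  have tμ' : Filter.Tendsto (fun l : ℝ => Complex.exp (2 * (1 - μ) * l)) Filter.atBot (nhds 0) :=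
    tendsto_exp_mul_atBot (by simpa using h1)
  have t2 : Filter.Tendsto (fun l : ℝ => Complex.exp (2 * l)) Filter.atBot (nhds 0) :=
    tendsto_exp_mul_atBot (by norm_num)
  have W1 := eq_of_hasDerivAt_zero_of_tendsto (c := 1)
    (fun l => hasDerivAt_wronskian_kap μ l (hi l) (hj l)) (by
      -- Normalised by their leading powers, the two products carry the factors `1` and `x^{2μ}`;
      -- only the first survives at `x → 0`.
      have := (ta.mul ti).add (tμ.mul (tb.mul tj))
      refine (this.congr fun l => ?_).trans_eq ?_
      · have x1 : Complex.exp (l : ℂ) = Complex.exp (μ * l) * Complex.exp (-(μ - 1) * l) := by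
          rw [← Complex.exp_add]; congr 1; ring
        have x2 : Complex.exp (l : ℂ) = Complex.exp (2 * μ * l) *
            (Complex.exp ((1 - μ) * l) * Complex.exp (-μ * l)) := by
          rw [← Complex.exp_add, ← Complex.exp_add]; congr 1; ring
        rw [mul_add]
        nth_rewrite 2 [x2]
        rw [x1]
        ring
      · congr 1
        rw [zero_mul, add_zero]
        have hG := mul_inv_cancel₀ hG0
        linear_combination (1 / 2 * Complex.exp (μ * Complex.log 2) *
          Complex.exp ((1 - μ) * Complex.log 2)) * hG + (1 / 2 : ℂ) * e2) l
  have W2 := eq_of_hasDerivAt_zero_of_tendsto (c := 1)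
    (fun l => hasDerivAt_wronskian_kap μ l (hp l) (hq l)) (by
      have := (tμ'.mul (ta.mul tp)).add (tb.mul tq)
      refine (this.congr fun l => ?_).trans_eq ?_
      · have x1 : Complex.exp (l : ℂ) = Complex.exp ((1 - μ) * l) * Complex.exp (- -μ * l) := by
          rw [← Complex.exp_add]; congr 1; ring
        have x2 : Complex.exp (l : ℂ) = Complex.exp (2 * (1 - μ) * l) *
            (Complex.exp (μ * l) * Complex.exp (-(1 - μ) * l)) := by
          rw [← Complex.exp_add, ← Complex.exp_add]; congr 1; ring
        rw [mul_add]
        nth_rewrite 1 [x2]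
        rw [x1]
        ring
      · congr 1
        rw [zero_mul, zero_add]
        have hG := mul_inv_cancel₀ hG1
        linear_combination (1 / 2 * Complex.exp (μ * Complex.log 2) *
          Complex.exp ((1 - μ) * Complex.log 2)) * hG + (1 / 2 : ℂ) * e2) l
  have W3 := eq_of_hasDerivAt_zero_of_tendsto (c := 2 * Complex.sin (Real.pi * μ) / Real.pi)
    (fun l => hasDerivAt_wronskian (hp l) (hq l) (hi l) (hj l)) (by
      have := (tq.mul ti).sub (t2.mul (tj.mul tp))
      refine (this.congr fun l => ?_).trans_eq ?_
      · have x1 : Complex.exp (l : ℂ) = Complex.exp (- -μ * l) * Complex.exp (-(μ - 1) * l) := by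
          rw [← Complex.exp_add]; congr 1; ring
        have x2 : Complex.exp (l : ℂ) = Complex.exp (2 * l) *
            (Complex.exp (-μ * l) * Complex.exp (-(1 - μ) * l)) := by
          rw [← Complex.exp_add, ← Complex.exp_add]; congr 1; ring
        rw [mul_sub]
        nth_rewrite 2 [x2]
        rw [x1]
        ring
      · congr 1
        rw [zero_mul, sub_zero, mul_mul_mul_comm, e2, ← mul_inv,
          mul_comm (Complex.Gamma (1 - μ)), hGG, inv_div]
        ring) l
  rw [besselKNonint, div_eq_iff hs]
  -- `I_{-μ} W1 - I_μ W2` cancels `kap (1 - μ)` and leaves `kap μ` times the third Wronskian.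
  have key : kap μ l * (2 * Complex.sin (Real.pi * μ) / Real.pi) =
      besselI (-μ) l - besselI μ l := by
    rw [← W3]
    linear_combination besselI (-μ) l * W1 - besselI μ l * W2
  rw [← key]
  field_simp

/-! ### `K_m` for integral `m` -/

theorem tendsto_ofReal_nhdsNE_zero :
    Filter.Tendsto (fun x : ℝ => (x : ℂ)) (nhdsWithin 0 {0}ᶜ) (nhdsWithin 0 {0}ᶜ) := by
  refine tendsto_nhdsWithin_iff.mpr ⟨?_, ?_⟩
  · exact (Complex.continuous_ofReal.tendsto' 0 0 rfl).mono_left nhdsWithin_le_nhds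
  · filter_upwards [self_mem_nhdsWithin] with x hx
    simpa using hx

/-- Holomorphic functions which agree on the real line agree. -/
theorem eqOn_of_eq_ofReal {U : Set ℂ} (hU : IsOpen U) (hc : IsPreconnected U) (h0 : (0 : ℂ) ∈ U)
    {f g : ℂ → ℂ} (hf : DifferentiableOn ℂ f U) (hg : DifferentiableOn ℂ g U)
    (h : ∀ x : ℝ, f x = g x) : Set.EqOn f g U := by
  refine (hf.analyticOnNhd hU).eqOn_of_preconnected_of_frequently_eq (hg.analyticOnNhd hU) hc h0 ?_
  exact tendsto_ofReal_nhdsNE_zero.frequently (Filter.Frequently.of_forall fun x => h x)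

theorem isOpen_strip (c r : ℝ) : IsOpen {l : ℂ | |l.im + c| < r} :=
  isOpen_lt (by fun_prop) continuous_const

theorem convex_strip (c r : ℝ) : Convex ℝ {l : ℂ | |l.im + c| < r} := by
  have h : {l : ℂ | |l.im + c| < r} = Complex.imLm ⁻¹' (Set.Ioo (-r - c) (r - c)) := by
    ext l
    simp only [Set.mem_ofPred_eq, Set.mem_preimage, Set.mem_Ioo, abs_lt, Complex.imLm_coe]
    constructor <;> rintro ⟨h1, h2⟩ <;> constructor <;> linarith
  rw [h]
  exact (convex_Ioo _ _).linear_preimage _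

/-- Order `0` lies on the boundary of the strip `0 < Re μ < 1`; it is reached through small positive
real orders, using continuity of `kap` in the order. -/
theorem besselK_zero_ofReal (l : ℝ) : besselK 0 l = kap 0 l := by
  have h1 := (tendsto_besselKNonint 0 l).comp
    (f := fun x : ℝ => (x : ℂ)) (x := nhdsWithin 0 (Set.Ioi 0))
    (by
      rw [Int.cast_zero]
      exact tendsto_ofReal_nhdsNE_zero.mono_left (nhdsWithin_mono _ fun x hx => ne_of_gt hx))
  have h2 : Filter.Tendsto (fun x : ℝ => kap x l) (nhdsWithin 0 (Set.Ioi 0)) (nhds (kap 0 l)) :=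
    (((continuous_kap_order (abs_im_ofReal_lt l)).comp Complex.continuous_ofReal).tendsto' 0 _
      (by simp)).mono_left nhdsWithin_le_nhds
  refine tendsto_nhds_unique (h1.congr' ?_) h2
  filter_upwards [Ioo_mem_nhdsGT one_pos] with x hx
  exact besselKNonint_eq_kap (by simpa using hx.1) (by simpa using hx.2) l

theorem besselK_zero_eq_kap {l : ℂ} (hl : |l.im| < Real.pi / 2) : besselK 0 l = kap 0 l := by
  refine eqOn_of_eq_ofReal (f := fun l => besselK 0 l) (g := fun l => kap 0 l)
    (U := {l : ℂ | |l.im + 0| < Real.pi / 2}) (isOpen_strip _ _)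
    (convex_strip _ _).isPreconnected ?_ (differentiable_besselK 0).differentiableOn
    (fun z hz => ?_) besselK_zero_ofReal (by simpa using hl)
  · simp [Real.pi_pos]
  · exact (hasDerivAt_kap 0 (by simpa using hz)).differentiableAt.differentiableWithinAt

theorem hasDerivAt_besselK' (m : ℤ) (l : ℂ) :
    HasDerivAt (fun l => besselK m l)
      (-(Complex.exp l * besselK (m + 1) l) + m * besselK m l) l := by
  have h := hasDerivAt_besselK (-m) l
  simp only [besselK_neg] at h
  have e : -m - 1 = -(m + 1) := by ring
  rw [e, besselK_neg] at h
  convert! h using 1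
  push_cast; ring

theorem hasDerivAt_kap' (μ : ℂ) {l : ℂ} (hl : |l.im| < Real.pi / 2) :
    HasDerivAt (kap μ) (-(Complex.exp l * kap (μ + 1) l) + μ * kap μ l) l := by
  have h := hasDerivAt_kap (-μ) hl
  have e : kap (-μ) = kap μ := funext fun l => kap_neg μ l
  have e' : -μ - 1 = -(μ + 1) := by ring
  rw [e', kap_neg, e] at h
  convert! h using 1
  ring

/-- The raising recurrence recovers order `n + 1` from order `n` and its derivative, for both
functions. -/
theorem besselK_nat_eq_kap (n : ℕ) {l : ℂ} (hl : |l.im| < Real.pi / 2) :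
    besselK n l = kap n l := by
  induction n generalizing l with
  | zero => simpa using besselK_zero_eq_kap hl
  | succ n ih =>
    have h1 := hasDerivAt_besselK' n l
    have h2 := hasDerivAt_kap' n hl
    have hU : {l : ℂ | |l.im + 0| < Real.pi / 2} ∈ nhds l :=
      (isOpen_strip _ _).mem_nhds (by simpa using hl)
    have h3 := h1.congr_of_eventuallyEq (f₁ := kap n) (by
      filter_upwards [hU] with z hz
      exact (ih (by simpa using hz)).symm)
    have h4 := h3.unique h2
    have hx := Complex.exp_ne_zero l
    rw [ih hl] at h4
    push_cast at h4 ⊢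
    refine mul_left_cancel₀ hx ?_
    linear_combination -h4

theorem besselK_eq_kap (m : ℤ) {l : ℂ} (hl : |l.im| < Real.pi / 2) :
    besselK m l = kap m l := by
  obtain ⟨n, rfl | rfl⟩ := m.eq_nat_or_neg
  · simpa using besselK_nat_eq_kap n hl
  · rw [besselK_neg]
    push_cast
    rw [kap_neg]
    exact besselK_nat_eq_kap n hl

/-! ### Binomial coefficients -/

theorem choose_succ_mul (a : ℂ) (n : ℕ) :
    ((n : ℂ) + 1) * Ring.choose a (n + 1) = (a - n) * Ring.choose a n := by
  have h : (Polynomial.smeval (descPochhammer ℤ (n + 1)) a) =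
      Polynomial.smeval (descPochhammer ℤ n) a * (a - n) := by
    rw [descPochhammer_succ_right, Polynomial.smeval_mul, Polynomial.smeval_sub,
      Polynomial.smeval_X, Polynomial.smeval_natCast]
    simp
  have hn : ((n : ℂ) + 1) ≠ 0 := Nat.cast_add_one_ne_zero n
  rw [Ring.choose_eq_smul, Ring.choose_eq_smul, h, Nat.factorial_succ, smul_eq_mul, smul_eq_mul]
  push_cast
  field_simp

theorem choose_eq_add (a : ℂ) (n : ℕ) :
    Ring.choose a (n + 1) = Ring.choose (a - 1) n + Ring.choose (a - 1) (n + 1) := by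
  have := Ring.choose_succ_succ (a - 1) n
  rwa [sub_add_cancel] at this

theorem succ_mul_choose_succ (a : ℂ) (n : ℕ) :
    ((n : ℂ) + 1) * Ring.choose a (n + 1) = a * Ring.choose (a - 1) n := by
  rw [choose_eq_add, mul_add, choose_succ_mul]
  ring

theorem choose_second_difference (a : ℂ) (n : ℕ) :
    Ring.choose (a + 1) (n + 2) + Ring.choose (a - 1) (n + 2) =
      2 * Ring.choose a (n + 2) + Ring.choose (a - 1) n := by
  rw [Ring.choose_succ_succ a (n + 1), choose_eq_add a (n + 1), choose_eq_add a n]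
  ring

/-- This identifies the uniform formula `gCoeff` at `m = 0` with the binomial series of `(2 +
r)^{-1/2}`. -/
theorem choose_central (k : ℕ) :
    (4 : ℂ) ^ k * Ring.choose ((k : ℂ) - 1 / 2) (2 * k) = Ring.choose (-1 / 2 : ℂ) k := by
  induction k with
  | zero => simp
  | succ k ih =>
    have h1 := succ_mul_choose_succ (((k + 1 : ℕ) : ℂ) - 1 / 2) (2 * k + 1)
    have h2 := choose_succ_mul ((k : ℂ) - 1 / 2) (2 * k)
    have h3 := choose_succ_mul (-1 / 2 : ℂ) k
    have e : ((k + 1 : ℕ) : ℂ) - 1 / 2 - 1 = k - 1 / 2 := by push_cast; ring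
    rw [e] at h1
    rw [← ih] at h3
    have e2 : 2 * (k + 1) = 2 * k + 1 + 1 := by ring
    rw [e2]
    have hk : ((k : ℂ) + 1) ≠ 0 := Nat.cast_add_one_ne_zero k
    have hk2 : (2 * (k : ℂ) + 1) ≠ 0 := by exact_mod_cast (2 * k).succ_ne_zero
    refine mul_left_cancel₀ hk ?_
    rw [h3, pow_succ]
    push_cast at h1 h2 ⊢
    refine mul_left_cancel₀ hk2 ?_
    linear_combination (2 * (k : ℂ) + 1) * 2 * 4 ^ k * h1 +
      2 * 4 ^ k * ((k : ℂ) + 1 - 1 / 2) * h2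

/-! ### The function `T_m(1 + r) (2 + r)^{-1/2}` -/

/-- `T_m(1 + r) (2 + r)^{-1/2}`, i.e. `cosh (m t) / (√2 cosh (t / 2))` for `r = cosh t - 1`. -/
def gFun (m : ℤ) (r : ℂ) : ℂ :=
  (Polynomial.Chebyshev.T ℂ m).eval (1 + r) * (2 + r) ^ (-(1 / 2) : ℂ)

/-- The Taylor coefficients of `gFun m` at `0`. -/
def gCoeff (m : ℤ) (k : ℕ) : ℂ :=
  (2 : ℂ) ^ (-(1 / 2) : ℂ) * 2 ^ k * Ring.choose ((m : ℂ) + k - 1 / 2) (2 * k)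

theorem gCoeff_zero (m : ℤ) : gCoeff m 0 = (2 : ℂ) ^ (-(1 / 2) : ℂ) := by simp [gCoeff]

/-- The coefficient form of `T_{m+1} + T_{m-1} = 2(1 + r) T_m`: the second difference of a binomial
coefficient in its upper entry lowers its lower entry by two. -/
theorem gCoeff_recurrence (m : ℤ) (k : ℕ) :
    gCoeff (m + 1) (k + 1) + gCoeff (m - 1) (k + 1) =
      2 * gCoeff m (k + 1) + 2 * gCoeff m k := by
  have h := choose_second_difference ((m : ℂ) + (k + 1 : ℕ) - 1 / 2) (2 * k)
  have e1 : (m : ℂ) + (k + 1 : ℕ) - 1 / 2 + 1 = ((m + 1 : ℤ) : ℂ) + (k + 1 : ℕ) - 1 / 2 := by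
    push_cast; ring
  have e2 : (m : ℂ) + (k + 1 : ℕ) - 1 / 2 - 1 = ((m - 1 : ℤ) : ℂ) + (k + 1 : ℕ) - 1 / 2 := by
    push_cast; ring
  have e3 : ((m - 1 : ℤ) : ℂ) + (k + 1 : ℕ) - 1 / 2 = (m : ℂ) + k - 1 / 2 := by
    push_cast; ring
  rw [e1, e2] at h
  simp only [gCoeff]
  rw [show 2 * (k + 1) = 2 * k + 2 by ring]
  have e4 : Ring.choose (((m - 1 : ℤ) : ℂ) + (k + 1 : ℕ) - 1 / 2) (2 * k) =
      Ring.choose ((m : ℂ) + k - 1 / 2) (2 * k) := by rw [e3]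
  rw [e4] at h
  rw [pow_succ]
  linear_combination (2 : ℂ) ^ (-(1 / 2) : ℂ) * 2 ^ k * 2 * h

theorem hasSum_one_add_cpow (a : ℂ) {z : ℂ} (hz : ‖z‖ < 1) :
    HasSum (fun n => Ring.choose a n * z ^ n) ((1 + z) ^ a) := by
  have h := (Complex.one_add_cpow_hasFPowerSeriesOnBall_zero (a := a)).hasSum (y := z) (by
    rw [Metric.mem_eball, edist_zero_right, ← ofReal_norm, ENNReal.ofReal_lt_one]
    exact hz)
  simpa [binomialSeries, FormalMultilinearSeries.ofScalars_apply_eq, mul_comm] using h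

theorem hasSum_gFun_zero {r : ℂ} (hr : ‖r‖ < 2) :
    HasSum (fun k => gCoeff 0 k * r ^ k) (gFun 0 r) := by
  have hz : ‖r / 2‖ < 1 := by
    rw [norm_div, Complex.norm_ofNat]; linarith
  have h := (hasSum_one_add_cpow (-(1 / 2)) hz).mul_left ((2 : ℂ) ^ (-(1 / 2) : ℂ))
  have e : (2 : ℂ) ^ (-(1 / 2) : ℂ) * (1 + r / 2) ^ (-(1 / 2) : ℂ) = gFun 0 r := by
    have h2 : ((2 : ℝ) : ℂ) = 2 := by norm_num
    have h0 : 1 + r / 2 ≠ 0 := fun h => by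
      rw [eq_neg_of_add_eq_zero_right h, norm_neg, norm_one] at hz
      exact lt_irrefl _ hz
    rw [gFun, Polynomial.Chebyshev.T_zero, Polynomial.eval_one, one_mul,
      show (2 + r : ℂ) = ((2 : ℝ) : ℂ) * (1 + r / 2) by push_cast; ring,
      Complex.cpow_def_of_ne_zero two_ne_zero, Complex.cpow_def_of_ne_zero h0,
      Complex.cpow_def_of_ne_zero (mul_ne_zero (by norm_num) h0),
      Complex.log_ofReal_mul two_pos h0, ← Complex.exp_add, Complex.ofReal_log two_pos.le, h2,
      add_mul]
  rw [e] at h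
  convert! h using 2 with k
  have hc := choose_central k
  rw [neg_div] at hc
  rw [gCoeff, ← hc, Int.cast_zero, zero_add, div_pow,
    show (4 : ℂ) ^ k = 2 ^ k * 2 ^ k by rw [← mul_pow]; norm_num]
  field_simp

theorem gFun_recurrence (m : ℤ) (r : ℂ) :
    gFun (m + 1) r + gFun (m - 1) r = 2 * (1 + r) * gFun m r := by
  simp only [gFun, Polynomial.Chebyshev.T_add_one ℂ m, Polynomial.eval_sub, Polynomial.eval_mul,
    Polynomial.eval_ofNat, Polynomial.eval_X]
  ring

theorem hasSum_gFun_three {m : ℤ} {r : ℂ} (h0 : HasSum (fun k => gCoeff m k * r ^ k) (gFun m r)) :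
    HasSum (fun k => (gCoeff (m + 1) k + gCoeff (m - 1) k) * r ^ k)
      (gFun (m + 1) r + gFun (m - 1) r) := by
  rw [gFun_recurrence, ← hasSum_nat_add_iff' 1]
  simp only [Finset.range_one, Finset.sum_singleton, pow_zero, mul_one, gCoeff_recurrence]
  have h1 := (hasSum_nat_add_iff' 1).mpr h0
  simp only [Finset.range_one, Finset.sum_singleton, pow_zero, mul_one] at h1
  convert! (h1.mul_left 2).add (h0.mul_left (2 * r)) using 1
  · funext k; ring
  · rw [gCoeff_zero, gCoeff_zero, gCoeff_zero]; ring

/-- The recurrence at `m = 0` determines only the sum of the orders `1` and `-1`; this symmetry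
separates them and starts the induction. It returns later as `K_{-1} = K_1` at the level of formal
coefficients. -/
theorem gCoeff_one (k : ℕ) : gCoeff (-1) k = gCoeff 1 k := by
  rcases k with _ | k
  · simp [gCoeff_zero]
  · have e1 : ((1 : ℤ) : ℂ) + (k + 1 : ℕ) - 1 / 2 - 1 = k + 1 / 2 := by push_cast; ring
    have e2 : ((-1 : ℤ) : ℂ) + (k + 1 : ℕ) - 1 / 2 = k + 1 / 2 - 1 := by push_cast; ring
    have e3 : ((1 : ℤ) : ℂ) + (k + 1 : ℕ) - 1 / 2 = k + 3 / 2 := by push_cast; ring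
    have h1 := choose_eq_add ((1 : ℤ) + (k + 1 : ℕ) - 1 / 2 : ℂ) (2 * k + 1)
    have h2 := choose_eq_add ((k : ℂ) + 1 / 2) (2 * k + 1)
    have h3 := succ_mul_choose_succ ((k : ℂ) + 1 / 2) (2 * k)
    have h4 := choose_eq_add ((k : ℂ) + 1 / 2) (2 * k)
    rw [e1] at h1
    have hk2 : (2 * (k : ℂ) + 1) ≠ 0 := by exact_mod_cast (2 * k).succ_ne_zero
    have h5 : Ring.choose ((k : ℂ) + 1 / 2) (2 * k + 1) +
        Ring.choose ((k : ℂ) + 1 / 2 - 1) (2 * k + 1) = 0 := by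
      have h6 : Ring.choose ((k : ℂ) + 1 / 2 - 1) (2 * k) =
          2 * Ring.choose ((k : ℂ) + 1 / 2) (2 * k + 1) := by
        refine mul_left_cancel₀ hk2 ?_
        push_cast at h3
        linear_combination -2 * h3
      rw [h6] at h4
      linear_combination -h4
    simp only [gCoeff]
    rw [e2, show 2 * (k + 1) = 2 * k + 1 + 1 by ring, h1, h2]
    linear_combination -((2 : ℂ) ^ (-(1 / 2) : ℂ) * 2 ^ (k + 1)) * h5

theorem hasSum_gFun (m : ℤ) {r : ℂ} (hr : ‖r‖ < 2) :
    HasSum (fun k => gCoeff m k * r ^ k) (gFun m r) := by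
  induction m using Polynomial.Chebyshev.induct with
  | zero => exact hasSum_gFun_zero hr
  | one =>
    have h := hasSum_gFun_three (hasSum_gFun_zero hr)
    have e : gFun (-1) r = gFun 1 r := by
      rw [gFun, gFun, Polynomial.Chebyshev.T_neg]
    simp only [zero_add, zero_sub, gCoeff_one, e] at h
    convert! h.mul_left (1 / 2) using 1
    · funext k; ring
    · ring
  | add_two n h1 h0 =>
    have h := (hasSum_gFun_three h1).sub h0
    rw [show (n : ℤ) + 1 + 1 = n + 2 by ring, show (n : ℤ) + 1 - 1 = n by ring] at h
    convert! h using 1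
    · funext k; ring
    · ring
  | neg_add_one n h0 h1 =>
    have h := (hasSum_gFun_three h0).sub h1
    convert! h using 1
    · funext k; ring
    · ring

/-! ### The slit plane and its sectors -/

/-- The plane cut along `(-∞, -2]`. -/
def slitDomain : Set ℂ := {s | 2 + s ∈ Complex.slitPlane}

theorem isOpen_slitDomain : IsOpen slitDomain :=
  Complex.isOpen_slitPlane.preimage (by fun_prop)

/-- The cut plane is star-shaped about `0`, so `s sin² α` stays in it and the average defining
`borelB` is holomorphic there. -/
theorem mul_mem_slitDomain {s : ℂ} (hs : s ∈ slitDomain) {c : ℝ} (h0 : 0 ≤ c) (h1 : c ≤ 1) :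
    s * c ∈ slitDomain := by
  simp only [slitDomain, Set.mem_ofPred_eq, Complex.mem_slitPlane_iff, Complex.add_re,
    Complex.re_ofNat, Complex.add_im, Complex.im_ofNat, zero_add, Complex.re_mul_ofReal,
    Complex.im_mul_ofReal] at hs ⊢
  rcases h0.eq_or_lt with rfl | h0
  · left; norm_num
  · rcases hs with hs | hs
    · left; nlinarith
    · right; exact mul_ne_zero hs h0.ne'

/-- The closed sector `|arg s| ≤ ψ`. -/
def sector (ψ : ℝ) : Set ℂ :=
  {s | ∃ ρ a : ℝ, 0 ≤ ρ ∧ |a| ≤ ψ ∧ s = ρ * Complex.exp (a * Complex.I)}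

theorem mul_mem_sector {ψ : ℝ} {s : ℂ} (hs : s ∈ sector ψ) {c : ℝ} (h0 : 0 ≤ c) :
    s * c ∈ sector ψ := by
  obtain ⟨ρ, a, hρ, ha, rfl⟩ := hs
  exact ⟨ρ * c, a, mul_nonneg hρ h0, ha, by push_cast; ring⟩

theorem mul_exp_mem_sector {ψ r : ℝ} {w : ℂ} (hr : 0 ≤ r) (hw : |w.im| ≤ ψ) :
    r * Complex.exp w ∈ sector ψ := by
  refine ⟨r * Real.exp w.re, w.im, by positivity, hw, ?_⟩
  push_cast
  rw [mul_assoc, ← Complex.exp_add, Complex.re_add_im]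

theorem two_add_eq (ρ a : ℝ) : (2 : ℂ) + ρ * Complex.exp (a * Complex.I) =
    (2 + ρ * Real.cos a : ℝ) + (ρ * Real.sin a : ℝ) * Complex.I := by
  rw [Complex.exp_mul_I]; push_cast; ring

theorem sector_subset_slitDomain {ψ : ℝ} (hψ : ψ < Real.pi) : sector ψ ⊆ slitDomain := by
  rintro s ⟨ρ, a, hρ, ha, rfl⟩
  rw [slitDomain, Set.mem_ofPred_eq, two_add_eq, Complex.mem_slitPlane_iff]
  simp only [Complex.add_re, Complex.ofReal_re, Complex.mul_re, Complex.I_re, mul_zero,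
    Complex.ofReal_im, Complex.I_im, mul_one, sub_self, add_zero, Complex.add_im, Complex.mul_im,
    zero_add]
  by_cases h : ρ * Real.sin a = 0
  · left
    rcases mul_eq_zero.mp h with h | h
    · rw [h]; norm_num
    · have ha2 := abs_le.mp ha
      have : a = 0 := (Real.sin_eq_zero_iff_of_lt_of_lt (by linarith) (by linarith)).mp h
      rw [this, Real.cos_zero]; linarith
  · exact Or.inr h

/-- A sector of half-opening less than `π` keeps a positive distance from the branch point `-2`, so
`(2 + s)^{-1/2}` is bounded on it. -/
theorem norm_two_add_ge {ψ : ℝ} (hψ : ψ < Real.pi) :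
    ∃ δ > 0, ∀ s ∈ sector ψ, δ ≤ ‖2 + s‖ := by
  by_cases hψ0 : 0 ≤ ψ
  · have hc : -1 < Real.cos ψ := by
      rw [← Real.cos_pi]
      exact Real.cos_lt_cos_of_nonneg_of_le_pi hψ0 le_rfl hψ
    refine ⟨Real.sqrt (2 * (1 + Real.cos ψ)), Real.sqrt_pos.mpr (by linarith), ?_⟩
    rintro s ⟨ρ, a, hρ, ha, rfl⟩
    have hca : Real.cos ψ ≤ Real.cos a := by
      rw [← Real.cos_abs a]
      exact Real.cos_le_cos_of_nonneg_of_le_pi (abs_nonneg a) hψ.le ha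
    refine Real.sqrt_le_iff.mpr ⟨norm_nonneg _, ?_⟩
    rw [two_add_eq, ← Complex.normSq_eq_norm_sq, Complex.normSq_add_mul_I]
    have e : (2 + ρ * Real.cos a) ^ 2 + (ρ * Real.sin a) ^ 2 = 4 + 4 * ρ * Real.cos a + ρ ^ 2 := by
      linear_combination ρ ^ 2 * Real.sin_sq_add_cos_sq a
    rw [e]
    have h1 : 4 * ρ * Real.cos ψ ≤ 4 * ρ * Real.cos a :=
      mul_le_mul_of_nonneg_left hca (by positivity)
    have h2 := Real.cos_le_one ψ
    rcases le_total 0 (Real.cos ψ) with h | h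
    · nlinarith [mul_nonneg hρ h]
    · nlinarith [mul_nonneg (neg_nonneg.mpr h) (sq_nonneg (2 - ρ)), sq_nonneg ρ]
  · refine ⟨1, one_pos, ?_⟩
    rintro s ⟨ρ, a, -, ha, -⟩
    exact absurd ((abs_nonneg a).trans ha) hψ0

theorem exists_polynomial_bound (P : Polynomial ℂ) :
    ∃ (C : ℝ) (M : ℕ), 0 ≤ C ∧ ∀ z, ‖P.eval z‖ ≤ C * (1 + ‖z‖) ^ M := by
  refine ⟨∑ i ∈ Finset.range (P.natDegree + 1), ‖P.coeff i‖, P.natDegree,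
    Finset.sum_nonneg fun _ _ => norm_nonneg _, fun z => ?_⟩
  rw [Polynomial.eval_eq_sum_range, Finset.sum_mul]
  refine (norm_sum_le _ _).trans (Finset.sum_le_sum fun i hi => ?_)
  rw [norm_mul, norm_pow]
  refine mul_le_mul_of_nonneg_left ?_ (norm_nonneg _)
  have h1 : (1 : ℝ) ≤ 1 + ‖z‖ := by linarith [norm_nonneg z]
  calc ‖z‖ ^ i ≤ (1 + ‖z‖) ^ i := by gcongr; linarith
    _ ≤ (1 + ‖z‖) ^ P.natDegree :=
      pow_le_pow_right₀ h1 (Nat.lt_succ_iff.mp (Finset.mem_range.mp hi))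

theorem gFun_bound (m : ℤ) {ψ : ℝ} (hψ : ψ < Real.pi) :
    ∃ (C : ℝ) (M : ℕ), 0 ≤ C ∧ ∀ s ∈ sector ψ, ‖gFun m s‖ ≤ C * (1 + ‖s‖) ^ M := by
  obtain ⟨δ, hδ, h⟩ := norm_two_add_ge hψ
  obtain ⟨C, M, hC, hP⟩ := exists_polynomial_bound
    ((Polynomial.Chebyshev.T ℂ m).comp (1 + Polynomial.X))
  refine ⟨C * δ ^ (-(1 / 2) : ℝ), M, by positivity, fun s hs => ?_⟩
  have h1 := hP s
  simp only [Polynomial.eval_comp, Polynomial.eval_add, Polynomial.eval_one,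
    Polynomial.eval_X] at h1
  have h2 : ‖(2 + s) ^ (-(1 / 2) : ℂ)‖ ≤ δ ^ (-(1 / 2) : ℝ) := by
    have e : (-(1 / 2) : ℂ) = ((-(1 / 2) : ℝ) : ℂ) := by push_cast; ring
    rw [e, Complex.norm_cpow_real]
    exact Real.rpow_le_rpow_of_nonpos hδ (h s hs) (by norm_num)
  rw [gFun, norm_mul]
  calc _ ≤ C * (1 + ‖s‖) ^ M * δ ^ (-(1 / 2) : ℝ) := by gcongr
    _ = _ := by ring

theorem differentiableOn_gFun (m : ℤ) : DifferentiableOn ℂ (gFun m) slitDomain := by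
  intro s hs
  refine DifferentiableAt.differentiableWithinAt ?_
  refine DifferentiableAt.mul ?_ ?_
  · exact ((Polynomial.Chebyshev.T ℂ m).differentiable.comp
      (show Differentiable ℂ fun r : ℂ => 1 + r by fun_prop)) s
  · exact DifferentiableAt.cpow (by fun_prop) (by fun_prop) hs

/-! ### The Borel transform of `√x e^x K_m(x)` -/

/-- `(2√π)⁻¹ ∫_{-π}^{π} g_m(s sin² α) dα`. -/
def borelB (m : ℤ) (s : ℂ) : ℂ :=
  1 / (2 * (Real.sqrt Real.pi : ℂ)) *
    ∫ α in (-Real.pi)..Real.pi, gFun m (s * ((Real.sin α ^ 2 : ℝ) : ℂ))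

theorem continuousOn_gFun_sin (m : ℤ) :
    ContinuousOn (fun q : ℂ × ℝ => gFun m (q.1 * ((Real.sin q.2 ^ 2 : ℝ) : ℂ)))
      (slitDomain ×ˢ Set.univ) := by
  refine (differentiableOn_gFun m).continuousOn.comp (Continuous.continuousOn (by fun_prop)) ?_
  rintro ⟨s, α⟩ ⟨hs, -⟩
  exact mul_mem_slitDomain hs (sq_nonneg _) (Real.sin_sq_le_one α)

theorem continuous_gFun_sin (m : ℤ) {s : ℂ} (hs : s ∈ slitDomain) :
    Continuous fun α : ℝ => gFun m (s * ((Real.sin α ^ 2 : ℝ) : ℂ)) := by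
  rw [← continuousOn_univ]
  exact (continuousOn_gFun_sin m).comp (f := fun α : ℝ => (s, α)) (by fun_prop)
    fun α _ => ⟨hs, trivial⟩

open MeasureTheory in
theorem differentiableOn_borelB (m : ℤ) : DifferentiableOn ℂ (borelB m) slitDomain := by
  intro s hs
  refine DifferentiableAt.differentiableWithinAt (DifferentiableAt.const_mul ?_ _)
  obtain ⟨r, hr, hb⟩ := Metric.nhds_basis_closedBall.mem_iff.mp (isOpen_slitDomain.mem_nhds hs)
  have hb' : Metric.ball s r ⊆ slitDomain := Metric.ball_subset_closedBall.trans hb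
  obtain ⟨M, hM⟩ := ((isCompact_closedBall s r).prod
    (isCompact_Icc (a := -Real.pi) (b := Real.pi))).exists_bound_of_continuousOn
    ((continuousOn_gFun_sin m).mono (Set.prod_mono hb (Set.subset_univ _)))
  simp only [intervalIntegral.integral_of_le (neg_le_self Real.pi_pos.le)]
  refine (hasDerivAt_integral_of_norm_le (b := fun _ => M) hr (integrable_const M)
    (fun z hz => (continuous_gFun_sin m (hb' hz)).aestronglyMeasurable)
    (Filter.Eventually.of_forall fun α => ?_) ?_).differentiableAt
  · refine (differentiableOn_gFun m).comp (by fun_prop) fun z hz => ?_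
    exact mul_mem_slitDomain (hb' hz) (sq_nonneg _) (Real.sin_sq_le_one α)
  · refine (ae_restrict_iff' measurableSet_Ioc).mpr (Filter.Eventually.of_forall fun α hα z hz => ?_)
    exact hM (z, α) ⟨Metric.ball_subset_closedBall hz, Set.Ioc_subset_Icc_self hα⟩

theorem borelB_bound (m : ℤ) {ψ : ℝ} (hψ : ψ < Real.pi) :
    ∃ (C : ℝ) (M : ℕ), 0 ≤ C ∧ ∀ s ∈ sector ψ, ‖borelB m s‖ ≤ C * (1 + ‖s‖) ^ M := by
  obtain ⟨C, M, hC, h⟩ := gFun_bound m hψ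
  refine ⟨‖1 / (2 * (Real.sqrt Real.pi : ℂ))‖ * (C * |Real.pi - -Real.pi|), M, by positivity,
    fun s hs => ?_⟩
  rw [borelB, norm_mul, mul_assoc]
  refine mul_le_mul_of_nonneg_left ?_ (norm_nonneg _)
  rw [mul_right_comm]
  refine intervalIntegral.norm_integral_le_of_norm_le_const fun α _ => ?_
  refine (h _ (mul_mem_sector hs (sq_nonneg _))).trans ?_
  have : ‖s * ((Real.sin α ^ 2 : ℝ) : ℂ)‖ ≤ ‖s‖ := by
    rw [norm_mul, Complex.norm_real, Real.norm_of_nonneg (sq_nonneg _)]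
    exact mul_le_of_le_one_right (norm_nonneg _) (Real.sin_sq_le_one α)
  gcongr

/-- Wallis' integrals, by the reduction formula. They supply the factor `Γ(k + 1/2)/k!` separating
the Taylor coefficients of `g_m` from those of its average `borelB`. -/
theorem integral_sin_pow_two_mul (k : ℕ) :
    ((∫ α in (-Real.pi)..Real.pi, (Real.sin α ^ 2) ^ k : ℝ) : ℂ) =
      2 * (Real.sqrt Real.pi : ℂ) * Complex.Gamma (k + 1 / 2) / k.factorial := by
  have hp : (Real.sqrt Real.pi : ℂ) * (Real.sqrt Real.pi : ℂ) = Real.pi := by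
    rw [← Complex.ofReal_mul, Real.mul_self_sqrt Real.pi_pos.le]
  induction k with
  | zero =>
    have h : Complex.Gamma (1 / 2) = (Real.sqrt Real.pi : ℂ) := by
      rw [Complex.Gamma_one_half_eq, Real.sqrt_eq_rpow, Complex.ofReal_cpow Real.pi_pos.le]
      push_cast; rfl
    simp only [pow_zero, Nat.cast_zero, zero_add, Nat.factorial_zero, Nat.cast_one, div_one]
    rw [h]
    simp
    linear_combination -2 * hp
  | succ k ih =>
    have h := integral_sin_pow (a := -Real.pi) (b := Real.pi) (n := 2 * k)
    have e : ∀ α : ℝ, (Real.sin α ^ 2) ^ (k + 1) = Real.sin α ^ (2 * k + 2) := fun α => by ring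
    simp only [e, h]
    simp only [← pow_mul] at ih
    push_cast at ih ⊢
    rw [ih]
    have hG : Complex.Gamma (k + 1 + 1 / 2) = (k + 1 / 2) * Complex.Gamma (k + 1 / 2) := by
      rw [add_right_comm, Complex.Gamma_add_one]
      have h0 : ((k : ℝ) + 1 / 2 : ℝ) ≠ 0 := by positivity
      have h1 : (((k : ℝ) + 1 / 2 : ℝ) : ℂ) ≠ 0 := Complex.ofReal_ne_zero.mpr h0
      push_cast at h1
      exact h1
    rw [hG, Nat.factorial_succ]
    have hk : ((k : ℂ) + 1) ≠ 0 := Nat.cast_add_one_ne_zero k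
    have hk2 : (2 * (k : ℂ) + 2) ≠ 0 := by
      have : 2 * (k : ℂ) + 2 = 2 * (k + 1) := by ring
      rw [this]; exact mul_ne_zero two_ne_zero hk
    have hf : (k.factorial : ℂ) ≠ 0 := by exact_mod_cast k.factorial_ne_zero
    field_simp
    simp
    ring

/-- The Taylor coefficients of `borelB m` at `0`, multiplied by `k!`. -/
def borelCoeff (m : ℤ) (k : ℕ) : ℂ := gCoeff m k * Complex.Gamma (k + 1 / 2)

open MeasureTheory in
theorem hasSum_borelB (m : ℤ) {s : ℂ} (hs : ‖s‖ < 2) :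
    HasSum (fun k => borelCoeff m k / (k.factorial : ℂ) * s ^ k) (borelB m s) := by
  have hsum : Summable fun k => ‖gCoeff m k * s ^ k‖ := (hasSum_gFun m hs).summable.norm
  have hle : ∀ α : ℝ, ‖s * ((Real.sin α ^ 2 : ℝ) : ℂ)‖ ≤ ‖s‖ := fun α => by
    rw [norm_mul, Complex.norm_real, Real.norm_of_nonneg (sq_nonneg _)]
    exact mul_le_of_le_one_right (norm_nonneg _) (Real.sin_sq_le_one α)
  have h := intervalIntegral.hasSum_integral_of_dominated_convergence (μ := volume)
    (a := -Real.pi) (b := Real.pi)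
    (F := fun (k : ℕ) (α : ℝ) => gCoeff m k * (s * ((Real.sin α ^ 2 : ℝ) : ℂ)) ^ k)
    (f := fun α => gFun m (s * ((Real.sin α ^ 2 : ℝ) : ℂ)))
    (fun k _ => ‖gCoeff m k * s ^ k‖)
    (fun k => Continuous.aestronglyMeasurable (by fun_prop))
    (fun k => Filter.Eventually.of_forall fun α _ => by
      rw [norm_mul, norm_mul, norm_pow, norm_pow]
      have := hle α
      gcongr)
    (Filter.Eventually.of_forall fun _ _ => hsum)
    intervalIntegrable_const
    (Filter.Eventually.of_forall fun α _ => hasSum_gFun m ((hle α).trans_lt hs))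
  rw [borelB]
  convert! h.mul_left (1 / (2 * (Real.sqrt Real.pi : ℂ))) using 2 with k
  have e : ∀ α : ℝ, gCoeff m k * (s * ((Real.sin α ^ 2 : ℝ) : ℂ)) ^ k =
      gCoeff m k * s ^ k * (((Real.sin α ^ 2) ^ k : ℝ) : ℂ) := fun α => by push_cast; ring
  simp only [e]
  rw [intervalIntegral.integral_const_mul, intervalIntegral.integral_ofReal,
    integral_sin_pow_two_mul, borelCoeff]
  have hf : (k.factorial : ℂ) ≠ 0 := by exact_mod_cast k.factorial_ne_zero
  have hp : (Real.sqrt Real.pi : ℂ) ≠ 0 := by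
    exact_mod_cast (Real.sqrt_pos.mpr Real.pi_pos).ne'
  field_simp

/-! ### The Laplace integral on the real line -/

/-- The integrand `g_m(2τ²) e^{-2xτ²}`. -/
def gaussG (m : ℤ) (x τ : ℝ) : ℂ :=
  gFun m ((2 * τ ^ 2 : ℝ) : ℂ) * ((Real.exp (-(2 * x) * τ ^ 2) : ℝ) : ℂ)

theorem gFun_two_mul_sinh_sq (m : ℤ) (t : ℝ) :
    gFun m ((2 * Real.sinh (t / 2) ^ 2 : ℝ) : ℂ) * (Real.cosh (t / 2) : ℂ) =
      Complex.cosh (m * t) * ((Real.sqrt 2)⁻¹ : ℝ) := by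
  have h1 : (1 : ℂ) + ((2 * Real.sinh (t / 2) ^ 2 : ℝ) : ℂ) = Complex.cosh t := by
    rw [← Complex.ofReal_cosh, ← Complex.ofReal_one, ← Complex.ofReal_add]
    congr 1
    have := Real.cosh_two_mul (t / 2)
    rw [mul_div_cancel₀ t two_ne_zero] at this
    rw [this, Real.cosh_sq]; ring
  have h2 : (2 : ℂ) + ((2 * Real.sinh (t / 2) ^ 2 : ℝ) : ℂ) =
      ((2 * Real.cosh (t / 2) ^ 2 : ℝ) : ℂ) := by
    rw [Real.cosh_sq]; push_cast; ring
  have hc := Real.cosh_pos (t / 2)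
  have h3 : (2 * Real.cosh (t / 2) ^ 2) ^ (-(1 / 2) : ℝ) * Real.cosh (t / 2) = (Real.sqrt 2)⁻¹ := by
    rw [Real.rpow_neg (by positivity), ← Real.sqrt_eq_rpow, Real.sqrt_mul (by norm_num),
      Real.sqrt_sq hc.le]
    field_simp
  rw [gFun, h1, h2, Polynomial.Chebyshev.T_complex_cosh, mul_assoc]
  congr 1
  have e : (-(1 / 2) : ℂ) = ((-(1 / 2) : ℝ) : ℂ) := by push_cast; ring
  rw [e, ← Complex.ofReal_cpow (by positivity), ← Complex.ofReal_mul, h3]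

/-- The substitution `τ = sinh(t/2)`, for which `2τ² = cosh t - 1`. Symmetrising in `m` produces the
`cosh(mt)` that the Chebyshev polynomial gives. -/
theorem gaussG_sinh (m : ℤ) (x t : ℝ) :
    |Real.cosh (t / 2) / 2| • gaussG m x (Real.sinh (t / 2)) =
      (((Real.sqrt 2)⁻¹ / 4 * Real.exp x : ℝ) : ℂ) *
        (kapIntegrand x m t + kapIntegrand x (-m) t) := by
  have h := gFun_two_mul_sinh_sq m t
  have he : Real.exp (-(2 * x) * Real.sinh (t / 2) ^ 2) = Real.exp x * Real.exp (-(x * Real.cosh t)) := by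
    rw [← Real.exp_add]
    congr 1
    have := Real.cosh_two_mul (t / 2)
    rw [mul_div_cancel₀ t two_ne_zero] at this
    rw [this, Real.cosh_sq]; ring
  have hk : kapIntegrand x m t + kapIntegrand x (-m) t =
      2 * Complex.cosh (m * t) * ((Real.exp (-(x * Real.cosh t)) : ℝ) : ℂ) := by
    have hc : Complex.cosh (m * t) = (Complex.exp (m * t) + Complex.exp (-(m * t))) / 2 := rfl
    rw [kapIntegrand, kapIntegrand, Complex.exp_add, Complex.exp_add, hc, neg_mul]
    push_cast
    ring
  rw [abs_of_pos (div_pos (Real.cosh_pos _) two_pos), Complex.real_smul, gaussG, he, hk]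
  push_cast at h ⊢
  linear_combination (1 / 2 * Complex.exp x * Complex.exp (-(x * Complex.cosh t))) * h

open MeasureTheory in
theorem integrable_gaussG (m : ℤ) {x : ℝ} (hx : 0 < x) :
    Integrable (gaussG m x) ∧ ∫ τ, gaussG m x τ =
      (((Real.sqrt 2)⁻¹ / 4 * Real.exp x : ℝ) : ℂ) *
        ((∫ t, kapIntegrand x m t) + ∫ t, kapIntegrand x (-m) t) := by
  have hx' : 0 < (x : ℂ).re := by simpa using hx
  have hi1 := integrable_kapIntegrand hx' m
  have hi2 := integrable_kapIntegrand hx' (-m)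
  have himg : (fun t : ℝ => Real.sinh (t / 2)) '' Set.univ = Set.univ := by
    rw [Set.image_univ]
    refine Set.range_eq_univ.mpr fun y => ?_
    obtain ⟨t, rfl⟩ := Real.sinh_surjective y
    exact ⟨2 * t, by simp⟩
  have hd : ∀ t ∈ Set.univ, HasDerivWithinAt (fun t : ℝ => Real.sinh (t / 2))
      (Real.cosh (t / 2) / 2) Set.univ t := fun t _ => by
    have := ((hasDerivAt_id t).div_const 2).sinh.hasDerivWithinAt (s := Set.univ)
    convert! this using 1
    simp; ring
  have hinj : Set.InjOn (fun t : ℝ => Real.sinh (t / 2)) Set.univ := fun a _ b _ hab => by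
    have := Real.sinh_injective hab
    linarith
  have h1 := integrableOn_image_iff_integrableOn_abs_deriv_smul MeasurableSet.univ hd hinj
    (gaussG m x)
  have h2 := integral_image_eq_integral_abs_deriv_smul MeasurableSet.univ hd hinj (gaussG m x)
  simp only [himg, gaussG_sinh, integrableOn_univ, Measure.restrict_univ] at h1 h2
  refine ⟨h1.mpr ((hi1.add hi2).const_mul _), ?_⟩
  rw [h2, integral_const_mul, integral_add hi1 hi2]

open MeasureTheory in
theorem integral_gaussG (m : ℤ) (l : ℝ) :
    ∫ τ, gaussG m (Real.exp l) τ =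
      (((Real.sqrt 2)⁻¹ * Real.exp (Real.exp l) : ℝ) : ℂ) * kap m l := by
  rw [(integrable_gaussG m (Real.exp_pos l)).2]
  have h1 : ∫ t, kapIntegrand (Real.exp l : ℝ) m t = 2 * kap m l := by
    rw [kap]; push_cast; ring
  have h2 : ∫ t, kapIntegrand (Real.exp l : ℝ) (-m) t = 2 * kap m l := by
    rw [← kap_neg, kap]; push_cast; ring
  rw [h1, h2]
  push_cast
  ring

open MeasureTheory in
-- The product of the two Gaussian integrals is an integral over the plane. In polar coordinates the
-- exponential depends on the radius only, and the angular integral of `g_m(2ρ² sin² α)` is `borelB`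
-- at `2ρ²`.
theorem integral_polar_gaussG (m : ℤ) {x : ℝ} (hx : 0 < x) :
    (∫ σ : ℝ, ((Real.exp (-(2 * x) * σ ^ 2) : ℝ) : ℂ)) * ∫ τ, gaussG m x τ =
      ∫ ρ in Set.Ioi (0 : ℝ), (ρ * Real.exp (-(2 * x) * ρ ^ 2) : ℝ) *
        (2 * (Real.sqrt Real.pi : ℂ) * borelB m ((2 * ρ ^ 2 : ℝ) : ℂ)) := by
  have hE : Integrable fun σ : ℝ => ((Real.exp (-(2 * x) * σ ^ 2) : ℝ) : ℂ) :=
    (integrable_exp_neg_mul_sq (by positivity)).ofReal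
  have hint : Integrable (fun p : ℝ × ℝ =>
      ((Real.exp (-(2 * x) * p.1 ^ 2) : ℝ) : ℂ) * gaussG m x p.2) (volume.prod volume) :=
    hE.mul_prod (integrable_gaussG m hx).1
  -- Integrability in polar coordinates is transported from the plane and justifies Fubini.
  have hpol : IntegrableOn (fun p : ℝ × ℝ => p.1 • (((Real.exp (-(2 * x) *
      (polarCoord.symm p).1 ^ 2) : ℝ) : ℂ) * gaussG m x (polarCoord.symm p).2))
      (Set.Ioi 0 ×ˢ Set.Ioo (-Real.pi) Real.pi) (volume.prod volume) := by
    have h := integrableOn_image_iff_integrableOn_abs_det_fderiv_smul (volume : Measure (ℝ × ℝ))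
      polarCoord.open_target.measurableSet
      (fun p _ => (hasFDerivAt_polarCoord_symm p).hasFDerivWithinAt) polarCoord.symm.injOn
      (fun p : ℝ × ℝ => ((Real.exp (-(2 * x) * p.1 ^ 2) : ℝ) : ℂ) * gaussG m x p.2)
    have h2 := h.mp (Integrable.integrableOn hint)
    simp only [det_fderivPolarCoordSymm] at h2
    refine IntegrableOn.congr_fun h2 (fun p hp => ?_) polarCoord.open_target.measurableSet
    simp only [abs_of_pos (show (0 : ℝ) < p.1 from hp.1)]
  rw [← integral_prod_mul]
  have h := integral_comp_polarCoord_symm (fun p : ℝ × ℝ =>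
      ((Real.exp (-(2 * x) * p.1 ^ 2) : ℝ) : ℂ) * gaussG m x p.2)
  rw [← Measure.volume_eq_prod, ← h, polarCoord_target, Measure.volume_eq_prod,
    setIntegral_prod _ hpol]
  refine setIntegral_congr_fun measurableSet_Ioi fun ρ _ => ?_
  have hs : (Real.sqrt Real.pi : ℂ) ≠ 0 := by
    exact_mod_cast (Real.sqrt_pos.mpr Real.pi_pos).ne'
  have hB : 2 * (Real.sqrt Real.pi : ℂ) * borelB m ((2 * ρ ^ 2 : ℝ) : ℂ) =
      ∫ α in Set.Ioo (-Real.pi) Real.pi, gFun m (((2 * ρ ^ 2 : ℝ) : ℂ) *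
        ((Real.sin α ^ 2 : ℝ) : ℂ)) := by
    rw [borelB, intervalIntegral.integral_of_le (neg_le_self Real.pi_pos.le),
      integral_Ioc_eq_integral_Ioo]
    field_simp
  simp only
  rw [hB, ← integral_const_mul]
  refine integral_congr_ae (Filter.Eventually.of_forall fun α => ?_)
  have hee : Real.exp (-(2 * x) * (ρ * Real.cos α) ^ 2) * Real.exp (-(2 * x) * (ρ * Real.sin α) ^ 2)
      = Real.exp (-(2 * x) * ρ ^ 2) := by
    rw [← Real.exp_add]
    congr 1
    linear_combination (-(2 * x) * ρ ^ 2) * Real.sin_sq_add_cos_sq α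
  simp only [polarCoord_symm_apply, gaussG, Complex.real_smul]
  rw [← hee, show (2 * ρ ^ 2 : ℝ) * ((Real.sin α ^ 2 : ℝ) : ℂ) =
    ((2 * (ρ * Real.sin α) ^ 2 : ℝ) : ℂ) by push_cast; ring]
  push_cast
  ring

open MeasureTheory in
theorem integral_radial_borelB (m : ℤ) (x : ℝ) :
    ∫ ρ in Set.Ioi (0 : ℝ), (ρ * Real.exp (-(2 * x) * ρ ^ 2) : ℝ) *
        (2 * (Real.sqrt Real.pi : ℂ) * borelB m ((2 * ρ ^ 2 : ℝ) : ℂ)) =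
      (Real.sqrt Real.pi : ℂ) / 2 *
        ∫ s in Set.Ioi (0 : ℝ), borelB m s * Complex.exp (-(x * s)) := by
  have h1 := integral_comp_rpow_Ioi_of_pos (E := ℂ) (p := 2) two_pos
    (g := fun y : ℝ => borelB m ((2 * y : ℝ) : ℂ) * Complex.exp (-(x * ((2 * y : ℝ) : ℂ))))
  have h2 := integral_comp_mul_left_Ioi
    (fun s : ℝ => borelB m s * Complex.exp (-(x * s))) 0 two_pos
  rw [mul_zero] at h2
  rw [h2] at h1
  have h3 : ∫ s in Set.Ioi (0 : ℝ), borelB m s * Complex.exp (-(x * s)) =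
      2 * ∫ ρ in Set.Ioi (0 : ℝ), ((2 : ℝ) * ρ ^ ((2 : ℝ) - 1)) •
        (borelB m ((2 * ρ ^ (2 : ℝ) : ℝ) : ℂ) *
          Complex.exp (-(x * ((2 * ρ ^ (2 : ℝ) : ℝ) : ℂ)))) := by
    rw [h1, Complex.real_smul, ← mul_assoc]
    norm_num
  rw [h3, ← integral_const_mul, ← integral_const_mul]
  refine setIntegral_congr_fun measurableSet_Ioi fun ρ _ => ?_
  have e1 : ρ ^ ((2 : ℝ) - 1) = ρ := by norm_num
  have e2 : ρ ^ (2 : ℝ) = ρ ^ 2 := Real.rpow_two ρ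
  simp only [e1, e2, Complex.real_smul]
  push_cast
  rw [show (-((x : ℂ) * (2 * ρ ^ 2))) = -(2 * x) * ρ ^ 2 by ring]
  ring

open MeasureTheory in
-- After `s = 2ρ²`, dividing by the Gaussian integral `√(π/(2x))` produces the factor `√x`.
theorem laplace_borelB_real (m : ℤ) (l : ℝ) :
    Complex.exp (Complex.exp l) * kap m l =
      Complex.exp (l / 2) * ∫ s in Set.Ioi (0 : ℝ), borelB m s * Complex.exp (-(Complex.exp l * s)) := by
  have h := integral_polar_gaussG m (Real.exp_pos l)
  rw [integral_gaussG, integral_radial_borelB, integral_complex_ofReal, integral_gaussian] at h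
  have hx : Real.sqrt (Real.exp l) = Real.exp (l / 2) := by
    rw [Real.sqrt_eq_iff_mul_self_eq_of_pos (Real.exp_pos _), ← Real.exp_add]
    ring_nf
  have h2 : Real.sqrt (Real.pi / (2 * Real.exp l)) * (Real.sqrt 2)⁻¹ * Real.exp (l / 2) =
      Real.sqrt Real.pi / 2 := by
    rw [Real.sqrt_div Real.pi_pos.le, Real.sqrt_mul (by norm_num), hx]
    have h3 : Real.sqrt 2 ^ 2 = 2 := Real.sq_sqrt (by norm_num)
    have h4 := (Real.exp_pos (l / 2)).ne'
    have h5 : Real.sqrt 2 ≠ 0 := by positivity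
    field_simp
    linarith
  have h2' := congrArg (fun r : ℝ => (r : ℂ)) h2
  have hs : (Real.sqrt Real.pi : ℂ) / 2 ≠ 0 := by
    refine div_ne_zero ?_ two_ne_zero
    exact_mod_cast (Real.sqrt_pos.mpr Real.pi_pos).ne'
  push_cast at h h2'
  refine mul_left_cancel₀ hs ?_
  linear_combination Complex.exp (l / 2) * h -
    Complex.exp (Complex.exp l) * kap m l * h2'

/-! ### Laplace integrals along rays -/

/-- The integrand of the Laplace integral of `borelB m` along the ray `e^w ℝ₊`. -/
def rayIntegrand (m : ℤ) (l w : ℂ) (r : ℝ) : ℂ :=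
  borelB m (r * Complex.exp w) * Complex.exp (-(Complex.exp l * (r * Complex.exp w))) *
    Complex.exp w

/-- The Laplace integral of `borelB m` along the ray `e^w ℝ₊`. -/
def laplaceRay (m : ℤ) (l w : ℂ) : ℂ := ∫ r in Set.Ioi (0 : ℝ), rayIntegrand m l w r

theorem pow_mul_exp_neg_le (M : ℕ) {ε : ℝ} (hε : 0 < ε) {R : ℝ} (hR : 0 < R) :
    ∃ K : ℝ, 0 ≤ K ∧ ∀ r : ℝ, 0 ≤ r →
      (1 + r * R) ^ M * Real.exp (-(ε * r)) ≤ K * Real.exp (-(ε / 2 * r)) := by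
  -- With this `δ` the exponential `e^{δ(1 + rR)}` dominating the polynomial grows like `e^{εr/2}`,
  -- half of the available decay.
  set δ := ε / (2 * R) with hδ
  have hδ0 : 0 < δ := by positivity
  refine ⟨M.factorial / δ ^ M * Real.exp δ, by positivity, fun r hr => ?_⟩
  have h1 := Real.pow_div_factorial_le_exp (δ * (1 + r * R)) (by positivity) M
  rw [div_le_iff₀ (by positivity), mul_pow] at h1
  have h2 : (1 + r * R) ^ M ≤ Real.exp (δ * (1 + r * R)) * M.factorial / δ ^ M := by
    rw [le_div_iff₀ (by positivity)]; linarith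
  have h3 : Real.exp (δ * (1 + r * R)) = Real.exp δ * Real.exp (ε / 2 * r) := by
    rw [← Real.exp_add]; congr 1; rw [hδ]; field_simp
  have h4 : Real.exp (ε / 2 * r) * Real.exp (-(ε * r)) = Real.exp (-(ε / 2 * r)) := by
    rw [← Real.exp_add]; congr 1; ring
  calc (1 + r * R) ^ M * Real.exp (-(ε * r)) ≤
      Real.exp (δ * (1 + r * R)) * M.factorial / δ ^ M * Real.exp (-(ε * r)) := by gcongr
    _ = M.factorial / δ ^ M * Real.exp δ * (Real.exp (ε / 2 * r) * Real.exp (-(ε * r))) := by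
      rw [h3]; ring
    _ = _ := by rw [h4]

theorem norm_exp_neg_mul_ray (l w : ℂ) (r : ℝ) :
    ‖Complex.exp (-(Complex.exp l * (r * Complex.exp w)))‖ =
      Real.exp (-((Complex.exp (l + w)).re * r)) := by
  have e : -(Complex.exp l * (r * Complex.exp w)) = -(Complex.exp (l + w) * (r : ℂ)) := by
    rw [Complex.exp_add]; ring
  rw [Complex.norm_exp, e, Complex.neg_re, Complex.re_mul_ofReal]

theorem rayIntegrand_bound (m : ℤ) {ψ : ℝ} (hψ : ψ < Real.pi) {ε R : ℝ} (hε : 0 < ε)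
    (hR : 0 < R) :
    ∃ K : ℝ, ∀ l w : ℂ, |w.im| ≤ ψ → ε ≤ (Complex.exp (l + w)).re → ‖Complex.exp w‖ ≤ R →
      ∀ r : ℝ, 0 ≤ r → ‖rayIntegrand m l w r‖ ≤ K * Real.exp (-(ε / 2) * r) := by
  obtain ⟨C, M, hC, hB⟩ := borelB_bound m hψ
  obtain ⟨K, hK, hp⟩ := pow_mul_exp_neg_le M hε hR
  refine ⟨C * K * R, fun l w hw hlw hwR r hr => ?_⟩
  rw [rayIntegrand, norm_mul, norm_mul, norm_exp_neg_mul_ray]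
  have h1 := hB _ (mul_exp_mem_sector hr hw)
  rw [norm_mul, Complex.norm_real, Real.norm_of_nonneg hr] at h1
  calc _ ≤ C * (1 + r * ‖Complex.exp w‖) ^ M * Real.exp (-((Complex.exp (l + w)).re * r)) * R := by
        gcongr
    _ ≤ C * (1 + r * R) ^ M * Real.exp (-(ε * r)) * R := by gcongr
    _ = C * ((1 + r * R) ^ M * Real.exp (-(ε * r))) * R := by ring
    _ ≤ C * (K * Real.exp (-(ε / 2 * r))) * R :=
      mul_le_mul_of_nonneg_right (mul_le_mul_of_nonneg_left (hp r hr) hC) hR.le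
    _ = _ := by rw [neg_mul]; ring

theorem ray_mem_slitDomain {w : ℂ} (hw : |w.im| < Real.pi) {r : ℝ} (hr : 0 ≤ r) :
    r * Complex.exp w ∈ slitDomain :=
  sector_subset_slitDomain hw (mul_exp_mem_sector hr le_rfl)

open MeasureTheory in
theorem aestronglyMeasurable_rayIntegrand (m : ℤ) (l : ℂ) {w : ℂ} (hw : |w.im| < Real.pi) :
    AEStronglyMeasurable (rayIntegrand m l w) (volume.restrict (Set.Ioi 0)) := by
  refine ContinuousOn.aestronglyMeasurable ?_ measurableSet_Ioi
  refine ContinuousOn.mul (ContinuousOn.mul ?_ (Continuous.continuousOn (by fun_prop)))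
    continuousOn_const
  exact (differentiableOn_borelB m).continuousOn.comp (Continuous.continuousOn (by fun_prop))
    fun r hr => ray_mem_slitDomain hw (le_of_lt hr)

open MeasureTheory in
theorem integrableOn_exp_neg_half {ε : ℝ} (hε : 0 < ε) (K : ℝ) :
    IntegrableOn (fun r : ℝ => K * Real.exp (-(ε / 2) * r)) (Set.Ioi 0) :=
  (exp_neg_integrableOn_Ioi 0 (half_pos hε)).const_mul K

open MeasureTheory in
theorem integrableOn_rayIntegrand (m : ℤ) {l w : ℂ} (hw : |w.im| < Real.pi)
    (hlw : |(l + w).im| < Real.pi / 2) : IntegrableOn (rayIntegrand m l w) (Set.Ioi 0) := by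
  have hε := exp_re_pos hlw
  obtain ⟨K, hK⟩ := rayIntegrand_bound m hw hε (norm_pos_iff.mpr (Complex.exp_ne_zero w))
  refine Integrable.mono' (integrableOn_exp_neg_half hε K)
    (aestronglyMeasurable_rayIntegrand m l hw) ?_
  exact (ae_restrict_iff' measurableSet_Ioi).mpr (Filter.Eventually.of_forall fun r hr =>
    hK l w le_rfl le_rfl le_rfl r (le_of_lt hr))

open MeasureTheory in
-- Both `log x` and the direction may vary holomorphically: rotation of the ray fixes the former,
-- continuation in `x` moves both.
theorem differentiableAt_laplaceRay (m : ℤ) {lf wf : ℂ → ℂ} (hl : Differentiable ℂ lf)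
    (hw : Differentiable ℂ wf) {τ : ℂ} (h1 : |(wf τ).im| < Real.pi)
    (h2 : |(lf τ + wf τ).im| < Real.pi / 2) :
    DifferentiableAt ℂ (fun τ => laplaceRay m (lf τ) (wf τ)) τ := by
  obtain ⟨ψ, hψ1, hψ2⟩ := exists_between h1
  have hε := exp_re_pos h2
  set ε := (Complex.exp (lf τ + wf τ)).re
  set R := ‖Complex.exp (wf τ)‖ + 1
  have hR : 0 < R := by positivity
  have hcl := hl.continuous
  have hcw := hw.continuous
  have e1 : ∀ᶠ z in nhds τ, |(wf z).im| < ψ :=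
    (show Continuous fun z => |(wf z).im| by fun_prop).continuousAt.eventually (gt_mem_nhds hψ1)
  have e2 : ∀ᶠ z in nhds τ, ε / 2 < (Complex.exp (lf z + wf z)).re :=
    (show Continuous fun z => (Complex.exp (lf z + wf z)).re by fun_prop).continuousAt.eventually
      (lt_mem_nhds (half_lt_self hε))
  have e3 : ∀ᶠ z in nhds τ, ‖Complex.exp (wf z)‖ < R :=
    (show Continuous fun z => ‖Complex.exp (wf z)‖ by fun_prop).continuousAt.eventually
      (gt_mem_nhds (lt_add_one _))
  obtain ⟨δ, hδ, hb⟩ := Metric.eventually_nhds_iff_ball.mp (e1.and (e2.and e3))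
  obtain ⟨K, hK⟩ := rayIntegrand_bound m hψ2 (half_pos hε) hR
  refine (hasDerivAt_integral_of_norm_le (F := fun z r => rayIntegrand m (lf z) (wf z) r) hδ
    (integrableOn_exp_neg_half (half_pos hε) K)
    (fun z hz => aestronglyMeasurable_rayIntegrand m _ ((hb z hz).1.trans hψ2)) ?_
    ?_).differentiableAt
  · refine (ae_restrict_iff' measurableSet_Ioi).mpr (Filter.Eventually.of_forall fun r hr => ?_)
    unfold rayIntegrand
    refine DifferentiableOn.mul (DifferentiableOn.mul ?_
      (Differentiable.differentiableOn (by fun_prop))) (Differentiable.differentiableOn (by fun_prop))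
    exact (differentiableOn_borelB m).comp (Differentiable.differentiableOn (by fun_prop))
      fun z hz => ray_mem_slitDomain ((hb z hz).1.trans hψ2) (le_of_lt hr)
  · refine (ae_restrict_iff' measurableSet_Ioi).mpr (Filter.Eventually.of_forall fun r hr z hz => ?_)
    exact hK _ _ (hb z hz).1.le (hb z hz).2.1.le (hb z hz).2.2.le r (le_of_lt hr)

theorem laplaceRay_add_real (m : ℤ) (l w : ℂ) (h : ℝ) :
    laplaceRay m l (w + h) = laplaceRay m l w := by
  have hi := MeasureTheory.integral_comp_mul_right_Ioi' (fun r : ℝ => rayIntegrand m l w r) 0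
    (Real.exp_pos h)
  rw [zero_mul] at hi
  rw [laplaceRay, laplaceRay, ← hi, ← MeasureTheory.integral_smul]
  congr 1
  funext r
  rw [rayIntegrand, rayIntegrand, Complex.exp_add, Complex.real_smul]
  push_cast
  rw [show (r : ℂ) * (Complex.exp w * Complex.exp h) = r * Complex.exp h * Complex.exp w by ring]
  ring

/-- Rotation of the contour without estimates on arcs: the integral is holomorphic in the complex
`w`, and constant along real translations because these only rescale the ray. By the identity
theorem it is constant on the convex set of admissible directions. -/
theorem laplaceRay_eq (m : ℤ) {l w w' : ℂ} (hw : |w.im| < Real.pi)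
    (hlw : |(l + w).im| < Real.pi / 2) (hw' : |w'.im| < Real.pi)
    (hlw' : |(l + w').im| < Real.pi / 2) : laplaceRay m l w' = laplaceRay m l w := by
  have h := eqOn_of_eq_ofReal (f := fun z => laplaceRay m l (w + z))
    (g := fun _ => laplaceRay m l w)
    (U := {z : ℂ | |z.im + w.im| < Real.pi} ∩ {z : ℂ | |z.im + (l + w).im| < Real.pi / 2})
    ((isOpen_strip _ _).inter (isOpen_strip _ _))
    ((convex_strip _ _).inter (convex_strip _ _)).isPreconnected
    ⟨by simpa using hw, by simpa using hlw⟩ (fun z hz => ?_) (differentiableOn_const _)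
    (fun x => laplaceRay_add_real m l w x)
  · have := h (x := w' - w) ⟨by simpa using hw', by
      simp only [Set.mem_ofPred_eq, Complex.sub_im, Complex.add_im] at hlw' ⊢
      convert! hlw' using 2; ring⟩
    simpa using this
  · refine (differentiableAt_laplaceRay m (lf := fun _ => l) (wf := fun z => w + z)
      (by fun_prop) (by fun_prop) ?_ ?_).differentiableWithinAt
    · simpa [add_comm] using hz.1
    · have := hz.2
      simp only [Set.mem_ofPred_eq, Complex.add_im] at this ⊢
      convert! this using 2; ring

/-- With `w = -(2/3) l`, the conditions `|Im w| < π` and `|Im(l + w)| < π/2` both become `|Im l| <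
3π/2`. The two sides are then holomorphic on this whole strip and agree on the real line. -/
theorem laplace_borelB_diagonal (m : ℤ) {l : ℂ} (hl : |l.im| < 3 * Real.pi / 2) :
    Complex.exp (Complex.exp l) * besselK m l =
      Complex.exp (l / 2) * laplaceRay m l (-(2 / 3) * l) := by
  have him : ∀ z : ℂ, (-(2 / 3) * z).im = -(2 / 3) * z.im := fun z => by
    have : (-(2 / 3) : ℂ) = ((-(2 / 3) : ℝ) : ℂ) := by push_cast; ring
    rw [this, Complex.im_ofReal_mul]
  refine eqOn_of_eq_ofReal (f := fun l => Complex.exp (Complex.exp l) * besselK m l)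
    (g := fun l => Complex.exp (l / 2) * laplaceRay m l (-(2 / 3) * l))
    (U := {l : ℂ | |l.im + 0| < 3 * Real.pi / 2}) (isOpen_strip _ _)
    (convex_strip _ _).isPreconnected ?_ ?_ ?_ ?_ (by simpa using hl)
  · simpa using Real.pi_pos
  · exact (Differentiable.mul (by fun_prop) (differentiable_besselK m)).differentiableOn
  · intro z hz
    simp only [Set.mem_ofPred_eq, add_zero] at hz
    refine (DifferentiableAt.mul (by fun_prop) (differentiableAt_laplaceRay m (lf := fun l => l)
      (wf := fun l => -(2 / 3) * l) (by fun_prop) (by fun_prop) ?_ ?_)).differentiableWithinAt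
    · rw [him, abs_mul, show |(-(2 / 3) : ℝ)| = 2 / 3 by norm_num]
      linarith
    · rw [Complex.add_im, him, show z.im + -(2 / 3) * z.im = 1 / 3 * z.im by ring, abs_mul,
        show |(1 / 3 : ℝ)| = 1 / 3 by norm_num]
      linarith
  · intro x
    have e : (-(2 / 3) * (x : ℂ)) = 0 + ((-(2 / 3) * x : ℝ) : ℂ) := by push_cast; ring
    rw [e, laplaceRay_add_real, besselK_eq_kap m (abs_im_ofReal_lt x), laplace_borelB_real]
    simp [laplaceRay, rayIntegrand]

/-- `√x e^x K_m(x) = x ∫_{e^w ℝ₊} B_m(s) e^{-xs} ds`, `x = e^l`. -/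
theorem laplace_borelB (m : ℤ) {l w : ℂ} (hw : |w.im| < Real.pi)
    (hlw : |(l + w).im| < Real.pi / 2) :
    Complex.exp (Complex.exp l) * besselK m l = Complex.exp (l / 2) * laplaceRay m l w := by
  have hl : |l.im| < 3 * Real.pi / 2 := by
    rw [Complex.add_im] at hlw
    rw [abs_lt] at *
    constructor <;> linarith [hw.1, hw.2, hlw.1, hlw.2]
  have him : (-(2 / 3) * l).im = -(2 / 3) * l.im := by
    have : (-(2 / 3) : ℂ) = ((-(2 / 3) : ℝ) : ℂ) := by push_cast; ring
    rw [this, Complex.im_ofReal_mul]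
  rw [laplace_borelB_diagonal m hl]
  congr 1
  refine laplaceRay_eq m hw hlw ?_ ?_
  · rw [him, abs_mul, show |(-(2 / 3) : ℝ)| = 2 / 3 by norm_num]
    linarith
  · rw [Complex.add_im, him, show l.im + -(2 / 3) * l.im = 1 / 3 * l.im by ring, abs_mul,
      show |(1 / 3 : ℝ)| = 1 / 3 by norm_num]
    linarith

/-! ### Watson's lemma -/

open MeasureTheory in
theorem integrableOn_pow_mul_exp_neg (k : ℕ) {c : ℂ} (hc : 0 < c.re) :
    IntegrableOn (fun r : ℝ => (r : ℂ) ^ k * Complex.exp (-(c * r))) (Set.Ioi 0) := by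
  obtain ⟨K, -, hK⟩ := pow_mul_exp_neg_le k hc one_pos
  refine Integrable.mono' (integrableOn_exp_neg_half hc K)
    (Continuous.aestronglyMeasurable (by fun_prop)) ?_
  refine (ae_restrict_iff' measurableSet_Ioi).mpr (Filter.Eventually.of_forall fun r hr => ?_)
  have hr' : 0 ≤ r := le_of_lt hr
  rw [norm_mul, norm_pow, Complex.norm_real, Real.norm_of_nonneg hr', Complex.norm_exp,
    Complex.neg_re, Complex.re_mul_ofReal, neg_mul]
  refine le_trans ?_ (hK r hr')
  gcongr
  linarith

open MeasureTheory in
theorem integral_pow_mul_exp_neg (k : ℕ) {c : ℂ} (hc : 0 < c.re) :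
    ∫ r in Set.Ioi (0 : ℝ), (r : ℂ) ^ k * Complex.exp (-(c * r)) = k.factorial / c ^ (k + 1) := by
  have hc0 : c ≠ 0 := fun h => by simp [h] at hc
  induction k with
  | zero =>
    have h := integral_exp_mul_complex_Ioi (a := -c) (by simpa using hc) 0
    simp only [pow_zero, one_mul, Nat.factorial_zero, Nat.cast_one, zero_add, pow_one]
    simp only [neg_mul] at h
    rw [h]
    simp
  | succ k ih =>
    have hd : ∀ r : ℝ, HasDerivAt (fun r : ℝ => (r : ℂ) ^ (k + 1) * Complex.exp (-(c * r)))
        (((k : ℂ) + 1) * ((r : ℂ) ^ k * Complex.exp (-(c * r))) -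
          c * ((r : ℂ) ^ (k + 1) * Complex.exp (-(c * r)))) r := fun r => by
      have h1 : HasDerivAt (fun z : ℂ => z ^ (k + 1) * Complex.exp (-(c * z)))
          (((k + 1 : ℕ) : ℂ) * (r : ℂ) ^ k * Complex.exp (-(c * r)) +
            (r : ℂ) ^ (k + 1) * (Complex.exp (-(c * r)) * -(c * 1))) (r : ℂ) :=
        (hasDerivAt_pow (k + 1) (r : ℂ)).mul (((hasDerivAt_id _).const_mul c).neg.cexp)
      convert! h1.comp_ofReal using 1
      push_cast; ring
    have i1 := (integrableOn_pow_mul_exp_neg k hc).const_mul ((k : ℂ) + 1)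
    have i2 := (integrableOn_pow_mul_exp_neg (k + 1) hc).const_mul c
    have ht : Filter.Tendsto (fun r : ℝ => (r : ℂ) ^ (k + 1) * Complex.exp (-(c * r))) Filter.atTop
        (nhds 0) :=
      tendsto_zero_of_hasDerivAt_of_integrableOn_Ioi (a := 0) (fun r _ => hd r) (i1.sub i2)
        (integrableOn_pow_mul_exp_neg (k + 1) hc)
    have h := integral_Ioi_of_hasDerivAt_of_tendsto' (fun r _ => hd r) (i1.sub i2) ht
    rw [integral_sub i1 i2, integral_const_mul, integral_const_mul, ih] at h
    rw [Nat.factorial_succ]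
    push_cast
    simp only [Complex.ofReal_zero, zero_pow (Nat.succ_ne_zero k), zero_mul, sub_zero] at h
    rw [eq_div_iff (pow_ne_zero _ hc0)]
    have h2 : c * ∫ r in Set.Ioi (0 : ℝ), (r : ℂ) ^ (k + 1) * Complex.exp (-(c * r)) =
        ((k : ℂ) + 1) * (k.factorial / c ^ (k + 1)) := by linear_combination -h
    rw [pow_succ, mul_comm (c ^ (k + 1)), ← mul_assoc, mul_comm _ c, h2]
    field_simp

/-- For `|s| ≤ 1` the tail of the Taylor series has order `|s|^N`, since the series converges
absolutely at `s = 1`. For `|s| ≥ 1` the function and the Taylor polynomial are bounded separately.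
-/
theorem borelB_remainder (m : ℤ) (N : ℕ) {ψ : ℝ} (hψ : ψ < Real.pi) :
    ∃ (C : ℝ) (M : ℕ), 0 ≤ C ∧ ∀ s ∈ sector ψ,
      ‖borelB m s - ∑ k ∈ Finset.range N, borelCoeff m k / (k.factorial : ℂ) * s ^ k‖ ≤
        C * ‖s‖ ^ N * (1 + ‖s‖) ^ M := by
  obtain ⟨C, M, hC, hB⟩ := borelB_bound m hψ
  set b : ℕ → ℂ := fun k => borelCoeff m k / (k.factorial : ℂ) with hb
  have hsum : Summable fun k => ‖b k‖ := by
    have h := (hasSum_borelB m (s := 1) (by norm_num)).summable.norm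
    simp only [one_pow, mul_one] at h
    exact h
  set A := ∑' k, ‖b k‖
  have hA : 0 ≤ A := tsum_nonneg fun _ => norm_nonneg _
  have hf : ∀ F : Finset ℕ, ∑ k ∈ F, ‖b k‖ ≤ A := fun F =>
    hsum.sum_le_tsum _ fun _ _ => norm_nonneg _
  refine ⟨A + C, M, by positivity, fun s hs => ?_⟩
  have h1 : (1 : ℝ) ≤ (1 + ‖s‖) ^ M := one_le_pow₀ (by linarith [norm_nonneg s])
  rcases le_total ‖s‖ 1 with hs1 | hs1
  · have h := (hasSum_nat_add_iff' N).mpr (hasSum_borelB m (s := s) (by linarith))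
    have hle : ∀ k, ‖b (k + N) * s ^ (k + N)‖ ≤ ‖b (k + N)‖ * ‖s‖ ^ N := fun k => by
      rw [norm_mul, norm_pow]
      exact mul_le_mul_of_nonneg_left
        (pow_le_pow_of_le_one (norm_nonneg s) hs1 (Nat.le_add_left N k)) (norm_nonneg _)
    have hs2 : Summable fun k => ‖b (k + N)‖ := (summable_nat_add_iff N).mpr hsum
    have h2 := h.norm_le_of_bounded ((hs2.mul_right (‖s‖ ^ N)).hasSum) hle
    rw [tsum_mul_right] at h2
    have h3 : ∑' k, ‖b (k + N)‖ ≤ A := by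
      have := hsum.sum_add_tsum_nat_add N
      have h4 : 0 ≤ ∑ k ∈ Finset.range N, ‖b k‖ := Finset.sum_nonneg fun _ _ => norm_nonneg _
      linarith
    calc _ ≤ (∑' k, ‖b (k + N)‖) * ‖s‖ ^ N := h2
      _ ≤ (A + C) * ‖s‖ ^ N := by gcongr; linarith
      _ ≤ (A + C) * ‖s‖ ^ N * (1 + ‖s‖) ^ M := le_mul_of_one_le_right (by positivity) h1
  · have hN : 1 ≤ ‖s‖ ^ N := one_le_pow₀ hs1
    have h2 : ‖∑ k ∈ Finset.range N, b k * s ^ k‖ ≤ A * ‖s‖ ^ N := by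
      refine (norm_sum_le _ _).trans ?_
      refine le_trans ?_ (mul_le_mul_of_nonneg_right (hf (Finset.range N)) (by positivity))
      rw [Finset.sum_mul]
      refine Finset.sum_le_sum fun k hk => ?_
      rw [norm_mul, norm_pow]
      exact mul_le_mul_of_nonneg_left (pow_le_pow_right₀ hs1 (Finset.mem_range.mp hk).le)
        (norm_nonneg _)
    calc _ ≤ ‖borelB m s‖ + ‖∑ k ∈ Finset.range N, b k * s ^ k‖ := norm_sub_le _ _
      _ ≤ C * (1 + ‖s‖) ^ M + A * ‖s‖ ^ N := add_le_add (hB s hs) h2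
      _ ≤ C * ‖s‖ ^ N * (1 + ‖s‖) ^ M + A * ‖s‖ ^ N * (1 + ‖s‖) ^ M := by
        refine add_le_add ?_ (le_mul_of_one_le_right (by positivity) h1)
        rw [mul_right_comm]
        exact le_mul_of_one_le_right (by positivity) hN
      _ = _ := by ring

open MeasureTheory in
theorem exp_mul_integral_ray_pow (k : ℕ) {l w : ℂ} (hlw : |(l + w).im| < Real.pi / 2) :
    IntegrableOn (fun r : ℝ => (r * Complex.exp w) ^ k *
        Complex.exp (-(Complex.exp l * (r * Complex.exp w))) * Complex.exp w) (Set.Ioi 0) ∧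
    Complex.exp l * ∫ r in Set.Ioi (0 : ℝ), (r * Complex.exp w) ^ k *
        Complex.exp (-(Complex.exp l * (r * Complex.exp w))) * Complex.exp w =
      k.factorial * ((Complex.exp l)⁻¹) ^ k := by
  have hc := exp_re_pos hlw
  have e : ∀ r : ℝ, (r * Complex.exp w) ^ k *
        Complex.exp (-(Complex.exp l * (r * Complex.exp w))) * Complex.exp w =
      Complex.exp w ^ (k + 1) * ((r : ℂ) ^ k * Complex.exp (-(Complex.exp (l + w) * r))) := by
    intro r
    rw [Complex.exp_add, show Complex.exp l * Complex.exp w * (r : ℂ) =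
      Complex.exp l * (r * Complex.exp w) by ring]
    ring
  simp only [e]
  refine ⟨(integrableOn_pow_mul_exp_neg k hc).const_mul _, ?_⟩
  rw [integral_const_mul, integral_pow_mul_exp_neg k hc, Complex.exp_add]
  have h1 := Complex.exp_ne_zero l
  have h2 := Complex.exp_ne_zero w
  rw [mul_pow, inv_pow, pow_succ (Complex.exp l)]
  field_simp

open MeasureTheory in
-- Watson's lemma: Taylor monomials integrate to the terms of the expansion, and the remainder to
-- `O(|x|^{-N-1})` before the factor `x`. The constant does not depend on the direction, which gives
-- uniformity in closed subsectors.
theorem laplaceRay_expansion (m : ℤ) (N : ℕ) {ψ : ℝ} (hψ : ψ < Real.pi) {ε : ℝ} (hε : 0 < ε) :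
    ∃ C : ℝ, ∀ l w : ℂ, |w.im| ≤ ψ → w.re = 0 → |(l + w).im| < Real.pi / 2 →
      ε * ‖Complex.exp l‖ ≤ (Complex.exp (l + w)).re → 1 ≤ ‖Complex.exp l‖ →
      ‖Complex.exp l * laplaceRay m l w -
        ∑ k ∈ Finset.range N, borelCoeff m k * ((Complex.exp l)⁻¹) ^ k‖ ≤
        C * (‖Complex.exp l‖⁻¹) ^ N := by
  obtain ⟨C, M, hC, hR⟩ := borelB_remainder m N hψ
  obtain ⟨K, hK, hp⟩ := pow_mul_exp_neg_le M (half_pos hε) one_pos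
  refine ⟨C * K * (N.factorial / (ε / 2) ^ (N + 1)), fun l w hw hw0 hlw hre hl => ?_⟩
  set X := ‖Complex.exp l‖
  have hX : 0 < X := by linarith
  have hw1 : ‖Complex.exp w‖ = 1 := by rw [Complex.norm_exp, hw0, Real.exp_zero]
  have hsum : Complex.exp l * laplaceRay m l w -
      ∑ k ∈ Finset.range N, borelCoeff m k * ((Complex.exp l)⁻¹) ^ k =
      Complex.exp l * ∫ r in Set.Ioi (0 : ℝ), (borelB m (r * Complex.exp w) -
        ∑ k ∈ Finset.range N, borelCoeff m k / (k.factorial : ℂ) * (r * Complex.exp w) ^ k) *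
        Complex.exp (-(Complex.exp l * (r * Complex.exp w))) * Complex.exp w := by
    have e : ∀ r : ℝ, (borelB m (r * Complex.exp w) -
        ∑ k ∈ Finset.range N, borelCoeff m k / (k.factorial : ℂ) * (r * Complex.exp w) ^ k) *
        Complex.exp (-(Complex.exp l * (r * Complex.exp w))) * Complex.exp w =
        rayIntegrand m l w r - ∑ k ∈ Finset.range N, borelCoeff m k / (k.factorial : ℂ) *
          ((r * Complex.exp w) ^ k * Complex.exp (-(Complex.exp l * (r * Complex.exp w))) *
            Complex.exp w) := fun r => by
      rw [rayIntegrand, sub_mul, sub_mul, Finset.sum_mul, Finset.sum_mul]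
      congr 1
      exact Finset.sum_congr rfl fun k _ => by ring
    have hi : ∀ k ∈ Finset.range N, IntegrableOn (fun r : ℝ => borelCoeff m k / (k.factorial : ℂ) *
          ((r * Complex.exp w) ^ k * Complex.exp (-(Complex.exp l * (r * Complex.exp w))) *
            Complex.exp w)) (Set.Ioi 0) := fun k _ =>
      (exp_mul_integral_ray_pow k hlw).1.const_mul _
    simp only [e]
    rw [integral_sub (integrableOn_rayIntegrand m (hw.trans_lt hψ) hlw) (integrable_finsetSum _ hi),
      integral_finsetSum _ hi, mul_sub, Finset.mul_sum]
    congr 1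
    refine Finset.sum_congr rfl fun k _ => ?_
    rw [integral_const_mul, mul_left_comm, (exp_mul_integral_ray_pow k hlw).2]
    have : (k.factorial : ℂ) ≠ 0 := by exact_mod_cast k.factorial_ne_zero
    field_simp
  have hεX : 0 < ε / 2 * X := by positivity
  have hbi := (integrableOn_pow_mul_exp_neg N (c := ((ε / 2 * X : ℝ) : ℂ))
    (by rw [Complex.ofReal_re]; exact hεX))
  have hbv := (integral_pow_mul_exp_neg N (c := ((ε / 2 * X : ℝ) : ℂ))
    (by rw [Complex.ofReal_re]; exact hεX))
  have hcast : ∀ r : ℝ, (r : ℂ) ^ N * Complex.exp (-(((ε / 2 * X : ℝ) : ℂ) * r)) =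
      ((r ^ N * Real.exp (-(ε / 2 * X * r)) : ℝ) : ℂ) := fun r => by push_cast; rfl
  simp only [hcast] at hbi hbv
  have hbi' : IntegrableOn (fun r : ℝ => r ^ N * Real.exp (-(ε / 2 * X * r))) (Set.Ioi 0) := by
    have h := hbi.re
    simp only [RCLike.re_to_complex, Complex.ofReal_re] at h
    exact h
  rw [integral_complex_ofReal] at hbv
  have hbv' : ∫ r in Set.Ioi (0 : ℝ), r ^ N * Real.exp (-(ε / 2 * X * r)) =
      N.factorial / (ε / 2 * X) ^ (N + 1) := by exact_mod_cast hbv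
  rw [hsum, norm_mul]
  have hmain : ‖∫ r in Set.Ioi (0 : ℝ), (borelB m (r * Complex.exp w) -
        ∑ k ∈ Finset.range N, borelCoeff m k / (k.factorial : ℂ) * (r * Complex.exp w) ^ k) *
        Complex.exp (-(Complex.exp l * (r * Complex.exp w))) * Complex.exp w‖ ≤
      ∫ r in Set.Ioi (0 : ℝ), C * K * (r ^ N * Real.exp (-(ε / 2 * X * r))) := by
    refine norm_integral_le_of_norm_le (hbi'.const_mul _)
      ((ae_restrict_iff' measurableSet_Ioi).mpr (Filter.Eventually.of_forall fun r hr => ?_))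
    have hr' : 0 ≤ r := le_of_lt hr
    have h1 := hR _ (mul_exp_mem_sector hr' hw)
    rw [norm_mul, Complex.norm_real, Real.norm_of_nonneg hr', hw1, mul_one] at h1
    have h2 := hp r hr'
    rw [mul_one] at h2
    -- The decay `e^{-εXr}` is split in two. By `X ≥ 1` one half becomes independent of `X` and
    -- absorbs `(1 + r)^M`; the other yields the power of `X`.
    have h3 : Real.exp (-((Complex.exp (l + w)).re * r)) ≤
        Real.exp (-(ε / 2 * r)) * Real.exp (-(ε / 2 * X * r)) := by
      rw [← Real.exp_add, Real.exp_le_exp]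
      have h4 : ε * X * r ≤ (Complex.exp (l + w)).re * r := mul_le_mul_of_nonneg_right hre hr'
      have h5 : ε / 2 * r * 1 ≤ ε / 2 * r * X := mul_le_mul_of_nonneg_left hl (by positivity)
      linarith
    have h6 : Real.exp (-(ε / 2 / 2 * r)) ≤ 1 := by
      rw [Real.exp_le_one_iff, neg_nonpos]; positivity
    rw [norm_mul, norm_mul, norm_exp_neg_mul_ray, hw1, mul_one]
    calc _ ≤ C * r ^ N * (1 + r) ^ M *
          (Real.exp (-(ε / 2 * r)) * Real.exp (-(ε / 2 * X * r))) := by gcongr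
      _ = C * r ^ N * Real.exp (-(ε / 2 * X * r)) * ((1 + r) ^ M * Real.exp (-(ε / 2 * r))) := by
        ring
      _ ≤ C * r ^ N * Real.exp (-(ε / 2 * X * r)) * K := by
        refine mul_le_mul_of_nonneg_left ?_ (by positivity)
        exact h2.trans (mul_le_of_le_one_right hK h6)
      _ = _ := by ring
  rw [integral_const_mul, hbv'] at hmain
  calc _ ≤ X * (C * K * (N.factorial / (ε / 2 * X) ^ (N + 1))) :=
        mul_le_mul_of_nonneg_left hmain hX.le
    _ = _ := by
      rw [mul_pow, inv_pow]
      field_simp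
      ring

/-- The asymptotic expansion of `√x e^x K_m(x)`, `x = e^l`. -/
theorem besselK_expansion (m : ℤ) (N : ℕ) {α : ℝ} (hα : α < 3 * Real.pi / 2) :
    ∃ C : ℝ, ∀ l : ℂ, |l.im| ≤ α → 1 ≤ ‖Complex.exp l‖ →
      ‖Complex.exp (l / 2) * (Complex.exp (Complex.exp l) * besselK m l) -
        ∑ k ∈ Finset.range N, borelCoeff m k * ((Complex.exp l)⁻¹) ^ k‖ ≤
        C * (‖Complex.exp l‖⁻¹) ^ N := by
  by_cases hα0 : 0 ≤ α
  swap
  · exact ⟨0, fun l hl => absurd ((abs_nonneg _).trans hl) hα0⟩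
  have hε : 0 < Real.cos (α / 3) :=
    Real.cos_pos_of_mem_Ioo ⟨by linarith [Real.pi_pos], by linarith⟩
  obtain ⟨C, hC⟩ := laplaceRay_expansion m N (ψ := 2 / 3 * α) (by linarith) hε
  refine ⟨C, fun l hl hl1 => ?_⟩
  -- The ray is turned back by two thirds of `arg x`. Then `|Im w| ≤ 2α/3 < π`, and `arg(x e^w) =
  -- arg x / 3` is at most `α/3 < π/2` in modulus, whence the constant `cos(α/3)`.
  set w : ℂ := ((-(2 / 3) * l.im : ℝ) : ℂ) * Complex.I
  have hwim : w.im = -(2 / 3) * l.im := by simp [w]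
  have hwre : w.re = 0 := by simp [w]
  have hlw : (l + w).im = l.im / 3 := by rw [Complex.add_im, hwim]; ring
  have h1 : |w.im| ≤ 2 / 3 * α := by
    rw [hwim, abs_mul, show |(-(2 / 3) : ℝ)| = 2 / 3 by norm_num]
    linarith
  have h2 : |(l + w).im| ≤ α / 3 := by
    rw [hlw, abs_div, show |(3 : ℝ)| = 3 by norm_num]; linarith
  have h3 : Real.cos (α / 3) * ‖Complex.exp l‖ ≤ (Complex.exp (l + w)).re := by
    rw [Complex.exp_re, Complex.norm_exp, Complex.add_re, hwre, add_zero, mul_comm]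
    refine mul_le_mul_of_nonneg_left ?_ (Real.exp_pos _).le
    rw [← Real.cos_abs (l + w).im]
    exact Real.cos_le_cos_of_nonneg_of_le_pi (abs_nonneg _) (by linarith) h2
  have h4 : |(l + w).im| < Real.pi / 2 := by linarith
  have h := hC l w h1 hwre h4 h3 hl1
  rw [laplace_borelB m (h1.trans_lt (by linarith)) h4, ← mul_assoc, ← Complex.exp_add, add_halves]
  exact h

/-! ### Residues of the formal solution at `p` -/

theorem norm_pt (φ : ℝ) : ‖pt φ‖ = 1 := Complex.norm_exp_ofReal_mul_I φ

theorem div_pt_mem_slitPlane {φ : ℝ} {z : ℂ} (hz : z ∈ Metric.closedBall (pt φ) (1 / 2)) :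
    z / pt φ ∈ Complex.slitPlane := by
  have hp := pt_ne_zero φ
  rw [mem_closedBall_iff_norm] at hz
  have h : ‖(z - pt φ) / pt φ‖ < 1 := by
    rw [norm_div, norm_pt, div_one]
    linarith
  have e : z / pt φ = 1 + (z - pt φ) / pt φ := by field_simp; ring
  rw [e]
  exact Complex.mem_slitPlane_of_norm_lt_one h

theorem ne_zero_of_div_pt_mem_slitPlane {φ : ℝ} {z : ℂ} (hz : z / pt φ ∈ Complex.slitPlane) :
    z ≠ 0 := by
  rintro rfl
  rw [zero_div] at hz
  exact Complex.slitPlane_ne_zero hz rfl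

theorem hasDerivAt_div_cpow {p z : ℂ} (a : ℂ) (hz : z / p ∈ Complex.slitPlane) :
    HasDerivAt (fun z : ℂ => (z / p) ^ a) (a * (z / p) ^ (a - 1) * p⁻¹) z := by
  have h := ((hasDerivAt_id z).div_const p).cpow_const (c := a) hz
  simpa [one_div] using h

theorem iteratedDeriv_div_cpow {p : ℂ} (a : ℂ) (j : ℕ) :
    ∀ z : ℂ, z / p ∈ Complex.slitPlane → iteratedDeriv j (fun z : ℂ => (z / p) ^ a) z =
      j.factorial * Ring.choose a j * (p⁻¹) ^ j * (z / p) ^ (a - j) := by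
  induction j with
  | zero => intro z _; simp
  | succ j ih =>
    intro z hz
    have hopen : {z : ℂ | z / p ∈ Complex.slitPlane} ∈ nhds z :=
      (Complex.isOpen_slitPlane.preimage (continuous_id.div_const p)).mem_nhds hz
    rw [iteratedDeriv_succ, Filter.EventuallyEq.deriv_eq
      (Filter.eventuallyEq_of_mem hopen ih),
      ((hasDerivAt_div_cpow (a - j) hz).const_mul _).deriv]
    have h := choose_succ_mul a j
    rw [Nat.factorial_succ, pow_succ]
    push_cast
    rw [show a - (j + 1 : ℂ) = a - j - 1 by ring]
    linear_combination (-(j.factorial : ℂ) * p⁻¹ ^ j * p⁻¹ * (z / p) ^ (a - j - 1)) * h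

theorem rootLam_ne_zero {u : ℂ} {φ : ℝ} {z : ℂ} (hz : z ≠ pt φ) : rootLam u φ z ≠ 0 := by
  have hp := pt_ne_zero φ
  refine mul_ne_zero (mul_ne_zero ?_ (neg_ne_zero.mpr (Complex.exp_ne_zero _)))
    (Complex.exp_ne_zero _)
  rw [sub_ne_zero, Ne, div_eq_one_iff_eq hp]
  exact hz

/-- The value of `e^{u/2} p^{-1/2}` chosen in `rootLam`. -/
def rootSlope (u : ℂ) (φ : ℝ) : ℂ := -Complex.exp ((u - φ * Complex.I) / 2)

theorem rootSlope_ne_zero (u : ℂ) (φ : ℝ) : rootSlope u φ ≠ 0 :=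
  neg_ne_zero.mpr (Complex.exp_ne_zero _)

/-- The factor `z/p - 1` of the root accounts for the whole pole; everything else is a constant
times `(z/p)^{n+k-1/2}`, holomorphic on the disc of integration. -/
theorem zpow_div_rootLam_pow {u : ℂ} {φ : ℝ} {z : ℂ} (hz : z / pt φ ∈ Complex.slitPlane)
    (hzp : z ≠ pt φ) (n : ℤ) (k : ℕ) :
    z ^ n / rootLam u φ z ^ (2 * k + 1) * (1 / z) =
      (1 / (z - pt φ) ^ (2 * k + 1)) •
        (pt φ ^ n * pt φ ^ (2 * k) * ((rootSlope u φ)⁻¹) ^ (2 * k + 1) *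
          (z / pt φ) ^ ((n : ℂ) + k - 1 / 2)) := by
  have hp := pt_ne_zero φ
  have hz0 := ne_zero_of_div_pt_mem_slitPlane hz
  have hw : z / pt φ ≠ 0 := div_ne_zero hz0 hp
  have hs := rootSlope_ne_zero u φ
  have hsub : z - pt φ ≠ 0 := sub_ne_zero.mpr hzp
  have hpow : Complex.exp (-(Complex.log (z / pt φ) / 2)) ^ (2 * k + 1) *
      (z / pt φ) ^ ((n : ℂ) + k - 1 / 2) = (z / pt φ) ^ (n - 1) := by
    rw [Complex.cpow_def_of_ne_zero hw, ← Complex.exp_nat_mul, ← Complex.exp_add,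
      ← Complex.cpow_intCast, Complex.cpow_def_of_ne_zero hw]
    congr 1
    push_cast
    ring
  have he := Complex.exp_ne_zero (-(Complex.log (z / pt φ) / 2))
  rw [smul_eq_mul, rootLam, ← rootSlope, mul_pow, mul_pow, div_sub_one hp, div_pow]
  have hz' : z ^ n * (1 / z) = pt φ ^ n * (pt φ)⁻¹ * (z / pt φ) ^ (n - 1) := by
    rw [div_zpow, zpow_sub_one₀ hz0, zpow_sub_one₀ hp]
    have := zpow_ne_zero n hp
    field_simp
  rw [div_mul_eq_mul_div, hz', ← hpow, inv_pow, pow_succ (pt φ) (2 * k)]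
  field_simp

open MeasureTheory in
-- Cauchy's formula for the pole of order `2k + 1` extracts the `2k`-th Taylor coefficient at `p`,
-- the binomial coefficient already present in `gCoeff`.
theorem circleIntegral_zpow_div_rootLam (u : ℂ) (φ : ℝ) (n : ℤ) (k : ℕ) :
    (∮ z in C(pt φ, 1 / 2), z ^ n / rootLam u φ z ^ (2 * k + 1) * (1 / z)) =
      2 * Real.pi * Complex.I * (pt φ ^ n * ((rootSlope u φ)⁻¹) ^ (2 * k + 1) *
        Ring.choose ((n : ℂ) + k - 1 / 2) (2 * k)) := by
  have hp := pt_ne_zero φ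
  have h12 : (0 : ℝ) < 1 / 2 := by norm_num
  rw [circleIntegral.integral_congr h12.le fun z hz => zpow_div_rootLam_pow
    (div_pt_mem_slitPlane (Metric.sphere_subset_closedBall hz))
    (Metric.ne_of_mem_sphere hz h12.ne') n k]
  rw [DifferentiableOn.circleIntegral_one_div_sub_center_pow_smul h12]
  · rw [iteratedDeriv_const_mul_field, iteratedDeriv_div_cpow]
    · rw [div_self hp, Complex.one_cpow, smul_eq_mul, inv_pow (pt φ)]
      have h1 : ((2 * k).factorial : ℂ) ≠ 0 := by exact_mod_cast (2 * k).factorial_ne_zero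
      field_simp
    · rw [div_self hp]; exact Complex.one_mem_slitPlane
  · intro z hz
    exact ((hasDerivAt_div_cpow _ (div_pt_mem_slitPlane hz)).differentiableAt.const_mul
      _).differentiableWithinAt

/-! ### Linearity of the formal coefficients in the test vector -/

theorem continuousOn_rootLam (u : ℂ) (φ : ℝ) :
    ContinuousOn (rootLam u φ) (Metric.closedBall (pt φ) (1 / 2)) := by
  unfold rootLam
  refine ContinuousOn.mul (by fun_prop) (Complex.continuous_exp.comp_continuousOn
    (ContinuousOn.neg (ContinuousOn.div_const (ContinuousOn.clog (by fun_prop)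
      fun z hz => div_pt_mem_slitPlane hz) 2)))

theorem continuousOn_dLamSigma (u σ : ℂ) (X : Test) :
    ContinuousOn (fun z => dLamSigma u σ z X) {z | z ≠ 0} := by
  have hz : ∀ n : ℤ, ContinuousOn (fun z : ℂ => z ^ n) {z | z ≠ 0} := fun n z hz =>
    (continuousAt_zpow₀ z n (Or.inl hz)).continuousWithinAt
  have hd : ContinuousOn (fun z : ℂ => Complex.exp u * X.2.2 / z) {z | z ≠ 0} :=
    ContinuousOn.div continuousOn_const continuousOn_id fun _ h => h
  unfold dLamSigma dLam dLamBar Finsupp.sum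
  refine ContinuousOn.add (ContinuousOn.mul continuousOn_const
    (((continuousOn_finsetSum _ fun n _ => ?_).add continuousOn_const).add hd))
    (ContinuousOn.mul continuousOn_const
    (((continuousOn_finsetSum _ fun n _ => ?_).sub continuousOn_const).sub hd))
  all_goals
    dsimp only
    split_ifs
    · exact continuousOn_const.mul (hz n)
    · exact continuousOn_const

theorem circleIntegrable_dLamSigma (u σ : ℂ) (φ : ℝ) (k : ℕ) (X : Test) :
    CircleIntegrable (fun z => dLamSigma u σ z X / rootLam u φ z ^ (2 * k + 1) * (1 / z))
      (pt φ) (1 / 2) := by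
  have h12 : (0 : ℝ) < 1 / 2 := by norm_num
  have h0 : ∀ z ∈ Metric.sphere (pt φ) (1 / 2), z ≠ 0 := fun z hz =>
    ne_zero_of_div_pt_mem_slitPlane (div_pt_mem_slitPlane (Metric.sphere_subset_closedBall hz))
  refine ContinuousOn.circleIntegrable h12.le (ContinuousOn.mul (ContinuousOn.div
    ((continuousOn_dLamSigma u σ X).mono h0)
    (((continuousOn_rootLam u φ).mono Metric.sphere_subset_closedBall).pow _)
    fun z hz => pow_ne_zero _ (rootLam_ne_zero (Metric.ne_of_mem_sphere hz h12.ne')))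
    (ContinuousOn.div continuousOn_const continuousOn_id h0))

theorem sum_coeff_add (g : ℤ → ℂ → ℂ) (h0 : ∀ n, g n 0 = 0)
    (h : ∀ n a b, g n (a + b) = g n a + g n b) (P Q : ℂ[T;T⁻¹]) :
    (P + Q).coeff.sum g = P.coeff.sum g + Q.coeff.sum g := by
  rw [AddMonoidAlgebra.coeff_add]
  exact Finsupp.sum_add_index' h0 h

theorem dLamSigma_add (u σ z : ℂ) (X Y : Test) :
    dLamSigma u σ z (X + Y) = dLamSigma u σ z X + dLamSigma u σ z Y := by
  have h1 := sum_coeff_add (fun n a => if n ≤ 0 then a * z ^ n else 0) (by simp)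
    (fun n a b => by split_ifs <;> ring) X.1 Y.1
  have h2 := sum_coeff_add (fun n a => if 1 ≤ n then a * z ^ n else 0) (by simp)
    (fun n a b => by split_ifs <;> ring) X.1 Y.1
  simp only [dLamSigma, dLam, dLamBar, Prod.fst_add, Prod.snd_add]
  rw [h1, h2]
  ring

theorem dLamSigma_smul (u σ z c : ℂ) (X : Test) :
    dLamSigma u σ z (c • X) = c * dLamSigma u σ z X := by
  simp only [dLamSigma, dLam, dLamBar, Prod.smul_fst, Prod.smul_snd, smul_eq_mul,
    AddMonoidAlgebra.coeff_smul]
  rw [Finsupp.sum_smul_index' (by simp), Finsupp.sum_smul_index' (by simp)]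
  simp only [Finsupp.sum, Finset.mul_sum, smul_eq_mul, mul_sub, mul_add, mul_ite, mul_zero,
    mul_assoc]
  simp only [← mul_assoc, mul_comm c, mul_div_assoc]
  ring

theorem dyFormalCoeff_add (u v : ℂ) (φ : ℝ) (k : ℕ) (X Y : Test) :
    dyFormalCoeff u v φ k (X + Y) = dyFormalCoeff u v φ k X + dyFormalCoeff u v φ k Y := by
  unfold dyFormalCoeff
  rw [← mul_add, ← circleIntegral.integral_add (circleIntegrable_dLamSigma _ _ _ _ _)
    (circleIntegrable_dLamSigma _ _ _ _ _)]
  simp only [dLamSigma_add, add_div, add_mul]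

theorem dyFormalCoeff_smul (u v : ℂ) (φ : ℝ) (k : ℕ) (c : ℂ) (X : Test) :
    dyFormalCoeff u v φ k (c • X) = c * dyFormalCoeff u v φ k X := by
  unfold dyFormalCoeff
  rw [mul_left_comm c, ← circleIntegral.integral_const_mul c]
  simp only [dLamSigma_smul, mul_div_assoc, mul_assoc]

/-! ### Matching the formal coefficients with those of the Bessel functions -/

theorem one_div_Gamma_half_sub (k : ℕ) :
    1 / Complex.Gamma (1 / 2 - k) = (-1) ^ k * Complex.Gamma (k + 1 / 2) / Real.pi := by
  have hpi : (Real.pi : ℂ) ≠ 0 := by exact_mod_cast Real.pi_ne_zero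
  have h := Complex.Gamma_mul_Gamma_one_sub (k + 1 / 2 : ℂ)
  have hs : Complex.sin (Real.pi * (k + 1 / 2 : ℂ)) = (-1) ^ k := by
    rw [show (Real.pi : ℂ) * (k + 1 / 2) = Real.pi * (k : ℤ) + Real.pi / 2 by push_cast; ring,
      Complex.sin_add_pi_div_two, cos_pi_mul_int, zpow_natCast]
  rw [hs, show (1 : ℂ) - (k + 1 / 2) = 1 / 2 - k by ring] at h
  have hk : ((-1 : ℂ)) ^ k ≠ 0 := pow_ne_zero _ (by norm_num)
  have hG : Complex.Gamma (1 / 2 - k) ≠ 0 := by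
    intro h0
    rw [h0, mul_zero] at h
    exact div_ne_zero hpi hk h.symm
  rw [div_eq_div_iff hG hpi, one_mul, mul_assoc, h]
  field_simp

/-- The coefficients of the formal series resummed by
`e^{l/2} e^x K_m(x) / (iπ)`, where `log x = logArg u φ l`. -/
def besselKCoeff (u : ℂ) (φ : ℝ) (m : ℤ) (k : ℕ) : ℂ :=
  Complex.exp (-(logArg u φ 0 / 2)) / (Complex.I * Real.pi) * borelCoeff m k *
    Complex.exp (-logArg u φ 0) ^ k

theorem exp_neg_logArg_zero (u : ℂ) (φ : ℝ) :
    2 * Complex.exp (-logArg u φ 0) = -(rootSlope u φ)⁻¹ ^ 2 := by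
  rw [rootSlope, inv_neg, neg_sq, ← Complex.exp_neg, ← Complex.exp_nat_mul, logArg]
  rw [show -(0 + Real.pi * Complex.I + Complex.log 2 + u - φ * Complex.I) =
    -(Real.pi * Complex.I) + -Complex.log 2 +
      ((2 : ℕ) : ℂ) * -((u - φ * Complex.I) / 2) by push_cast; ring,
    Complex.exp_add, Complex.exp_add, Complex.exp_neg, Complex.exp_neg (Complex.log 2),
    Complex.exp_pi_mul_I, Complex.exp_log two_ne_zero]
  ring

/-- Here the choices of branch meet: the sign in `rootSlope` and the convention `-1 = e^{iπ}` in
`logArg` fix the overall sign of the formal solution. -/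
theorem exp_neg_logArg_zero_half (u : ℂ) (φ : ℝ) :
    Complex.exp (-(logArg u φ 0 / 2)) * (2 : ℂ) ^ (-(1 / 2) : ℂ) =
      Complex.I / 2 * (rootSlope u φ)⁻¹ := by
  rw [rootSlope, inv_neg, ← Complex.exp_neg, logArg, Complex.cpow_def_of_ne_zero two_ne_zero,
    ← Complex.exp_add]
  rw [show -((0 + Real.pi * Complex.I + Complex.log 2 + u - φ * Complex.I) / 2) +
      Complex.log 2 * -(1 / 2) = -(Real.pi / 2 * Complex.I) + -Complex.log 2 +
      -((u - φ * Complex.I) / 2) by ring,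
    Complex.exp_add, Complex.exp_add, Complex.exp_neg, Complex.exp_neg (Complex.log 2),
    Complex.exp_pi_div_two_mul_I, Complex.exp_log two_ne_zero, Complex.inv_I]
  ring

theorem circleIntegral_eq_besselKCoeff (u : ℂ) (φ : ℝ) (n : ℤ) (k : ℕ) :
    1 / (2 * Complex.Gamma (1 / 2 - k)) * (1 / (2 * Real.pi * Complex.I)) *
      (∮ z in C(pt φ, 1 / 2), z ^ n / rootLam u φ z ^ (2 * k + 1) * (1 / z)) =
      pt φ ^ n * besselKCoeff u φ n k := by
  have hpi : (Real.pi : ℂ) ≠ 0 := by exact_mod_cast Real.pi_ne_zero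
  have h1 := exp_neg_logArg_zero_half u φ
  have h2 : (2 : ℂ) ^ k * Complex.exp (-logArg u φ 0) ^ k =
      (-1) ^ k * (rootSlope u φ)⁻¹ ^ (2 * k) := by
    rw [← mul_pow, exp_neg_logArg_zero, neg_pow, ← pow_mul]
  rw [circleIntegral_zpow_div_rootLam, besselKCoeff, borelCoeff, gCoeff,
    show 1 / (2 * Complex.Gamma (1 / 2 - k)) = 1 / 2 * (1 / Complex.Gamma (1 / 2 - k)) by
      rw [one_div_mul_one_div], one_div_Gamma_half_sub]
  set G := Complex.Gamma (k + 1 / 2)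
  set c := Ring.choose ((n : ℂ) + k - 1 / 2) (2 * k)
  calc _ = pt φ ^ n * (1 / (2 * Real.pi)) * G * c * (rootSlope u φ)⁻¹ *
        ((-1) ^ k * (rootSlope u φ)⁻¹ ^ (2 * k)) := by
        field_simp
        ring
    _ = pt φ ^ n * (1 / (Complex.I * Real.pi)) * G * c * (Complex.I / 2 * (rootSlope u φ)⁻¹) *
        ((2 : ℂ) ^ k * Complex.exp (-logArg u φ 0) ^ k) := by
        rw [h2]
        have := Complex.I_ne_zero
        field_simp
    _ = _ := by
        rw [← h1]
        ring

/-- The prefactor of the `n`-th coefficient of `ds`. -/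
def dsFactor (u : ℂ) (φ : ℝ) (n : ℤ) : ℂ :=
  if 1 ≤ n then Complex.exp u / pt φ ^ 2 + 1 else Complex.exp u / pt φ ^ 2

theorem dLamSigma_T (u v : ℂ) (φ : ℝ) (z : ℂ) (n : ℤ) :
    dLamSigma u (sigma u v (pt φ)) z (LaurentPolynomial.T n, 0, 0) =
      dsFactor u φ n * z ^ n := by
  have h : ∀ g : ℤ → ℂ → ℂ, (∀ n, g n 0 = 0) →
      (LaurentPolynomial.T n : ℂ[T;T⁻¹]).coeff.sum g = g n 1 := fun g hg => by
    rw [LaurentPolynomial.T, AddMonoidAlgebra.coeff_single]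
    exact Finsupp.sum_single_index (hg n)
  simp only [dLamSigma, dLam, dLamBar]
  rw [h _ (by simp), h _ (by simp), sigma_pt, dsFactor]
  by_cases hn : 1 ≤ n
  · rw [if_pos hn, if_neg (by omega), if_pos hn]; ring
  · rw [if_neg hn, if_pos (by omega), if_neg hn]; ring

theorem dyFormalCoeff_T (u v : ℂ) (φ : ℝ) (k : ℕ) (n : ℤ) :
    dyFormalCoeff u v φ k (LaurentPolynomial.T n, 0, 0) =
      dsFactor u φ n * pt φ ^ n * besselKCoeff u φ n k := by
  simp only [dyFormalCoeff, dLamSigma_T, mul_div_assoc, mul_assoc (dsFactor u φ n)]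
  rw [circleIntegral.integral_const_mul, mul_left_comm]
  congr 1
  exact circleIntegral_eq_besselKCoeff u φ n k

theorem dyFormalCoeff_v (u v : ℂ) (φ : ℝ) (k : ℕ) :
    dyFormalCoeff u v φ k (0, 1, 0) = besselKCoeff u φ 0 k := by
  have h := circleIntegral_eq_besselKCoeff u φ 0 k
  rw [zpow_zero, one_mul] at h
  rw [← h]
  simp [dyFormalCoeff, dLamSigma, dLam, dLamBar]

theorem dyFormalCoeff_u (u v : ℂ) (φ : ℝ) (k : ℕ) :
    dyFormalCoeff u v φ k (0, 0, 1) = Complex.exp u / pt φ * besselKCoeff u φ 1 k := by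
  have h := circleIntegral_eq_besselKCoeff u φ (-1) k
  have e : ∀ z : ℂ, dLamSigma u (sigma u v (pt φ)) z (0, 0, 1) = Complex.exp u * z ^ (-1 : ℤ) := by
    intro z
    simp [dLamSigma, dLam, dLamBar]
    ring
  simp only [dyFormalCoeff, e, mul_div_assoc, mul_assoc (Complex.exp u)]
  rw [circleIntegral.integral_const_mul, mul_left_comm, h]
  -- The residue involves `z^{-1}`, hence order `-1`, whereas `ds` is written with `K_1`.
  rw [besselKCoeff, besselKCoeff, borelCoeff, borelCoeff, gCoeff_one, zpow_neg_one]
  ring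

/-! ### Reduction to the basis of test vectors -/

theorem test_induction {motive : Test → Prop} (hadd : ∀ X Y, motive X → motive Y → motive (X + Y))
    (hsmul : ∀ (c : ℂ) X, motive X → motive (c • X))
    (hT : ∀ n : ℤ, motive (LaurentPolynomial.T n, 0, 0)) (hv : motive (0, 1, 0))
    (hu : motive (0, 0, 1)) (X : Test) : motive X := by
  have hP : ∀ P : ℂ[T;T⁻¹], motive (P, 0, 0) := by
    intro P
    induction P using LaurentPolynomial.induction_on' with
    | add P Q hP hQ => simpa using hadd _ _ hP hQ
    | C_mul_T n a =>
      have h := hsmul a _ (hT n)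
      simpa [LaurentPolynomial.smul_eq_C_mul] using h
  obtain ⟨P, a, b⟩ := X
  have h := hadd _ _ (hadd _ _ (hP P) (hsmul a _ hv)) (hsmul b _ hu)
  simpa using h

theorem weakDual_ext {ξ η : WeakDual}
    (hT : ∀ n : ℤ, ξ (LaurentPolynomial.T n, 0, 0) = η (LaurentPolynomial.T n, 0, 0))
    (hv : ξ (0, 1, 0) = η (0, 1, 0)) (hu : ξ (0, 0, 1) = η (0, 0, 1)) : ξ = η :=
  LinearMap.ext (test_induction (fun X Y hX hY => by rw [map_add, map_add, hX, hY])
    (fun c X hX => by rw [map_smul, map_smul, hX]) hT hv hu)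

theorem ofCoeffs_T (C : ℤ → ℂ) (Cv Cu : ℂ) (n : ℤ) :
    ofCoeffs C Cv Cu (LaurentPolynomial.T n, 0, 0) = C n := by
  have h : (LaurentPolynomial.T n : ℂ[T;T⁻¹]).coeff = Finsupp.single n 1 := by
    rw [LaurentPolynomial.T, AddMonoidAlgebra.coeff_single]
  simp [ofCoeffs, h]

theorem ofCoeffs_v (C : ℤ → ℂ) (Cv Cu : ℂ) : ofCoeffs C Cv Cu (0, 1, 0) = Cv := by
  simp [ofCoeffs]

theorem ofCoeffs_u (C : ℤ → ℂ) (Cv Cu : ℂ) : ofCoeffs C Cv Cu (0, 0, 1) = Cu := by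
  simp [ofCoeffs]

/-! ### Evaluation of `ds` on the basis -/

theorem logArg_eq (u : ℂ) (φ : ℝ) (l : ℂ) : logArg u φ l = l + logArg u φ 0 := by
  simp only [logArg]; ring

theorem exp_logArg (u : ℂ) (φ : ℝ) (l : ℂ) :
    Complex.exp (logArg u φ l) = -(2 * Complex.exp l * (Complex.exp u / pt φ)) := by
  rw [logArg, Complex.exp_sub, Complex.exp_add, Complex.exp_add, Complex.exp_add,
    Complex.exp_pi_mul_I, Complex.exp_log two_ne_zero, ← pt]
  ring

theorem canon_eq (u v : ℂ) (φ : ℝ) : canon u v φ = v + 2 * (Complex.exp u / pt φ) := by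
  have hp := pt_ne_zero φ
  rw [canon, sigma_pt]
  simp only [lamSigma, lam, lamBar]
  field_simp
  ring

theorem logArg_im (u : ℂ) (φ : ℝ) (l : ℂ) : (logArg u φ l).im = l.im + theta0 u φ := by
  have h : (Complex.log 2).im = 0 := by
    rw [Complex.log_im]; exact Complex.arg_ofReal_of_nonneg (x := 2) (by norm_num)
  simp [logArg, theta0, h]
  ring

/-- `e^{l/2} e^x K_m(x) / (iπ)`, where `log x = logArg u φ l`. -/
def scaledBesselK (u : ℂ) (φ : ℝ) (m : ℤ) (l : ℂ) : ℂ :=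
  Complex.exp (Complex.exp (logArg u φ l)) * Complex.exp (l / 2) * besselK m (logArg u φ l) /
    (Complex.I * Real.pi)

theorem exp_mul_exp_exp_logArg (u v : ℂ) (φ : ℝ) (l : ℂ) :
    Complex.exp (Complex.exp l * canon u v φ) * Complex.exp (Complex.exp (logArg u φ l)) =
      Complex.exp (Complex.exp l * v) := by
  rw [← Complex.exp_add, canon_eq, exp_logArg]
  congr 1
  ring

theorem ds_T (u v : ℂ) (φ : ℝ) (n : ℤ) (l : ℂ) :
    ds u v φ l (LaurentPolynomial.T n, 0, 0) = dsFactor u φ n * pt φ ^ n *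
      (Complex.exp (Complex.exp l * canon u v φ) * scaledBesselK u φ n l) := by
  rw [ds, ofCoeffs_T, ← exp_mul_exp_exp_logArg u v φ l, scaledBesselK, ← dsFactor]
  ring

theorem ds_v (u v : ℂ) (φ : ℝ) (l : ℂ) :
    ds u v φ l (0, 1, 0) =
      Complex.exp (Complex.exp l * canon u v φ) * scaledBesselK u φ 0 l := by
  rw [ds, ofCoeffs_v, ← exp_mul_exp_exp_logArg u v φ l, scaledBesselK]
  ring

theorem ds_u (u v : ℂ) (φ : ℝ) (l : ℂ) :
    ds u v φ l (0, 0, 1) = Complex.exp u / pt φ *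
      (Complex.exp (Complex.exp l * canon u v φ) * scaledBesselK u φ 1 l) := by
  rw [ds, ofCoeffs_u, ← exp_mul_exp_exp_logArg u v φ l, scaledBesselK]
  ring

/-! ### Closure properties of Borel sums and expansions -/

open MeasureTheory in
theorem IsBorelSum.add {a b : ℕ → ℂ} {θ : ℝ} {ζ s t : ℂ} (ha : IsBorelSum a θ ζ s)
    (hb : IsBorelSum b θ ζ t) : IsBorelSum (fun k => a k + b k) θ ζ (s + t) := by
  obtain ⟨D, F, h1, h2, h3, h4, h5, h6⟩ := ha
  obtain ⟨E, G, g1, g2, g3, g4, g5, g6⟩ := hb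
  refine ⟨D ∩ E, fun χ => F χ + G χ, h1.inter g1, fun t ht => ⟨h2 t ht, g2 t ht⟩,
    (h3.mono Set.inter_subset_left).add (g3.mono Set.inter_subset_right), ?_, ?_, ?_⟩
  · filter_upwards [h4, g4] with χ hF hG
    simpa only [add_div, add_mul] using hF.add hG
  · simp only [add_mul]
    exact h5.add g5
  · rw [h6, g6, ← mul_add, ← integral_add (h5.mul_const _) (g5.mul_const _)]
    simp only [add_mul]

open MeasureTheory in
theorem IsBorelSum.const_mul {a : ℕ → ℂ} {θ : ℝ} {ζ s : ℂ} (c : ℂ) (ha : IsBorelSum a θ ζ s) :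
    IsBorelSum (fun k => c * a k) θ ζ (c * s) := by
  obtain ⟨D, F, h1, h2, h3, h4, h5, h6⟩ := ha
  refine ⟨D, fun χ => c * F χ, h1, h2, h3.const_mul c, ?_, ?_, ?_⟩
  · filter_upwards [h4] with χ hF
    simpa only [mul_div_assoc, mul_assoc] using hF.mul_left c
  · simp only [mul_assoc c]
    exact h5.const_mul c
  · rw [h6, mul_left_comm, ← integral_const_mul]
    simp only [mul_assoc]

theorem HasExpansion.add {f g : ℂ → ℂ} {μ : ℂ} {a b : ℕ → ℂ} {θ₀ β : ℝ}
    (hf : HasExpansion f μ a θ₀ β) (hg : HasExpansion g μ b θ₀ β) :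
    HasExpansion (fun l => f l + g l) μ (fun k => a k + b k) θ₀ β := by
  intro α hα N
  obtain ⟨C, R, h⟩ := hf α hα N
  obtain ⟨C', R', h'⟩ := hg α hα N
  refine ⟨C + C', max R R', fun l hl hR => ?_⟩
  have e := norm_add_le_of_le (h l hl ((le_max_left _ _).trans hR))
    (h' l hl ((le_max_right _ _).trans hR))
  rw [add_mul]
  refine le_of_eq_of_le ?_ e
  simp only [add_mul, Finset.sum_add_distrib]
  congr 1
  ring

theorem HasExpansion.const_mul {f : ℂ → ℂ} {μ : ℂ} {a : ℕ → ℂ} {θ₀ β : ℝ} (c : ℂ)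
    (hf : HasExpansion f μ a θ₀ β) :
    HasExpansion (fun l => c * f l) μ (fun k => c * a k) θ₀ β := by
  intro α hα N
  obtain ⟨C, R, h⟩ := hf α hα N
  refine ⟨‖c‖ * C, R, fun l hl hR => ?_⟩
  have e := mul_le_mul_of_nonneg_left (h l hl hR) (norm_nonneg c)
  rw [← norm_mul] at e
  rw [mul_assoc]
  refine le_of_eq_of_le ?_ e
  rw [mul_sub, Finset.mul_sum]
  simp only [mul_assoc, mul_left_comm c]

/-! ### The Borel sum and the expansion of `scaledBesselK` -/

open MeasureTheory in
theorem isBorelSum_scaledBesselK (u : ℂ) {φ : ℝ} (m : ℤ) {θ : ℝ} {l : ℂ}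
    (hθ : |θ - theta0 u φ| < Real.pi) (hl : |l.im + θ| < Real.pi / 2) :
    IsBorelSum (besselKCoeff u φ m) θ (Complex.exp l) (scaledBesselK u φ m l) := by
  set L := logArg u φ 0 with hL
  -- The substitution `χ = s e^L`, `e^L = -2e^u/p`, gives `ζχ = xs` and sends the ray `e^{iθ}ℝ₊` to
  -- `e^w ℝ₊`. The condition `|θ - θ₀| < π` says that this ray avoids the cut of `borelB`.
  set w : ℂ := θ * Complex.I - L with hw
  have hwim : w.im = θ - theta0 u φ := by simp [hw, hL, logArg_im]
  have hw' : |w.im| < Real.pi := by rwa [hwim]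
  have hlw : |(logArg u φ l + w).im| < Real.pi / 2 := by
    rw [Complex.add_im, hwim, logArg_im]
    convert hl using 2
    ring
  have hew : ∀ t : ℝ, t * Complex.exp (θ * Complex.I) * Complex.exp (-L) = t * Complex.exp w := by
    intro t; rw [mul_assoc, ← Complex.exp_add, hw, sub_eq_add_neg]
  have hLw : Complex.exp L * Complex.exp w = Complex.exp (θ * Complex.I) := by
    rw [← Complex.exp_add, hw, add_sub_cancel]
  set c := Complex.exp (-(L / 2)) / (Complex.I * Real.pi) with hc
  have hint : ∀ t : ℝ, c * borelB m (t * Complex.exp (θ * Complex.I) * Complex.exp (-L)) *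
      Complex.exp (-(Complex.exp l * (t * Complex.exp (θ * Complex.I)))) *
      Complex.exp (θ * Complex.I) =
      c * Complex.exp L * rayIntegrand m (logArg u φ l) w t := by
    intro t
    rw [rayIntegrand, hew, logArg_eq, ← hL, Complex.exp_add l L, ← hLw]
    ring_nf
  refine ⟨{χ | χ * Complex.exp (-L) ∈ slitDomain}, fun χ => c * borelB m (χ * Complex.exp (-L)),
    isOpen_slitDomain.preimage (by fun_prop), fun t ht => ?_, ?_, ?_, ?_, ?_⟩
  · rw [Set.mem_ofPred_eq, hew]
    exact ray_mem_slitDomain hw' ht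
  · have hlin : DifferentiableOn ℂ (fun χ : ℂ => χ * Complex.exp (-L))
        {χ | χ * Complex.exp (-L) ∈ slitDomain} := by fun_prop
    exact ((differentiableOn_borelB m).comp hlin fun χ hχ => hχ).const_mul c
  · have hcont : Continuous fun χ : ℂ => ‖χ * Complex.exp (-L)‖ := by fun_prop
    have h0 : ∀ᶠ χ in nhds (0 : ℂ), ‖χ * Complex.exp (-L)‖ < 2 :=
      hcont.continuousAt.eventually_lt continuousAt_const (by simp)
    filter_upwards [h0] with χ hχ
    have e : (fun k : ℕ => besselKCoeff u φ m k / (k.factorial : ℂ) * χ ^ k) = fun k =>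
        c * (borelCoeff m k / (k.factorial : ℂ) * (χ * Complex.exp (-L)) ^ k) := by
      funext k
      rw [besselKCoeff, mul_pow]
      ring
    rw [e]
    exact (hasSum_borelB m hχ).mul_left c
  -- The integrability clause of `IsBorelSum` omits the Jacobian `e^{iθ}` of the ray, so it is
  -- divided out.
  · have h := ((integrableOn_rayIntegrand m hw' hlw).const_mul (c * Complex.exp L)).mul_const
      (Complex.exp (θ * Complex.I))⁻¹
    refine h.congr (Filter.Eventually.of_forall fun t => ?_)
    dsimp only
    rw [← hint, mul_inv_cancel_right₀ (Complex.exp_ne_zero _)]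
  · simp only [hint]
    rw [integral_const_mul, ← laplaceRay, scaledBesselK, mul_right_comm, laplace_borelB m hw' hlw,
      hc, mul_assoc, ← mul_assoc (Complex.exp l)]
    have e1 : Complex.exp (logArg u φ l / 2) * Complex.exp (l / 2) =
        Complex.exp l * (Complex.exp (-(L / 2)) * Complex.exp L) := by
      rw [← Complex.exp_add, ← Complex.exp_add, ← Complex.exp_add, logArg_eq, ← hL]
      congr 1
      ring
    linear_combination (laplaceRay m (logArg u φ l) w / (Complex.I * Real.pi)) * e1

theorem hasExpansion_scaledBesselK (u μ : ℂ) (φ : ℝ) (m : ℤ) :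
    HasExpansion (fun l => Complex.exp (Complex.exp l * μ) * scaledBesselK u φ m l) μ
      (besselKCoeff u φ m) (theta0 u φ) (3 * Real.pi / 2) := by
  intro α hα N
  obtain ⟨C, h⟩ := besselK_expansion m N hα
  set L := logArg u φ 0 with hL
  set c := Complex.exp (-(L / 2)) / (Complex.I * Real.pi) with hc
  -- The radius is chosen so that `|ζ| ≥ R` means `|x| ≥ 1`; the constant rescales `|x|^{-N}` to
  -- `|ζ|^{-N}`.
  refine ⟨‖c‖ * C * (‖Complex.exp L‖⁻¹) ^ N, ‖Complex.exp L‖⁻¹, fun l hl hR => ?_⟩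
  have hL0 : 0 < ‖Complex.exp L‖ := norm_pos_iff.mpr (Complex.exp_ne_zero _)
  have hn : Complex.exp (logArg u φ l) = Complex.exp l * Complex.exp L := by
    rw [logArg_eq, Complex.exp_add]
  have h1 : 1 ≤ ‖Complex.exp (logArg u φ l)‖ := by
    rw [hn, norm_mul]
    exact (inv_le_iff_one_le_mul₀ hL0).mp hR
  have h2 := mul_le_mul_of_nonneg_left (h (logArg u φ l) (by rwa [logArg_im]) h1) (norm_nonneg c)
  rw [← norm_mul, mul_sub, Finset.mul_sum, hn] at h2
  have e1 : c * Complex.exp (logArg u φ l / 2) = Complex.exp (l / 2) / (Complex.I * Real.pi) := by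
    rw [hc, div_mul_eq_mul_div, ← Complex.exp_add, logArg_eq, ← hL]
    congr 2
    ring
  have e2 : Complex.exp (-(Complex.exp l * μ)) * (Complex.exp (Complex.exp l * μ) *
      scaledBesselK u φ m l) = c * (Complex.exp (logArg u φ l / 2) *
        (Complex.exp (Complex.exp l * Complex.exp L) * besselK m (logArg u φ l))) := by
    rw [← mul_assoc, ← Complex.exp_add, neg_add_cancel, Complex.exp_zero, one_mul, ← mul_assoc c,
      e1, scaledBesselK, hn]
    ring
  have e3 : ∀ k : ℕ, c * (borelCoeff m k * (Complex.exp l * Complex.exp L)⁻¹ ^ k) =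
      besselKCoeff u φ m k * (Complex.exp l)⁻¹ ^ k := by
    intro k
    rw [besselKCoeff, Complex.exp_neg (logArg u φ 0), mul_inv, mul_pow]
    ring
  simp only [e3] at h2
  rw [e2]
  refine h2.trans (le_of_eq ?_)
  rw [norm_mul (Complex.exp l), mul_inv, mul_pow]
  ring

/-! ### The Dubrovin equation -/

theorem zDeriv_add (P Q : ℂ[T;T⁻¹]) : zDeriv (P + Q) = zDeriv P + zDeriv Q := by
  rw [zDeriv, AddMonoidAlgebra.coeff_add]
  exact Finsupp.sum_add_index' (by simp) fun n a b => by rw [mul_add, map_add, add_mul]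

theorem zDeriv_smul (c : ℂ) (P : ℂ[T;T⁻¹]) : zDeriv (c • P) = c • zDeriv P := by
  rw [zDeriv, zDeriv, AddMonoidAlgebra.coeff_smul, Finsupp.sum_smul_index' (by simp), Finsupp.sum,
    Finsupp.sum, Finset.smul_sum]
  refine Finset.sum_congr rfl fun n _ => ?_
  rw [smul_eq_mul, mul_left_comm, map_mul, mul_assoc, LaurentPolynomial.smul_eq_C_mul]

theorem opU_add (u v : ℂ) (X Y : Test) : opU u v (X + Y) = opU u v X + opU u v Y := by
  simp only [opU, Prod.fst_add, Prod.snd_add, AddMonoidAlgebra.coeff_add, Finsupp.add_apply,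
    Prod.mk_add_mk, map_add, mul_add]
  refine Prod.ext ?_ (Prod.ext ?_ ?_) <;> dsimp only <;> ring

theorem opU_smul (u v c : ℂ) (X : Test) : opU u v (c • X) = c • opU u v X := by
  simp only [opU, Prod.smul_fst, Prod.smul_snd, AddMonoidAlgebra.coeff_smul, Finsupp.smul_apply,
    Prod.smul_mk, smul_eq_mul]
  simp only [LaurentPolynomial.smul_eq_C_mul, map_mul]
  refine Prod.ext ?_ (Prod.ext ?_ ?_) <;> dsimp only <;> ring

theorem opV_add (X Y : Test) : opV (X + Y) = opV X + opV Y := by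
  simp only [opV, Prod.fst_add, Prod.snd_add, zDeriv_add, Prod.mk_add_mk, smul_add]
  refine Prod.ext ?_ (Prod.ext ?_ ?_) <;> dsimp only <;> ring

theorem opV_smul (c : ℂ) (X : Test) : opV (c • X) = c • opV X := by
  simp only [opV, Prod.smul_fst, Prod.smul_snd, zDeriv_smul, Prod.smul_mk, smul_eq_mul]
  simp only [LaurentPolynomial.smul_eq_C_mul]
  refine Prod.ext ?_ (Prod.ext ?_ ?_) <;> dsimp only <;> ring

theorem coeff_T (n : ℤ) : (LaurentPolynomial.T n : ℂ[T;T⁻¹]).coeff = Finsupp.single n 1 := by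
  rw [LaurentPolynomial.T, AddMonoidAlgebra.coeff_single]

theorem opU_T (u v : ℂ) (n : ℤ) :
    opU u v (LaurentPolynomial.T n, 0, 0) = v • (LaurentPolynomial.T n, 0, 0) +
      (2 * Complex.exp u) • (LaurentPolynomial.T (n - 1), 0, 0) +
      (if n = 1 then 2 * Complex.exp u else 0) • (0, 1, 0) := by
  have h : (LaurentPolynomial.T (n - 1) : ℂ[T;T⁻¹]) =
      LaurentPolynomial.T (-1) * LaurentPolynomial.T n := by
    rw [← LaurentPolynomial.T_add, neg_add_eq_sub]
  refine Prod.ext ?_ (Prod.ext ?_ ?_)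
  · simp only [opU, Prod.fst_add, Prod.smul_fst, smul_zero, mul_zero, map_zero, add_zero,
      LaurentPolynomial.smul_eq_C_mul, h]
    ring
  · simp only [opU, coeff_T, Finsupp.single_apply, Prod.snd_add, Prod.fst_add, Prod.smul_snd,
      Prod.smul_fst, smul_eq_mul, mul_ite, mul_one, mul_zero, add_zero, zero_add]
  · simp only [opU, Prod.snd_add, Prod.smul_snd, smul_eq_mul, mul_zero, add_zero]

theorem opU_v (u v : ℂ) : opU u v (0, 1, 0) = v • (0, 1, 0) + (2 : ℂ) • (0, 0, 1) := by
  simp [opU]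

theorem opU_u (u v : ℂ) : opU u v (0, 0, 1) =
    (2 * Complex.exp u) • (LaurentPolynomial.T 0, 0, 0) + v • (0, 0, 1) := by
  simp [opU, LaurentPolynomial.smul_eq_C_mul]

theorem opV_T (n : ℤ) :
    opV (LaurentPolynomial.T n, 0, 0) = ((n : ℂ) - 1 / 2) • (LaurentPolynomial.T n, 0, 0) := by
  have h : zDeriv (LaurentPolynomial.T n) = (n : ℂ) • LaurentPolynomial.T n := by
    rw [zDeriv, coeff_T, Finsupp.sum_single_index (by simp), mul_one,
      LaurentPolynomial.smul_eq_C_mul]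
  refine Prod.ext ?_ (Prod.ext ?_ ?_)
  · simp only [opV, h, Prod.smul_fst]
    rw [sub_smul]
    abel
  · simp [opV]
  · simp [opV]

theorem opV_v : opV (0, 1, 0) = (-(1 / 2) : ℂ) • (0, 1, 0) := by
  simp [opV, zDeriv]

theorem opV_u : opV (0, 0, 1) = (1 / 2 : ℂ) • (0, 0, 1) := by
  simp [opV, zDeriv]

theorem hasDerivAt_logArg (u : ℂ) (φ : ℝ) (l : ℂ) : HasDerivAt (logArg u φ) 1 l :=
  ((((hasDerivAt_id l).add_const _).add_const _).add_const _).sub_const _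

theorem hasDerivAt_exp_mul_besselK (u v : ℂ) (φ : ℝ) {m : ℤ} {l K : ℂ}
    (h : HasDerivAt (fun l => besselK m l) K (logArg u φ l)) :
    HasDerivAt (fun l => Complex.exp (Complex.exp l * v) * Complex.exp (l / 2) *
        besselK m (logArg u φ l))
      (Complex.exp (Complex.exp l * v) * Complex.exp (l / 2) *
        ((Complex.exp l * v + 1 / 2) * besselK m (logArg u φ l) + K)) l := by
  have h1 := ((Complex.hasDerivAt_exp l).mul_const v).cexp
  have h2 := ((hasDerivAt_id l).div_const 2).cexp
  have h3 := h.comp l (hasDerivAt_logArg u φ l)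
  refine ((h1.mul h2).mul h3).congr_deriv ?_
  simp only [Function.comp, id, Pi.mul_apply]
  ring

theorem isWeakSolution_ds (u v : ℂ) (φ : ℝ) : IsWeakSolution u v (ds u v φ) := by
  have hp := pt_ne_zero φ
  intro X l
  have hl := Complex.exp_ne_zero l
  have hx := exp_logArg u φ l
  induction X using test_induction with
  | hadd X Y hX hY =>
    simp only [map_add]
    refine (hX.add hY).congr_deriv ?_
    rw [opU_add, opV_add, ← mul_add, ← map_add, smul_add]
    congr 2
    abel
  | hsmul c X hX =>
    simp only [map_smul, smul_eq_mul]
    refine (hX.const_mul c).congr_deriv ?_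
    rw [opU_smul, opV_smul, smul_comm, ← smul_sub, map_smul, smul_eq_mul]
    ring
  | hT n =>
    simp only [opU_T, opV_T, map_sub, map_add, map_smul, smul_eq_mul]
    simp only [ds, ofCoeffs_T, ofCoeffs_v]
    have h := (hasDerivAt_exp_mul_besselK u v φ (hasDerivAt_besselK n (logArg u φ l))).const_mul
      (1 / (Complex.I * Real.pi) * (if 1 ≤ n then Complex.exp u / pt φ ^ 2 + 1 else
        Complex.exp u / pt φ ^ 2) * pt φ ^ n)
    simp only [← mul_assoc] at h
    refine h.congr_deriv ?_
    rw [hx, zpow_sub_one₀ hp]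
    have hn := zpow_ne_zero n hp
    -- Away from `n = 1`, orders `n` and `n - 1` have the same prefactor and the lowering recurrence
    -- suffices. At `n = 1` the prefactor drops from `e^u/p² + 1` to `e^u/p²`, and the missing `K_0`
    -- term is the `e_v` component of `U e_1`.
    rcases lt_trichotomy n 1 with h1 | rfl | h1
    · rw [if_neg (by omega), if_neg (by omega), if_neg (by omega)]
      field_simp
      ring
    · rw [if_pos le_rfl, if_neg (by omega), if_pos rfl, sub_self, zpow_one]
      field_simp
      ring
    · rw [if_pos (by omega), if_pos (by omega), if_neg (by omega)]
      field_simp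
      ring
  | hv =>
    simp only [opU_v, opV_v, map_sub, map_add, map_smul, smul_eq_mul]
    simp only [ds, ofCoeffs_v, ofCoeffs_u]
    -- `U e_v` contains `e_u`, whose coefficient involves `K_1`, so the raising recurrence is the
    -- relevant one here.
    have h := (hasDerivAt_exp_mul_besselK u v φ (hasDerivAt_besselK' 0 (logArg u φ l))).const_mul
      (1 / (Complex.I * Real.pi))
    simp only [← mul_assoc] at h
    refine h.congr_deriv ?_
    rw [hx, zero_add, Int.cast_zero]
    field_simp
    ring
  | hu =>
    simp only [opU_u, opV_u, map_sub, map_add, map_smul, smul_eq_mul]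
    simp only [ds, ofCoeffs_T, ofCoeffs_u]
    have h := (hasDerivAt_exp_mul_besselK u v φ (hasDerivAt_besselK 1 (logArg u φ l))).const_mul
      (1 / (Complex.I * Real.pi) * (Complex.exp u / pt φ))
    simp only [← mul_assoc] at h
    refine h.congr_deriv ?_
    rw [hx, sub_self, Int.cast_one, if_neg (by omega), zpow_zero]
    field_simp
    ring

/-! ### Borel resummation and asymptotic expansion -/

theorem isBorelSum_ds (u v : ℂ) (φ : ℝ) (X : Test) (θ : ℝ) (l : ℂ)
    (hθ : |θ - theta0 u φ| < Real.pi) (hl : |l.im + θ| < Real.pi / 2) :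
    IsBorelSum (fun k => dyFormalCoeff u v φ k X) θ (Complex.exp l)
      (Complex.exp (-(Complex.exp l * canon u v φ)) * ds u v φ l X) := by
  have he : ∀ a b : ℂ, Complex.exp (-(Complex.exp l * canon u v φ)) *
      (a * (Complex.exp (Complex.exp l * canon u v φ) * b)) = a * b := by
    intro a b
    rw [mul_left_comm, ← mul_assoc (Complex.exp _), ← Complex.exp_add, neg_add_cancel,
      Complex.exp_zero, one_mul]
  have h := fun m => isBorelSum_scaledBesselK u m hθ hl
  induction X using test_induction with
  | hadd X Y hX hY => simpa only [dyFormalCoeff_add, map_add, mul_add] using hX.add hY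
  | hsmul c X hX =>
    simpa only [dyFormalCoeff_smul, map_smul, smul_eq_mul, mul_left_comm] using hX.const_mul c
  | hT n => simpa only [dyFormalCoeff_T, ds_T, he] using (h n).const_mul _
  | hv =>
    have := he 1
    simp only [one_mul] at this
    simpa only [dyFormalCoeff_v, ds_v, this] using h 0
  | hu => simpa only [dyFormalCoeff_u, ds_u, he] using (h 1).const_mul _

theorem hasExpansion_ds (u v : ℂ) (φ : ℝ) (X : Test) :
    HasExpansion (fun l => ds u v φ l X) (canon u v φ) (fun k => dyFormalCoeff u v φ k X)
      (theta0 u φ) (3 * Real.pi / 2) := by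
  have h := hasExpansion_scaledBesselK u (canon u v φ) φ
  induction X using test_induction with
  | hadd X Y hX hY => simpa only [dyFormalCoeff_add, map_add] using hX.add hY
  | hsmul c X hX =>
    simpa only [dyFormalCoeff_smul, map_smul, smul_eq_mul] using hX.const_mul c
  | hT n => simpa only [dyFormalCoeff_T, ds_T] using (h n).const_mul _
  | hv => simpa only [dyFormalCoeff_v, ds_v] using h 0
  | hu => simpa only [dyFormalCoeff_u, ds_u] using (h 1).const_mul _

/-! ### Monodromy -/

theorem pt_sub_pi (φ : ℝ) : pt (φ - Real.pi) = -pt φ := by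
  rw [pt, pt, Complex.ofReal_sub, sub_mul, Complex.exp_sub, Complex.exp_pi_mul_I, div_neg, div_one]

theorem logArg_sub_pi (u : ℂ) (φ : ℝ) (l : ℂ) :
    logArg u (φ - Real.pi) l = logArg u φ l + Real.pi * Complex.I := by
  simp only [logArg, Complex.ofReal_sub]
  ring

theorem logArg_add (u : ℂ) (φ : ℝ) (l w : ℂ) : logArg u φ (l + w) = logArg u φ l + w := by
  simp only [logArg]
  ring

theorem logArg_sub (u : ℂ) (φ : ℝ) (l w : ℂ) : logArg u φ (l - w) = logArg u φ l - w := by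
  simp only [logArg]
  ring

theorem exp_add_two_pi_mul_I_div_two (l : ℂ) :
    Complex.exp ((l + 2 * Real.pi * Complex.I) / 2) = -Complex.exp (l / 2) := by
  rw [add_div, show 2 * Real.pi * Complex.I / 2 = Real.pi * Complex.I by ring, Complex.exp_add,
    Complex.exp_pi_mul_I]
  ring

theorem exp_sub_two_pi_mul_I_div_two (l : ℂ) :
    Complex.exp ((l - 2 * Real.pi * Complex.I) / 2) = -Complex.exp (l / 2) := by
  rw [← neg_eq_iff_eq_neg, ← exp_add_two_pi_mul_I_div_two, sub_add_cancel]

theorem neg_one_zpow_mul_self (m : ℤ) : (-1 : ℂ) ^ m * (-1) ^ m = 1 := by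
  rw [← mul_zpow]; norm_num

/-- Passing from `p` to `e^{-iπ}p` turns `x` into `xe^{iπ}` and `p^m` into `(-1)^m p^m`. The latter
sign cancels the one in the connection formula, and `ζ^{1/2} ↦ -ζ^{1/2}` yields the coefficients `1`
and `-2`. -/
theorem ds_add_two_pi_mul_I (u v : ℂ) (φ : ℝ) (l : ℂ) :
    ds u v φ (l + 2 * Real.pi * Complex.I) =
      ds u v φ l - (2 : ℂ) • ds u v (φ - Real.pi) l := by
  have hK : ∀ m : ℤ, besselK m (logArg u φ l + 2 * Real.pi * Complex.I) =
      2 * (-1) ^ m * besselK m (logArg u φ l + Real.pi * Complex.I) -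
        besselK m (logArg u φ l) := fun m => by
    have h := besselK_add_sub m (logArg u φ l + Real.pi * Complex.I)
    rw [add_sub_cancel_right, add_assoc, ← two_mul, ← mul_assoc] at h
    rw [← h, add_sub_cancel_right]
  refine weakDual_ext (fun n => ?_) ?_ ?_
  all_goals
    rw [LinearMap.sub_apply, LinearMap.smul_apply, smul_eq_mul]
    simp only [ds, ofCoeffs_T, ofCoeffs_v, ofCoeffs_u, pt_sub_pi, logArg_sub_pi, logArg_add, hK,
      exp_add_two_pi_mul_I_div_two, Complex.exp_periodic l]
  · rw [neg_sq, ← neg_one_mul (pt φ), mul_zpow]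
    ring
  · rw [zpow_zero]
    ring
  · rw [zpow_one, div_neg]
    ring

theorem ds_sub_two_pi_mul_I (u v : ℂ) (φ : ℝ) (l : ℂ) :
    ds u v (φ - Real.pi) (l - 2 * Real.pi * Complex.I) =
      ds u v (φ - Real.pi) l - (2 : ℂ) • ds u v φ l := by
  have hK : ∀ m : ℤ, besselK m (logArg u φ l + Real.pi * Complex.I - 2 * Real.pi * Complex.I) =
      2 * (-1) ^ m * besselK m (logArg u φ l) -
        besselK m (logArg u φ l + Real.pi * Complex.I) := fun m => by
    rw [← besselK_add_sub m (logArg u φ l), add_sub_cancel_left]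
    congr 1
    ring
  refine weakDual_ext (fun n => ?_) ?_ ?_
  all_goals
    rw [LinearMap.sub_apply, LinearMap.smul_apply, smul_eq_mul]
    simp only [ds, ofCoeffs_T, ofCoeffs_v, ofCoeffs_u, pt_sub_pi, logArg_sub_pi, logArg_sub, hK,
      exp_sub_two_pi_mul_I_div_two, Complex.exp_periodic.sub_eq l]
  · rw [neg_sq, ← neg_one_mul (pt φ), mul_zpow]
    -- Here the signs `(-1)^n` of the connection formula and of `(-p)^n` meet in one term and square
    -- to `1`.
    linear_combination (-2 * (1 / (Complex.I * Real.pi) *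
      (if 1 ≤ n then Complex.exp u / pt φ ^ 2 + 1 else Complex.exp u / pt φ ^ 2) * pt φ ^ n *
      Complex.exp (Complex.exp l * v) * Complex.exp (l / 2) * besselK n (logArg u φ l))) *
      neg_one_zpow_mul_self n
  · rw [zpow_zero]
    ring
  · rw [zpow_one, div_neg]
    ring

end TodaDubrovin

end

theorem mainTheorem5 (u v : ℂ) (hu : ‖Complex.exp u‖ < 1) (φ : ℝ) :
    -- weak solution of the Dubrovin equation
    TodaDubrovin.IsWeakSolution u v (TodaDubrovin.ds u v φ) ∧
    -- Borel resummation of the formal integral solution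
    (∀ (X : TodaDubrovin.Test) (θ : ℝ) (l : ℂ),
      |θ - TodaDubrovin.theta0 u φ| < Real.pi → |l.im + θ| < Real.pi / 2 →
      TodaDubrovin.IsBorelSum (fun k => TodaDubrovin.dyFormalCoeff u v φ k X) θ (Complex.exp l)
        (Complex.exp (-(Complex.exp l * TodaDubrovin.canon u v φ)) *
          TodaDubrovin.ds u v φ l X)) ∧
    -- asymptotic expansion in a sector of opening `3π`
    (∀ X : TodaDubrovin.Test,
      TodaDubrovin.HasExpansion (fun l => TodaDubrovin.ds u v φ l X)
        (TodaDubrovin.canon u v φ) (fun k => TodaDubrovin.dyFormalCoeff u v φ k X)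
        (TodaDubrovin.theta0 u φ) (3 * Real.pi / 2)) ∧
    -- monodromy, where `-p` stands for `e^{-iπ} p`
    (∀ l : ℂ, TodaDubrovin.ds u v φ (l + 2 * Real.pi * Complex.I) =
      TodaDubrovin.ds u v φ l - (2 : ℂ) • TodaDubrovin.ds u v (φ - Real.pi) l) ∧
    (∀ l : ℂ, TodaDubrovin.ds u v (φ - Real.pi) (l - 2 * Real.pi * Complex.I) =
      TodaDubrovin.ds u v (φ - Real.pi) l - (2 : ℂ) • TodaDubrovin.ds u v φ l) :=
  ⟨TodaDubrovin.isWeakSolution_ds u v φ, TodaDubrovin.isBorelSum_ds u v φ,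
    TodaDubrovin.hasExpansion_ds u v φ, TodaDubrovin.ds_add_two_pi_mul_I u v φ,
    TodaDubrovin.ds_sub_two_pi_mul_I u v φ⟩
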